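/- Conventions. A variety over a field $F$ is a separated scheme of finite type over $F$ (possibly non-reduced or reducible); $|B|$ denotes its set of closed points. If $B$ is an $F$-variety and $F$ is embedded in $\overline{\mathbb Q}$, the subset of $B(\overline{\mathbb Q})$ associated to a set $S \subseteq |B|$ is the set of $\overline{\mathbb Q}$-points whose underlying closed point lies in $S$. A morphism to an irreducible variety is generically finite if it is finite over some nonempty open subscheme of the target; if it is moreover dominant with irreducible source, its degree $\deg\pi$ is the degree of the extension of residue fields at the generic points. A set $S \subseteq |B|$ is sparse if there is a dominant and generically finite morphism $\pi\colon B' \to B$ of irreducible $F$-varieties such that for each $s \in S$ the fiber $\pi^{-1}(s)$ is either empty or contains more than one closed point. The sets $B(\mathbb C_p)$ carry the $p$-adic topology. Proposition. (i) Let $p$ be a prime and let $F$ be a number field. Fix embeddings $F \subseteq \overline{\mathbb Q} \subseteq \mathbb C_p$. Let $\pi\colon B' \to B$ be any dominant and generically finite morphism of irreducible $F$-varieties such that $\dim B > 0$ and $\deg \pi > 1$. Then the set $$\{ b \in |B| : \pi^{-1}(b) \text{ is not a single closed point}\}$$ is sparse, and the associated subset of $B(\overline{\mathbb Q})$ is dense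 in $B(\mathbb C_p)$. (ii) There exists a non-sparse subset $S$ of $|\mathbb A^1_{\mathbb Q}|$, namely the set $S = \mathbb Q$ of rational points, such that for every prime $p$ and all embeddings $\mathbb Q \subseteq \overline{\mathbb Q} \subseteq \mathbb C_p$, the associated subset of $\mathbb A^1(\overline{\mathbb Q})$ is nowhere dense in $\mathbb A^1(\mathbb C_p)$. -/

import Mathlib

open AlgebraicGeometry CategoryTheory

universe u

namespace SparseDense

/-- A scheme `X` with structure morphism `s : X ⟶ Spec F` is an `F`-variety if it is separated and
of finite type over `F` (it may be non-reduced or reducible). -/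
structure IsVariety {F : Type u} [Field F] {X : Scheme.{u}} (s : X ⟶ Spec (.of F)) : Prop where
  separated : IsSeparated s
  locallyOfFiniteType : LocallyOfFiniteType s
  quasiCompact : QuasiCompact s

/-- A morphism to an irreducible scheme is generically finite if it is finite over some nonempty
(hence dense) open subscheme of the target. -/
def IsGenericallyFinite {X Y : Scheme.{u}} (f : X ⟶ Y) : Prop :=
  ∃ V : Y.Opens, (V : Set Y).Nonempty ∧ IsFinite (f ∣_ V)

/-- The degree of a dominant generically finite morphism `f : X ⟶ Y` of irreducible schemes:
the degree of `κ(X)` over `κ(Y)`, where the function field of an irreducible (possibly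
non-reduced) scheme is the residue field at its generic point. -/
noncomputable def genericDegree {X Y : Scheme.{u}} [IrreducibleSpace X] (f : X ⟶ Y) : ℕ :=
  f.residueDegree (genericPoint X)

/-- A set `S` of closed points of an irreducible `F`-variety `B` is sparse if there is a dominant
and generically finite `F`-morphism `π : B' ⟶ B` from an irreducible `F`-variety such that every
fiber `π⁻¹(b)` with `b ∈ S` is empty or contains more than one closed point. As `b` is closed,
a point of the fiber is closed in the fiber if and only if it is closed in `B'`. -/
def IsSparse {F : Type u} [Field F] {B : Scheme.{u}} (s : B ⟶ Spec (.of F))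
    (S : Set (closedPoints B)) : Prop :=
  ∃ (B' : Scheme.{u}) (s' : B' ⟶ Spec (.of F)) (π : B' ⟶ B),
    IsVariety s' ∧ IrreducibleSpace B' ∧ π ≫ s = s' ∧ IsDominant π ∧ IsGenericallyFinite π ∧
    ∀ b ∈ S, π ⁻¹' {(b : B)} = ∅ ∨ (π ⁻¹' {(b : B)} ∩ closedPoints B').Nontrivial

/-- The set of closed points `b` of `B` such that `π⁻¹(b)` is not a single closed point. -/
def nonSingletonFibers {B' B : Scheme.{u}} (π : B' ⟶ B) : Set (closedPoints B) :=
  {b | ¬ ∃ b' ∈ closedPoints B', π ⁻¹' {(b : B)} = {b'}}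

/-- The set `X(K)` of `K`-points of the `F`-scheme `s : X ⟶ Spec F`, where `K` is viewed as an
extension of `F` through `i : F →+* K`. -/
def Points {F K : Type u} [Field F] [Field K] (i : F →+* K) {X : Scheme.{u}}
    (s : X ⟶ Spec (.of F)) : Type u :=
  {x : Spec (.of K) ⟶ X // x ≫ s = Spec.map (CommRingCat.ofHom i)}

namespace Points

variable {F L K : Type u} [Field F] [Field L] [Field K] {X : Scheme.{u}} {s : X ⟶ Spec (.of F)}

/-- The point of the scheme `X` underlying a `K`-point. -/
noncomputable def point {i : F →+* K} (x : Points i s) : X :=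
  x.1 (IsLocalRing.closedPoint K)

/-- The map `X(L) → X(K)` induced by an embedding `j : L →+* K`. -/
noncomputable def map {i : F →+* L} (j : L →+* K) (x : Points i s) : Points (j.comp i) s :=
  ⟨Spec.map (CommRingCat.ofHom j) ≫ x.1, by
    rw [Category.assoc, x.2, ← Spec.map_comp, ← CommRingCat.ofHom_comp]⟩

/-- For an affine open `ι : Spec A ⟶ X`, a function `a` on it and a subset `V` of `K`, the set of
`K`-points of `X` that lie in the affine open and at which `a` takes a value in `V`. -/
def basicSet (i : F →+* K) (s : X ⟶ Spec (.of F)) {A : CommRingCat.{u}} (ι : Spec A ⟶ X) (a : A)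
    (V : Set K) : Set (Points i s) :=
  {x | ∃ φ : A ⟶ .of K, Spec.map φ ≫ ι = x.1 ∧ φ.hom a ∈ V}

/-- The topology on `X(K)` induced by a topology on `K`: the one generated by requiring that
`U(K)` is open in `X(K)` for each affine open `U` of `X`, and that each regular function on `U` is
continuous on `U(K)`. -/
instance [TopologicalSpace K] (i : F →+* K) (s : X ⟶ Spec (.of F)) :
    TopologicalSpace (Points i s) :=
  TopologicalSpace.generateFrom
    {W | ∃ (A : CommRingCat.{u}) (ι : Spec A ⟶ X) (a : A) (V : Set K),
      IsOpenImmersion ι ∧ IsOpen V ∧ W = basicSet i s ι a V}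

end Points

/-- The subset of `X(K)` associated to a set `S` of closed points of `X`: the `K`-points whose
underlying point lies in `S`. -/
def associatedPoints {F K : Type u} [Field F] [Field K] (i : F →+* K) {X : Scheme.{u}}
    (s : X ⟶ Spec (.of F)) (S : Set (closedPoints X)) : Set (Points i s) :=
  {x | ∃ b ∈ S, (b : X) = x.point}

/-- The set of closed points of `X` that underlie an `F`-rational point; it is identified
with `X(F)`. -/
def rationalClosedPoints {F : Type u} [Field F] {X : Scheme.{u}} (s : X ⟶ Spec (.of F)) :
    Set (closedPoints X) :=
  {b | ∃ x : Points (RingHom.id F) s, x.point = b}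

end SparseDense

open SparseDense

/-! Density in (i). Sparseness of the set is immediate with `π` itself as witness, because `B'` is
Jacobson. For density, work on an affine chart with coordinate domain `A`, fraction field `E`, and
let `Ω` be the function field of `B'`. Since `deg π > 1`, some function `θ` of `B'` lies outside
`E`. Its minimal polynomial over the integral closure of a Noether normalisation in `E` is separable
of degree at least two, so a point where the derivative does not vanish has a companion with the
same image in `B` and another value of `θ`. Two such geometric points may still be Galois conjugate,
hence the same closed point. They are certainly different closed points if the value of `θ` at the
first one already lies in the field generated by the coordinates of its image: then `θ - α`, for a
suitable function `α` on `B`, vanishes at one point and not at the other.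

Such points are found near any given point by a shear (`exists_specialization`). Let `z` be a
coordinate of the Noether normalisation, move to a nearby algebraic point, let `m` be the minimal
polynomial of the value of `z` there, and replace `z` by `h = m(z) (z ^ r - θ)`. For large `r` the
algebra stays integral over the new polynomial ring, and `h` vanishes at the chosen point.
Restriction of points along an integral extension of a normal domain is open
(`eventually_exists_extension`, a form of continuity of roots), so there are nearby points at which
`h` takes a small nonzero value `v` in `F`. At these, `θ = z ^ r - v / m(z)` is rational over `F` in
`z`. The conclusion is `exists_two_specializations`.

Nowhere density in (ii). All rational points have coordinate in the closed subset `ℚ_[p]` of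
`ℂ_[p]`, which has empty interior.

Non-sparseness in (ii). Over a principal open subset of the line, a generically finite `B'` becomes,
modulo nilpotents, a finite extension of domains. Choose a primitive integral element; wherever its
minimal polynomial specialises to an irreducible polynomial, away from finitely many points, the
fiber is one point (`exists_existsUnique_prime`). Such rational points exist by Hilbert's
irreducibility theorem (`exists_irreducible_specialization`). It is proved analytically: a rational
factor of the specialisation at `1 / s` is a product over a subset of the analytic root branches,
with coefficients of controlled denominator, and a divided-difference estimate
(`eventually_or_eventually`) shows that integrality happens rarely in short intervals unless the
coefficients are polynomials in `1 / s`, which would give a factor of the original polynomial. -/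

namespace SparseDense

/-! ### Extending homomorphisms to a field along integral extensions. -/

section Homs

open Polynomial Filter Topology

variable {R C K : Type*} [CommRing R] [CommRing C] [Algebra R C]

/-- A ring homomorphism to an algebraically closed field extends along an integral extension
as soon as it vanishes on the kernel. -/
lemma exists_ringHom_extension [Field K] [IsAlgClosed K] [Algebra.IsIntegral R C] (v : R →+* K)
    (hv : RingHom.ker (algebraMap R C) ≤ RingHom.ker v) :
    ∃ y : C →+* K, y.comp (algebraMap R C) = v := by
  have := RingHom.ker_isPrime v
  obtain ⟨Q, -, hQ, hQv⟩ := Ideal.exists_ideal_over_prime_of_isIntegral (S := C) (RingHom.ker v) ⊥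
    (by rwa [← RingHom.ker_eq_comap_bot])
  let g : R ⧸ Q.comap (algebraMap R C) →+* K :=
    Ideal.Quotient.lift _ v (fun a ha => by rw [hQv] at ha; exact ha)
  have hg : Function.Injective g := by
    rw [injective_iff_map_eq_zero]
    intro a ha
    obtain ⟨a, rfl⟩ := Ideal.Quotient.mk_surjective a
    rw [Ideal.Quotient.eq_zero_iff_mem, hQv]
    exact ha
  let _ : Algebra (R ⧸ Q.comap (algebraMap R C)) K := g.toAlgebra
  have : FaithfulSMul (R ⧸ Q.comap (algebraMap R C)) K :=
    (faithfulSMul_iff_algebraMap_injective _ _).2 hg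
  have : Module.IsTorsionFree (R ⧸ Q.comap (algebraMap R C)) (C ⧸ Q) :=
    FaithfulSMul.to_isTorsionFree _ _
  let l : C ⧸ Q →ₐ[R ⧸ Q.comap (algebraMap R C)] K := IsAlgClosed.lift
  refine ⟨l.toRingHom.comp (Ideal.Quotient.mk Q), ?_⟩
  ext a
  exact l.commutes (Ideal.Quotient.mk _ a)

variable [IsDomain R] [IsIntegrallyClosed R] [IsDomain C] [Module.IsTorsionFree R C]
  [Algebra.IsIntegral R C]

/-- Every root of the specialised minimal polynomial of `a` is the value of `a` under some
extension of the specialisation. -/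
lemma exists_ringHom_extension_apply_eq [Field K] [IsAlgClosed K] (v : R →+* K) (a : C) {b : K}
    (hb : (minpoly R a).eval₂ v b = 0) :
    ∃ y : C →+* K, y.comp (algebraMap R C) = v ∧ y a = b := by
  have ha : IsIntegral R a := Algebra.IsIntegral.isIntegral a
  -- Normality of `R` enters here: it gives `R[a] ≅ R[X] / (minpoly R a)`, so any root `b` defines a
  -- homomorphism on `R[a]`, which then extends by lying over.
  let g : Algebra.adjoin R {a} →+* K :=
    (AdjoinRoot.lift v b hb).comp ((minpoly.equivAdjoin ha).symm : _ →+* _)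
  have : Algebra.IsIntegral (Algebra.adjoin R {a}) C := Algebra.IsIntegral.tower_top R
  obtain ⟨y, hy⟩ := exists_ringHom_extension (C := C) g (by
    rw [(RingHom.injective_iff_ker_eq_bot _).1
      (show Function.Injective (algebraMap (Algebra.adjoin R {a}) C) from Subtype.val_injective)]
    exact bot_le)
  refine ⟨y, ?_, ?_⟩
  · ext r
    have h1 := RingHom.congr_fun hy (algebraMap R _ r)
    have h2 : (minpoly.equivAdjoin ha).symm (algebraMap R _ r) = algebraMap R _ r :=
      (minpoly.equivAdjoin ha).symm.commutes r
    simp only [RingHom.comp_apply, g, RingHom.coe_coe, h2] at h1 ⊢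
    rw [AdjoinRoot.algebraMap_eq, AdjoinRoot.lift_of] at h1
    exact h1
  · have h1 := RingHom.congr_fun hy ⟨a, Algebra.self_mem_adjoin_singleton R a⟩
    have h2 : (minpoly.equivAdjoin ha).symm ⟨a, Algebra.self_mem_adjoin_singleton R a⟩ =
        AdjoinRoot.root _ := by
      rw [AlgEquiv.symm_apply_eq, minpoly.coe_equivAdjoin]
      ext
      simp [AdjoinRoot.Minpoly.toAdjoin]
    simp only [RingHom.comp_apply, g, RingHom.coe_coe, h2, AdjoinRoot.lift_root] at h1
    exact h1

end Homs

/-! ### Pointwise convergence of homomorphisms and continuity of roots. -/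

section Nhds

open Polynomial Filter Topology

/-- The neighbourhoods of a ring homomorphism for the topology of pointwise convergence. -/
def nhdsHom {R K : Type*} [CommRing R] [CommRing K] [TopologicalSpace K] (x : R →+* K) :
    Filter (R →+* K) :=
  comap (fun v : R →+* K => (v : R → K)) (𝓝 (x : R → K))

lemma tendsto_nhdsHom_iff {R K ι : Type*} [CommRing R] [CommRing K] [TopologicalSpace K]
    {x : R →+* K} {l : Filter ι} {f : ι → R →+* K} :
    Tendsto f l (nhdsHom x) ↔ ∀ r, Tendsto (fun i => f i r) l (𝓝 (x r)) := by
  rw [nhdsHom, tendsto_comap_iff, tendsto_pi_nhds]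
  rfl

lemma tendsto_apply_nhdsHom {R K : Type*} [CommRing R] [CommRing K] [TopologicalSpace K]
    (x : R →+* K) (r : R) : Tendsto (fun v : R →+* K => v r) (nhdsHom x) (𝓝 (x r)) :=
  tendsto_nhdsHom_iff.1 tendsto_id r

variable {R K : Type*} [CommRing R] [NormedField K]

lemma eventually_norm_coeff_sub_lt (x : R →+* K) (P : R[X]) {δ : ℝ} (hδ : 0 < δ) :
    ∀ᶠ v in nhdsHom x, ∀ i, ‖(P.map v).coeff i - (P.map x).coeff i‖ < δ := by
  have : ∀ᶠ v in nhdsHom x, ∀ i ∈ P.support, ‖v (P.coeff i) - x (P.coeff i)‖ < δ := by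
    rw [Finset.eventually_all]
    intro i _
    have := (tendsto_apply_nhdsHom x (P.coeff i)).eventually (Metric.ball_mem_nhds _ hδ)
    filter_upwards [this] with v hv
    simpa [dist_eq_norm] using hv
  filter_upwards [this] with v hv i
  by_cases hi : i ∈ P.support
  · simpa using hv i hi
  · simp [notMem_support_iff.1 hi, hδ]

lemma exists_root_close [IsAlgClosed K] (x : R →+* K) {P : R[X]} (hP : P.Monic)
    {b : K} (hb : P.eval₂ x b = 0) {ε : ℝ} (hε : 0 < ε) :
    ∀ᶠ v in nhdsHom x, ∃ b', P.eval₂ v b' = 0 ∧ ‖b - b'‖ < ε := by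
  set d := P.natDegree with hd
  set M := max ‖b‖ 1 with hM
  have hM0 : 0 < M := by positivity
  have hd0 : d ≠ 0 := by
    intro h
    rw [hP.natDegree_eq_zero.1 h] at hb
    simp at hb
  -- Coefficients within `δ` give roots within `((d + 1) δ) ^ (1 / d) * max ‖b‖ 1`; this `δ` makes
  -- that bound equal to `ε`.
  have hδ : 0 < (ε / M) ^ d / (d + 1) := by positivity
  filter_upwards [eventually_norm_coeff_sub_lt x P hδ] with v hv
  obtain ⟨b', hb', hlt⟩ := exists_roots_norm_sub_lt_of_norm_coeff_sub_lt (f := P.map x)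
    (a := b) (g := P.map v) hδ (by rwa [Polynomial.eval_map]) (hP.map x) (hP.map v)
    (by rw [hP.natDegree_map, hP.natDegree_map]) hv (IsAlgClosed.splits _)
  refine ⟨b', by simpa [Polynomial.eval_map] using (mem_roots'.1 hb').2, hlt.trans_eq ?_⟩
  rw [hP.natDegree_map, ← hd, mul_div_cancel₀ _ (by positivity), ← Real.rpow_natCast,
    Real.rpow_rpow_inv (by positivity) (by exact_mod_cast hd0), ← hM, div_mul_cancel₀ _ hM0.ne']

/-- The quantitative continuity of roots depends on the size of the root one starts from. Here that
root belongs to the varying polynomial, so Cauchy's bound is used to make the estimate uniform. -/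
lemma forall_root_close [IsAlgClosed K] (x : R →+* K) {P : R[X]} (hP : P.Monic)
    {ε : ℝ} (hε : 0 < ε) :
    ∀ᶠ v in nhdsHom x, ∀ b', P.eval₂ v b' = 0 → ∃ b, P.eval₂ x b = 0 ∧ ‖b' - b‖ < ε := by
  set d := P.natDegree with hd
  obtain ⟨B, hB⟩ : ∃ B : ℝ, ∀ i, ‖(P.map x).coeff i‖ ≤ B := by
    refine ⟨∑ i ∈ (P.map x).support, ‖(P.map x).coeff i‖, fun i => ?_⟩
    by_cases hi : i ∈ (P.map x).support
    · exact Finset.single_le_sum (f := fun i => ‖(P.map x).coeff i‖)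
        (fun _ _ => norm_nonneg _) hi
    · rw [notMem_support_iff.1 hi, norm_zero]
      positivity
  have hB0 : 0 ≤ B := (norm_nonneg _).trans (hB 0)
  -- Coefficients at `v` are within `1` of those at `x`, hence at most `B + 1`; Cauchy's bound for a
  -- monic polynomial adds another `1`.
  set M := B + 2 with hM
  have hM0 : 0 < M := by positivity
  have hδ : 0 < (ε / M) ^ d / (d + 1) := by positivity
  filter_upwards [eventually_norm_coeff_sub_lt x P hδ, eventually_norm_coeff_sub_lt x P one_pos]
    with v hv hv1 b' hb'
  have hd0 : d ≠ 0 := by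
    intro h
    rw [hP.natDegree_eq_zero.1 h] at hb'
    simp at hb'
  have hb'M : ‖b'‖ ≤ M := by
    have h1 : (P.map v).IsRoot b' := by rwa [IsRoot, Polynomial.eval_map]
    have h2 := h1.norm_lt_cauchyBound (hP.map v).ne_zero
    have h3 : cauchyBound (P.map v) ≤ M.toNNReal := by
      rw [cauchyBound, (hP.map v).leadingCoeff, nnnorm_one, div_one]
      have : M.toNNReal = (B + 1).toNNReal + 1 := by
        rw [← Real.toNNReal_one, ← Real.toNNReal_add (by positivity) zero_le_one, hM]
        congr 1
        ring
      rw [this]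
      gcongr
      refine Finset.sup_le fun i _ => ?_
      rw [← NNReal.coe_le_coe, Real.coe_toNNReal _ (by positivity), coe_nnnorm]
      calc ‖(P.map v).coeff i‖ = ‖((P.map v).coeff i - (P.map x).coeff i) + (P.map x).coeff i‖ := by
            rw [sub_add_cancel]
        _ ≤ _ := norm_add_le _ _
        _ ≤ 1 + B := add_le_add (hv1 i).le (hB i)
        _ = _ := add_comm _ _
    have h4 : ((‖b'‖₊ : NNReal) : ℝ) ≤ M := by
      rw [← Real.coe_toNNReal M hM0.le]
      exact_mod_cast h2.le.trans h3
    exact h4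
  obtain ⟨b, hb, hlt⟩ := exists_roots_norm_sub_lt_of_norm_coeff_sub_lt (f := P.map v)
    (g := P.map x) (a := b') hδ (by rwa [Polynomial.eval_map]) (hP.map v) (hP.map x)
    (by rw [hP.natDegree_map, hP.natDegree_map])
    (fun i => by rw [norm_sub_rev]; exact hv i) (IsAlgClosed.splits _)
  refine ⟨b, by simpa [Polynomial.eval_map] using (mem_roots'.1 hb).2, hlt.trans_le ?_⟩
  rw [hP.natDegree_map, ← hd, mul_div_cancel₀ _ (by positivity), ← Real.rpow_natCast,
    Real.rpow_rpow_inv (by positivity) (by exact_mod_cast hd0)]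
  calc ε / M * max ‖b'‖ 1 ≤ ε / M * M := by
        gcongr
        exact max_le hb'M (by linarith)
    _ = ε := div_mul_cancel₀ _ hM0.ne'

end Nhds


/-! ### Openness of restriction of points along integral extensions. -/

section Open

open Polynomial Filter Topology

lemma hasBasis_nhdsHom {R K : Type*} [CommRing R] [NormedField K] (x : R →+* K)
    {s : Set (R →+* K)} (hs : s ∈ nhdsHom x) :
    ∃ (T : Finset R) (ε : ℝ), 0 < ε ∧ ∀ y : R →+* K, (∀ t ∈ T, ‖y t - x t‖ < ε) → y ∈ s := by
  obtain ⟨u, hu, hus⟩ := mem_comap.1 hs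
  rw [nhds_pi, Filter.mem_pi] at hu
  obtain ⟨I, hI, t, ht, htu⟩ := hu
  choose ε hε hεt using fun i => Metric.mem_nhds_iff.1 (ht i)
  obtain ⟨δ, hδ, hδε⟩ : ∃ δ > 0, ∀ i ∈ hI.toFinset, δ ≤ ε i := by
    classical
    induction hI.toFinset using Finset.induction with
    | empty => exact ⟨1, one_pos, by simp⟩
    | insert a S _ ih =>
      obtain ⟨δ, hδ, h⟩ := ih
      refine ⟨min δ (ε a), lt_min hδ (hε a), fun i hi => ?_⟩
      rcases Finset.mem_insert.1 hi with rfl | hi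
      · exact min_le_right _ _
      · exact (min_le_left _ _).trans (h i hi)
  refine ⟨hI.toFinset, δ, hδ, fun y hy => hus (htu fun i hi => hεt i ?_)⟩
  rw [Metric.mem_ball, dist_eq_norm]
  exact (hy i (by simpa using hi)).trans_le (hδε i (by simpa using hi))

variable {R C K : Type*} [CommRing R] [CommRing C] [Algebra R C] [Algebra.IsIntegral R C]
  [NormedField K] [IsAlgClosed K] [CharZero K]

/-- For extensions of specialisations close to a given one, closeness on finitely many elements
follows from closeness on a single one. -/
lemma exists_controlling_element (x : C →+* K) (T : Finset C) :
    ∃ a : C, ∀ ε > 0, ∃ δ > 0, ∀ᶠ v in nhdsHom (x.comp (algebraMap R C)),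
      ∀ y : C →+* K, y.comp (algebraMap R C) = v → ‖y a - x a‖ < δ →
        ∀ t ∈ T, ‖y t - x t‖ < ε := by
  classical
  induction T using Finset.induction with
  | empty => exact ⟨0, fun ε _ => ⟨1, one_pos, by simp⟩⟩
  | insert b T _ ih =>
    obtain ⟨a, ha⟩ := ih
    set v₀ := x.comp (algebraMap R C) with hv₀
    have hmon : ∀ c : C, (minpoly R c).Monic := fun c =>
      minpoly.monic (Algebra.IsIntegral.isIntegral c)
    let ρ : C → Finset K := fun c => ((minpoly R c).map v₀).roots.toFinset
    have hρ : ∀ c z, z ∈ ρ c ↔ (minpoly R c).eval₂ v₀ z = 0 := fun c z => by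
      simp [ρ, mem_roots', Polynomial.eval_map, ((hmon c).map v₀).ne_zero]
    -- As in the primitive element theorem: among the finitely many candidate values `(σ, β)` of
    -- `(a, b)` above `v₀`, a general linear form `σ + c β` singles out the true one. The excluded
    -- `c` are the quotients `(x a - σ) / (β - x b)`.
    obtain ⟨c, hc⟩ : ∃ c : ℕ, ∀ σ ∈ ρ a, ∀ β ∈ ρ b,
        σ + c * β = x a + c * x b → σ = x a ∧ β = x b := by
      obtain ⟨c, hc⟩ := Infinite.exists_notMem_finset
        (((ρ a ×ˢ ρ b).image fun q => (x a - q.1) / (q.2 - x b)).preimage (Nat.cast : ℕ → K)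
          Nat.cast_injective.injOn)
      refine ⟨c, fun σ hσ β hβ h => ?_⟩
      have hβ' : β = x b := by
        by_contra hne
        have hne' : β - x b ≠ 0 := sub_ne_zero.2 hne
        refine hc ?_
        rw [Finset.mem_preimage, Finset.mem_image]
        refine ⟨(σ, β), Finset.mk_mem_product hσ hβ, ?_⟩
        rw [div_eq_iff hne']
        linear_combination -h
      subst hβ'
      exact ⟨by simpa using h, rfl⟩
    obtain ⟨η, hη, hηle⟩ : ∃ η > 0, ∀ q ∈ ρ a ×ˢ ρ b,
        ‖(q.1 + c * q.2) - (x a + c * x b)‖ < η → q.1 = x a ∧ q.2 = x b := by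
      have : ∀ Q ⊆ ρ a ×ˢ ρ b, ∃ η > 0, ∀ q ∈ Q,
          ‖(q.1 + c * q.2) - (x a + c * x b)‖ < η → q.1 = x a ∧ q.2 = x b := by
        intro Q
        induction Q using Finset.induction with
        | empty => exact fun _ => ⟨1, one_pos, by simp⟩
        | insert q Q _ ih =>
          intro hQ
          obtain ⟨η, hη, h⟩ := ih ((Finset.subset_insert _ _).trans hQ)
          have hq := Finset.mem_product.1 (hQ (Finset.mem_insert_self q Q))
          by_cases h0 : (q.1 + c * q.2) - (x a + c * x b) = 0
          · refine ⟨η, hη, fun q' hq' hlt => ?_⟩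
            rcases Finset.mem_insert.1 hq' with rfl | hq'
            · exact hc _ hq.1 _ hq.2 (sub_eq_zero.1 h0)
            · exact h _ hq' hlt
          · refine ⟨min η ‖(q.1 + c * q.2) - (x a + c * x b)‖,
              lt_min hη (norm_pos_iff.2 h0), fun q' hq' hlt => ?_⟩
            rcases Finset.mem_insert.1 hq' with rfl | hq'
            · exact absurd (hlt.trans_le (min_le_right _ _)) (lt_irrefl _)
            · exact h _ hq' (hlt.trans_le (min_le_left _ _))
      exact this _ subset_rfl
    refine ⟨a + c * b, fun ε hε => ?_⟩
    obtain ⟨δ₁, hδ₁, hev⟩ := ha ε hε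
    set κ : ℝ := 1 + ‖(c : K)‖
    have hκ : 0 < κ := by positivity
    -- Replacing `y a`, `y b` by their nearest roots above `v₀` changes the linear form by at most
    -- `ε' κ ≤ η / 2`. Together with the assumed `η / 2` this stays below the gap `η`, so the
    -- nearest roots are `x a` and `x b`.
    set ε' := min (min δ₁ ε) (η / 2 / κ)
    have hε' : 0 < ε' := by positivity
    refine ⟨η / 2, by positivity, ?_⟩
    filter_upwards [hev, forall_root_close v₀ (hmon a) hε', forall_root_close v₀ (hmon b) hε']
      with v hv hva hvb y hy hlt
    have hroot : ∀ d : C, (minpoly R d).eval₂ v (y d) = 0 := fun d => by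
      rw [← hy, ← hom_eval₂, ← aeval_def, minpoly.aeval, map_zero]
    obtain ⟨σ, hσ, hσlt⟩ := hva _ (hroot a)
    obtain ⟨β, hβ, hβlt⟩ := hvb _ (hroot b)
    have key : ‖(σ + c * β) - (x a + c * x b)‖ < η := by
      have e : (σ + c * β) - (x a + c * x b) =
          (y (a + c * b) - x (a + c * b)) - ((y a - σ) + c * (y b - β)) := by
        simp only [map_add, map_mul, map_natCast]; ring
      rw [e]
      have h1 : ‖(y a - σ) + c * (y b - β)‖ ≤ η / 2 := by
        calc _ ≤ ‖y a - σ‖ + ‖(c : K) * (y b - β)‖ := norm_add_le _ _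
          _ ≤ ε' + ‖(c : K)‖ * ε' := by
            rw [norm_mul]
            gcongr
          _ = ε' * κ := by ring
          _ ≤ η / 2 / κ * κ := by gcongr; exact min_le_right _ _
          _ = η / 2 := div_mul_cancel₀ _ hκ.ne'
      linarith [norm_sub_le (y (a + c * b) - x (a + c * b)) ((y a - σ) + c * (y b - β))]
    obtain ⟨rfl, rfl⟩ := hηle (σ, β) (Finset.mk_mem_product ((hρ a σ).2 hσ) ((hρ b β).2 hβ)) key
    intro t ht
    rcases Finset.mem_insert.1 ht with rfl | ht
    · exact hβlt.trans_le ((min_le_left _ _).trans (min_le_right _ _))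
    · exact hv y hy (hσlt.trans_le ((min_le_left _ _).trans (min_le_left _ _))) t ht

/-- Restriction of specialisations along an integral extension of a normal domain is an
open map. -/
theorem eventually_exists_extension [IsDomain R] [IsIntegrallyClosed R] [IsDomain C]
    [Module.IsTorsionFree R C] (x : C →+* K) {s : Set (C →+* K)} (hs : s ∈ nhdsHom x) :
    ∀ᶠ v in nhdsHom (x.comp (algebraMap R C)), ∃ y ∈ s, y.comp (algebraMap R C) = v := by
  obtain ⟨T, ε, hε, hT⟩ := hasBasis_nhdsHom x hs
  obtain ⟨a, ha⟩ := exists_controlling_element (R := R) x T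
  obtain ⟨δ, hδ, hev⟩ := ha ε hε
  have hx : (minpoly R a).eval₂ (x.comp (algebraMap R C)) (x a) = 0 := by
    rw [← hom_eval₂, ← aeval_def, minpoly.aeval, map_zero]
  -- Continuity of roots moves `x a` to a root `b` of the minimal polynomial at `v`, normality of
  -- `R` makes `b` the value of an extension of `v`, and the choice of `a` forces this extension to
  -- be close to `x` on all of `T`.
  filter_upwards [hev, exists_root_close _ (minpoly.monic (Algebra.IsIntegral.isIntegral a)) hx hδ]
    with v hv ⟨b, hb, hlt⟩
  obtain ⟨y, hy, rfl⟩ := exists_ringHom_extension_apply_eq v a hb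
  exact ⟨y, hT y (hv y hy (by rwa [norm_sub_rev])), hy⟩

end Open

end SparseDense

namespace SparseDense

/-! ### The change of variable that preserves integrality. -/

section Shear

open Polynomial

/-- If `θ` is integral over `S[z]`, then `z` is integral over `S[m(z) (z ^ r - θ)]` for monic `m`
and `r` large. -/
lemma exists_isIntegralElem_shear {S D : Type*} [CommRing S] [Nontrivial S] [CommRing D]
    [Algebra S D] (z θ : D) {m : S[X]} (hm : m.Monic)
    (hθ : (aeval z : S[X] →ₐ[S] D).toRingHom.IsIntegralElem θ) :
    ∃ r : ℕ, (aeval (aeval z m * (z ^ r - θ)) : S[X] →ₐ[S] D).toRingHom.IsIntegralElem z := by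
  obtain ⟨P, hP, hPθ⟩ := hθ
  set N := P.natDegree with hN
  -- `r` exceeds the `z`-degree of every non-leading coefficient of the equation of `θ`, so that
  -- powers of `z ^ r` dominate.
  set r := (Finset.range N).sup (fun i => (P.coeff i).natDegree) + 1 with hr
  have hrlt : ∀ i ∈ Finset.range N, (P.coeff i).natDegree < r := fun i hi =>
    Nat.lt_succ_of_le (Finset.le_sup (f := fun i => (P.coeff i).natDegree) hi)
  refine ⟨r, ?_⟩
  set h := aeval z m * (z ^ r - θ) with hh
  set M : S[X][X] := m.map C with hMdef
  have hM : M.Monic := hm.map _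
  have hMdeg : M.natDegree = m.natDegree := hm.natDegree_map _
  -- The inner variable stands for `h` and the outer one for `z`. Thus `G` represents `m(z) z ^ r -
  -- h`, which equals `m(z) θ`.
  set G : S[X][X] := M * X ^ r - C X with hG
  have hMX : (M * X ^ r).Monic := hM.mul (monic_X_pow r)
  have hMXdeg : (M * X ^ r).natDegree = m.natDegree + r := by
    rw [hM.natDegree_mul (monic_X_pow r), hMdeg, natDegree_X_pow]
  have hlt : (C X : S[X][X]).degree < (M * X ^ r).degree := by
    refine degree_C_le.trans_lt ?_
    rw [degree_eq_natDegree hMX.ne_zero, hMXdeg]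
    have : 0 < m.natDegree + r := by omega
    exact_mod_cast this
  have hGm : G.Monic := hMX.sub_of_left hlt
  have hGdeg : G.natDegree = m.natDegree + r := by
    rw [hG, natDegree_sub_eq_left_of_natDegree_lt, hMXdeg]
    rw [hMXdeg, natDegree_C]
    omega
  -- This is the equation of `θ` multiplied by `m(z) ^ N`. With `μ = deg m`, the `i`-th term has
  -- degree at most `deg p_i + N μ + i r`, below the degree `N (μ + r)` of the monic term `G ^ N`.
  refine ⟨G ^ N + ∑ i ∈ Finset.range N, (P.coeff i).map C * M ^ (N - i) * G ^ i,
    ?_, ?_⟩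
  · refine (hGm.pow N).add_of_left ?_
    rw [degree_eq_natDegree (hGm.pow N).ne_zero, hGm.natDegree_pow, hGdeg]
    refine (degree_sum_le _ _).trans_lt ?_
    rw [Finset.sup_lt_iff (by exact WithBot.bot_lt_coe _)]
    intro i hi
    have hiN := Finset.mem_range.1 hi
    refine degree_le_natDegree.trans_lt ?_
    norm_cast
    have h1 : ((P.coeff i).map C * M ^ (N - i) * G ^ i : S[X][X]).natDegree ≤
        (P.coeff i).natDegree + (N - i) * m.natDegree + i * (m.natDegree + r) := by
      refine natDegree_mul_le.trans (add_le_add (natDegree_mul_le.trans (add_le_add ?_ ?_)) ?_)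
      · exact natDegree_map_le
      · rw [hM.natDegree_pow, hMdeg]
      · rw [hGm.natDegree_pow, hGdeg]
    refine h1.trans_lt ?_
    obtain ⟨k, hk⟩ := Nat.exists_eq_add_of_lt hiN
    have h2 := hrlt i hi
    rw [hk, show i + k + 1 - i = k + 1 by omega]
    nlinarith [Nat.zero_le (k * r)]
  · have eM : eval₂ (aeval h : S[X] →ₐ[S] D).toRingHom z M = aeval z m := by
      rw [hMdef, eval₂_map, aeval_def]
      congr 1
      ext s
      simp
    have ec : ∀ i, eval₂ (aeval h : S[X] →ₐ[S] D).toRingHom z ((P.coeff i).map C) =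
        aeval z (P.coeff i) := fun i => by
      rw [eval₂_map, aeval_def]
      congr 1
      ext s
      simp
    have eG : eval₂ (aeval h : S[X] →ₐ[S] D).toRingHom z G = aeval z m * θ := by
      rw [hG, eval₂_sub, eval₂_mul, eM, eval₂_X_pow, eval₂_C]
      simp only [AlgHom.toRingHom_eq_coe, RingHom.coe_coe, aeval_X, hh]
      ring
    have e : ∑ i ∈ Finset.range N, aeval z (P.coeff i) * θ ^ i + θ ^ N = 0 := by
      rw [eval₂_eq_sum_range, Finset.sum_range_succ, ← hN, show P.coeff N = 1 from hP, map_one,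
        one_mul] at hPθ
      exact hPθ
    rw [eval₂_add, eval₂_pow, eval₂_finsetSum, eG, Finset.sum_congr rfl (g := fun i =>
      aeval z m ^ N * (aeval z (P.coeff i) * θ ^ i))]
    · rw [← Finset.mul_sum, mul_pow, ← mul_add, add_comm, e, mul_zero]
    · intro i hi
      rw [eval₂_mul, eval₂_mul, eval₂_pow, eval₂_pow, eM, ec, eG, mul_pow,
        ← pow_sub_mul_pow (aeval z m) (Finset.mem_range.1 hi).le]
      ring

/-- The shear of `exists_isIntegralElem_shear` preserves integrality of the whole algebra. -/
lemma exists_isIntegral_shear {S D : Type*} [CommRing S] [Nontrivial S] [CommRing D]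
    [Algebra S D] (z θ : D) {m : S[X]} (hm : m.Monic)
    (hz : (aeval z : S[X] →ₐ[S] D).toRingHom.IsIntegral) :
    ∃ r : ℕ, (aeval (aeval z m * (z ^ r - θ)) : S[X] →ₐ[S] D).toRingHom.IsIntegral := by
  obtain ⟨r, hr⟩ := exists_isIntegralElem_shear z θ hm (hz θ)
  refine ⟨r, fun c => ?_⟩
  set h := aeval z m * (z ^ r - θ)
  let _ : Algebra S[X] D := (aeval h : S[X] →ₐ[S] D).toRingHom.toAlgebra
  have hzI : z ∈ integralClosure S[X] D := hr
  let g : S[X] →+* integralClosure S[X] D :=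
    eval₂RingHom ((algebraMap S[X] (integralClosure S[X] D)).comp C) ⟨z, hzI⟩
  have hg : (algebraMap (integralClosure S[X] D) D).comp g =
      (aeval z : S[X] →ₐ[S] D).toRingHom := by
    ext a
    · simp only [RingHom.comp_apply, g, coe_eval₂RingHom, eval₂_C]
      rw [← IsScalarTower.algebraMap_apply]
      change (aeval h : S[X] →ₐ[S] D) (C a) = aeval z (C a)
      simp
    · simp only [RingHom.comp_apply, g, coe_eval₂RingHom, eval₂_X]
      simp
  obtain ⟨p, hp, hpc⟩ := hz c
  have hc : IsIntegral (integralClosure S[X] D) c := by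
    refine ⟨p.map g, hp.map g, ?_⟩
    rw [eval₂_map, hg]
    exact hpc
  exact isIntegral_trans c hc

/-- If `h` were algebraic over `S`, then `z`, being integral over `S[h]`, would be algebraic too.
Hence the sheared coordinate again defines a polynomial ring. -/
lemma transcendental_of_isIntegral_aeval {S D : Type*} [CommRing S] [IsDomain S] [CommRing D]
    [IsDomain D] [Algebra S D] [FaithfulSMul S D] {z h : D} (hz : Transcendental S z)
    (hh : (aeval h : S[X] →ₐ[S] D).toRingHom.IsIntegral) : Transcendental S h := by
  intro hh'
  refine hz ?_
  have : Algebra.IsAlgebraic S (Algebra.adjoin S {h}) :=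
    (Subalgebra.isAlgebraic_iff _).1 (Algebra.isAlgebraic_adjoin_singleton_iff.2 hh')
  have hz' : IsIntegral (Algebra.adjoin S {h}) z := by
    obtain ⟨p, hp, hpz⟩ := hh z
    let g : S[X] →+* Algebra.adjoin S {h} :=
      (aeval (⟨h, Algebra.self_mem_adjoin_singleton S h⟩ : Algebra.adjoin S {h})).toRingHom
    have hg : (algebraMap (Algebra.adjoin S {h}) D).comp g =
        (aeval h : S[X] →ₐ[S] D).toRingHom := by
      ext a
      · simp [g]
      · simp [g]
    refine ⟨p.map g, hp.map g, ?_⟩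
    rw [eval₂_map, hg]
    exact hpz
  exact hz'.isAlgebraic.restrictScalars S

end Shear

end SparseDense

namespace SparseDense

/-! ### Nearby algebraic points at which `θ` is rational in one coordinate. -/

section Specialize

open Polynomial Filter Topology

variable {F K : Type*} [Field F] [NormedField K] [Algebra F K] {n : ℕ}

/-- The `K`-point of affine space with coordinates `q`. -/
noncomputable def evalPoint (q : (Fin n → K) × K) : (MvPolynomial (Fin n) F)[X] →+* K :=
  eval₂RingHom (MvPolynomial.eval₂Hom (algebraMap F K) q.1) q.2

lemma evalPoint_algebraMap (q : (Fin n → K) × K) (a : F) :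
    evalPoint q (algebraMap F (MvPolynomial (Fin n) F)[X] a) = algebraMap F K a := by
  rw [IsScalarTower.algebraMap_apply F (MvPolynomial (Fin n) F), Polynomial.algebraMap_apply,
    Algebra.algebraMap_self_apply, MvPolynomial.algebraMap_eq]
  simp [evalPoint]

@[simp] lemma evalPoint_X (q : (Fin n → K) × K) :
    evalPoint q (X : (MvPolynomial (Fin n) F)[X]) = q.2 := by
  simp [evalPoint]

lemma eq_evalPoint (w : (MvPolynomial (Fin n) F)[X] →+* K)
    (hw : ∀ a, w (algebraMap F _ a) = algebraMap F K a) :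
    w = evalPoint (fun i => w (C (MvPolynomial.X i)), w X) := by
  ext a
  · have := hw a
    rw [IsScalarTower.algebraMap_apply F (MvPolynomial (Fin n) F), Polynomial.algebraMap_apply,
      Algebra.algebraMap_self_apply, MvPolynomial.algebraMap_eq] at this
    simp [evalPoint, this]
  · simp [evalPoint]
  · simp

lemma continuous_evalPoint (P : (MvPolynomial (Fin n) F)[X]) :
    Continuous (fun q : (Fin n → K) × K => evalPoint q P) := by
  have h1 : ∀ s : MvPolynomial (Fin n) F, Continuous (fun q : (Fin n → K) × K =>
      MvPolynomial.eval₂Hom (algebraMap F K) q.1 s) := by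
    intro s
    induction s using MvPolynomial.induction_on with
    | C a => simpa using continuous_const
    | add p q hp hq => simp only [map_add]; exact hp.add hq
    | mul_X p i hp =>
      simp only [map_mul, MvPolynomial.coe_eval₂Hom, MvPolynomial.eval₂_X] at hp ⊢
      exact hp.mul ((continuous_apply i).comp continuous_fst)
  induction P using Polynomial.induction_on' with
  | add p q hp hq => simp only [map_add]; exact hp.add hq
  | monomial k s =>
    simp only [evalPoint, coe_eval₂RingHom, eval₂_monomial]
    exact (h1 s).mul (continuous_snd.pow k)

lemma tendsto_evalPoint (q : (Fin n → K) × K) :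
    Tendsto (evalPoint (F := F)) (𝓝 q) (nhdsHom (evalPoint q)) :=
  tendsto_nhdsHom_iff.2 fun P => (continuous_evalPoint P).tendsto q

lemma isIntegral_evalPoint {q : (Fin n → K) × K} (h1 : ∀ i, IsIntegral F (q.1 i))
    (h2 : IsIntegral F q.2) (P : (MvPolynomial (Fin n) F)[X]) : IsIntegral F (evalPoint q P) := by
  have h3 : ∀ s : MvPolynomial (Fin n) F,
      IsIntegral F (MvPolynomial.eval₂Hom (algebraMap F K) q.1 s) := by
    intro s
    induction s using MvPolynomial.induction_on with
    | C a => simpa using isIntegral_algebraMap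
    | add p q hp hq => simpa using hp.add hq
    | mul_X p i hp =>
      simp only [map_mul, MvPolynomial.coe_eval₂Hom, MvPolynomial.eval₂_X] at hp ⊢
      exact hp.mul (h1 i)
  induction P using Polynomial.induction_on' with
  | add p q hp hq => simpa using hp.add hq
  | monomial k s =>
    simp only [evalPoint, coe_eval₂RingHom, eval₂_monomial]
    exact (h3 s).mul (h2.pow k)

/-- Algebraic points are dense. -/
lemma frequently_isIntegral (hdense : Dense {z : K | IsIntegral F z})
    (w : (MvPolynomial (Fin n) F)[X] →+* K) (hw : ∀ a, w (algebraMap F _ a) = algebraMap F K a) :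
    ∃ᶠ w' in nhdsHom w, (∀ a, w' (algebraMap F _ a) = algebraMap F K a) ∧
      ∀ P, IsIntegral F (w' P) := by
  rw [eq_evalPoint w hw]
  set q : (Fin n → K) × K := (fun i => w (C (MvPolynomial.X i)), w X)
  refine (tendsto_evalPoint q).frequently ?_
  have hd : Dense ((Set.univ.pi fun _ : Fin n => {z : K | IsIntegral F z}) ×ˢ
      {z : K | IsIntegral F z}) := (dense_pi _ fun _ _ => hdense).prod hdense
  refine (mem_closure_iff_frequently.1 (hd q)).mono fun q' hq' => ?_
  exact ⟨evalPoint_algebraMap q', isIntegral_evalPoint (fun i => hq'.1 i trivial) hq'.2⟩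

/-- The powers of `ϖ` are distinct nonzero elements of `F` tending to zero, so translating by them
supplies the perturbations by elements of `F`. -/
lemma infinite_image_inter_nhds {ϖ : F} (h0 : ϖ ≠ 0) (h1 : ‖algebraMap F K ϖ‖ < 1) (u : K)
    {s : Set K} (hs : s ∈ 𝓝 u) :
    {a | a ∈ s ∧ ∃ v : F, v ≠ 0 ∧ a = u + algebraMap F K v}.Infinite := by
  have ht : Tendsto (fun k : ℕ => u + algebraMap F K (ϖ ^ k)) atTop (𝓝 u) := by
    have := (tendsto_pow_atTop_nhds_zero_of_norm_lt_one h1).const_add u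
    simpa using this
  have hinj : Function.Injective (fun k : ℕ => u + algebraMap F K (ϖ ^ k)) := by
    intro a b hab
    have hab : algebraMap F K ϖ ^ a = algebraMap F K ϖ ^ b := by simpa using hab
    have := congrArg norm hab
    rw [norm_pow, norm_pow] at this
    exact (pow_right_injective₀ (norm_pos_iff.2 (by simpa using h0)) h1.ne) this
  obtain ⟨N, hN⟩ := (ht.eventually_mem hs).exists_forall_of_atTop
  refine ((Set.infinite_range_of_injective
    (hinj.comp (add_left_injective N))).mono ?_)
  rintro _ ⟨k, rfl⟩
  exact ⟨hN _ (Nat.le_add_left _ _), ϖ ^ (k + N), pow_ne_zero _ h0, rfl⟩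

/-- Near a point with algebraic coordinates and last coordinate zero there are algebraic
points with nonzero `F`-rational last coordinate off a given hypersurface. -/
lemma frequently_eval_ne_zero {ϖ : F} (h0 : ϖ ≠ 0) (h1 : ‖algebraMap F K ϖ‖ < 1)
    (w : (MvPolynomial (Fin n) F)[X] →+* K) (hw : ∀ a, w (algebraMap F _ a) = algebraMap F K a)
    (hint : ∀ i, IsIntegral F (w (C (MvPolynomial.X i)))) (hX : w X = 0)
    {e : (MvPolynomial (Fin n) F)[X]} (he : e ≠ 0) :
    ∃ᶠ w' in nhdsHom w, (∀ a, w' (algebraMap F _ a) = algebraMap F K a) ∧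
      (∀ P, IsIntegral F (w' P)) ∧ (∃ v : F, v ≠ 0 ∧ w' X = algebraMap F K v) ∧ w' e ≠ 0 := by
  rw [eq_evalPoint w hw]
  set q : (Fin n → K) × K := (fun i => w (C (MvPolynomial.X i)), w X)
  refine (tendsto_evalPoint q).frequently ?_
  rw [frequently_iff]
  intro U hU
  obtain ⟨U₁, hU₁, U₂, hU₂, hU⟩ := mem_nhds_prod_iff.1 hU
  rw [nhds_pi, Filter.mem_pi'] at hU₁
  obtain ⟨I, t, ht, htU⟩ := hU₁
  have hinf : ∀ i, {a | a ∈ t i ∧ ∃ v : F, v ≠ 0 ∧ a = q.1 i + algebraMap F K v}.Infinite :=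
    fun i => infinite_image_inter_nhds h0 h1 _ (ht i)
  -- Choose the first coordinates so that the leading coefficient of `e` survives: a nonzero
  -- polynomial cannot vanish on a product of infinite sets.
  obtain ⟨u, huA, hu⟩ : ∃ u ∈ Set.univ.pi fun i =>
      {a | a ∈ t i ∧ ∃ v : F, v ≠ 0 ∧ a = q.1 i + algebraMap F K v},
      MvPolynomial.eval u (MvPolynomial.map (algebraMap F K) e.leadingCoeff) ≠ 0 := by
    by_contra! hcon
    have : MvPolynomial.map (algebraMap F K) e.leadingCoeff = 0 :=
      MvPolynomial.funext_set _ hinf fun u hu => by rw [hcon u hu, map_zero]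
    rw [map_eq_zero_iff _ (MvPolynomial.map_injective _ (algebraMap F K).injective)] at this
    exact he (leadingCoeff_eq_zero.1 this)
  rw [MvPolynomial.eval_map] at hu
  have hmap : e.map (MvPolynomial.eval₂Hom (algebraMap F K) u) ≠ 0 := by
    intro h
    have := congrArg (fun p => p.coeff e.natDegree) h
    simp only [coeff_map, coeff_zero] at this
    exact hu this
  classical
  -- Now only finitely many values of the last coordinate are forbidden. As it starts at zero, the
  -- perturbed value is itself a nonzero element of `F`.
  obtain ⟨z, ⟨hzU, v, hv, hzv⟩, hz⟩ := ((infinite_image_inter_nhds h0 h1 _ hU₂).sdiff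
    (e.map (MvPolynomial.eval₂Hom (algebraMap F K) u)).roots.toFinset.finite_toSet).nonempty
  rw [hX, zero_add] at hzv
  refine ⟨(u, z), hU ⟨htU fun i _ => (huA i trivial).1, hzU⟩, evalPoint_algebraMap _,
    isIntegral_evalPoint ?_ ?_, ⟨v, hv, ?_⟩, ?_⟩
  · intro i
    obtain ⟨-, v, -, hv⟩ := huA i trivial
    rw [show (u, z).1 i = u i from rfl, hv]
    exact (hint i).add isIntegral_algebraMap
  · rw [show (u, z).2 = z from rfl, hzv]
    exact isIntegral_algebraMap
  · rw [evalPoint_X, ← hzv]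
  · intro h
    refine hz ?_
    rw [evalPoint, coe_eval₂RingHom, ← Polynomial.eval_map] at h
    simpa [mem_roots', hmap] using h

lemma isIntegral_of_ringHom_isIntegral {R D : Type*} [CommRing R] [CommRing D] {g : R →+* D}
    (hg : g.IsIntegral) (y : D →+* K) (h : ∀ r, IsIntegral F (y (g r))) (d : D) :
    IsIntegral F (y d) := by
  obtain ⟨p, hp, hpd⟩ := hg d
  let g' : R →+* integralClosure F K := (y.comp g).codRestrict (integralClosure F K) h
  have : IsIntegral (integralClosure F K) (y d) := by
    refine ⟨p.map g', hp.map g', ?_⟩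
    rw [eval₂_map, show (algebraMap (integralClosure F K) K).comp g' = y.comp g from rfl,
      ← hom_eval₂, hpd, map_zero]
  exact isIntegral_trans _ this

/-- An open neighbourhood inside `s` is needed because the point is moved twice, the second time
starting from a point other than `x`. -/
lemma exists_mem_nhdsHom_forall {R : Type*} [CommRing R] {x : R →+* K} {s : Set (R →+* K)}
    (hs : s ∈ nhdsHom x) : ∃ s' ⊆ s, s' ∈ nhdsHom x ∧ ∀ y ∈ s', s' ∈ nhdsHom y := by
  obtain ⟨u, hu, hus⟩ := mem_comap.1 hs
  obtain ⟨v, hvu, hv, hxv⟩ := mem_nhds_iff.1 hu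
  exact ⟨_, (Set.preimage_mono hvu).trans hus, mem_comap.2 ⟨v, hv.mem_nhds hxv, subset_rfl⟩,
    fun y hy => mem_comap.2 ⟨v, hv.mem_nhds hy, subset_rfl⟩⟩

theorem eventually_exists_extension_ringHom [IsAlgClosed K] [CharZero K] {R D : Type*} [CommRing R]
    [IsDomain R] [IsIntegrallyClosed R] [CommRing D] [IsDomain D] {f : R →+* D}
    (hf : Function.Injective f) (hint : f.IsIntegral) (x : D →+* K) {s : Set (D →+* K)}
    (hs : s ∈ nhdsHom x) :
    ∀ᶠ v in nhdsHom (x.comp f), ∃ y ∈ s, y.comp f = v := by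
  let _ := f.toAlgebra
  have : Algebra.IsIntegral R D := ⟨hint⟩
  have : FaithfulSMul R D := (faithfulSMul_iff_algebraMap_injective R D).2 hf
  have : Module.IsTorsionFree R D := FaithfulSMul.to_isTorsionFree R D
  exact eventually_exists_extension (R := R) x hs

open IntermediateField in
/-- An algebra `D` that is integral over a polynomial ring has, near every point, algebraic
points at which the value of a given `θ` is a rational function of the value of the last
coordinate. -/
theorem exists_specialization [CharZero F] [IsAlgClosed K]
    (hdense : Dense {z : K | IsIntegral F z}) {ϖ : F} (h0 : ϖ ≠ 0)
    (h1 : ‖algebraMap F K ϖ‖ < 1) {D : Type*} [CommRing D] [IsDomain D] [Algebra F D]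
    (f : (MvPolynomial (Fin n) F)[X] →ₐ[F] D) (hf : Function.Injective f)
    (hint : (f : (MvPolynomial (Fin n) F)[X] →+* D).IsIntegral) (θ : D) {e : D} (he : e ≠ 0)
    (x : D →ₐ[F] K) {s : Set (D →+* K)} (hs : s ∈ nhdsHom (x : D →+* K)) :
    ∃ y : D →ₐ[F] K, (y : D →+* K) ∈ s ∧ (∀ c, IsIntegral F (y c)) ∧ y e ≠ 0 ∧
      y θ ∈ F⟮y (f X)⟯ := by
  have := charZero_of_injective_algebraMap (algebraMap F K).injective
  obtain ⟨s', hs's, hs', hs'nhds⟩ := exists_mem_nhdsHom_forall hs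
  -- First move: pass to a nearby point `x₁` above an algebraic point of affine space, so that the
  -- value of `z` has a minimal polynomial over `F`.
  obtain ⟨w₁, ⟨hw₁F, hw₁int⟩, x₁, hx₁s, hx₁⟩ := ((frequently_isIntegral hdense
    ((x : D →+* K).comp (f : (MvPolynomial (Fin n) F)[X] →+* D))
    (fun a => (congrArg x (f.commutes a)).trans (x.commutes a))).and_eventually
    (eventually_exists_extension_ringHom (f := (f : (MvPolynomial (Fin n) F)[X] →+* D)) hf hint _ hs')).exists
  have hx₁f : ∀ P, x₁ (f P) = w₁ P := fun P => RingHom.congr_fun hx₁ P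
  have hx₁F : ∀ a, x₁ (algebraMap F D a) = algebraMap F K a := fun a => by
    rw [← hw₁F, ← hx₁f, f.commutes]
  set S := MvPolynomial (Fin n) F
  let _ : Algebra S D := ((f : S[X] →+* D).comp C).toAlgebra
  have halg : ∀ t : S, algebraMap S D t = f (C t) := fun t => rfl
  have : IsScalarTower F S D := IsScalarTower.of_algebraMap_eq fun a => by
    rw [halg, ← f.commutes, IsScalarTower.algebraMap_apply F S, Polynomial.algebraMap_apply,
      Algebra.algebraMap_self_apply]
  have : FaithfulSMul S D := (faithfulSMul_iff_algebraMap_injective S D).2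
    (hf.comp C_injective)
  set z := f X
  have hfz : (aeval z : S[X] →ₐ[S] D).toRingHom = (f : S[X] →+* D) := by
    ext t <;> simp [halg, z, AlgHom.toRingHom_eq_coe]
  have hztr : Transcendental S z := by
    rw [transcendental_iff_injective]
    intro a b hab
    exact hf ((RingHom.congr_fun hfz a).symm.trans (hab.trans (RingHom.congr_fun hfz b)))
  set m₀ := minpoly F (x₁ z)
  have hzint : IsIntegral F (x₁ z) := by rw [hx₁f]; exact hw₁int X
  set m : S[X] := m₀.map (algebraMap F S)
  have hm : m.Monic := (minpoly.monic hzint).map _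
  have hmval : ∀ y : D →+* K, (∀ a, y (algebraMap F D a) = algebraMap F K a) →
      y (aeval z m) = aeval (y z) m₀ := fun y hy => by
    rw [aeval_map_algebraMap, aeval_def, hom_eval₂, aeval_def]
    congr 1
    ext a
    exact hy a
  obtain ⟨r, hr⟩ := exists_isIntegral_shear z θ hm (by rw [hfz]; exact hint)
  set h := aeval z m * (z ^ r - θ) with hh
  set g : S[X] →ₐ[S] D := aeval h
  have hginj : Function.Injective g :=
    transcendental_iff_injective.1 (transcendental_of_isIntegral_aeval hztr hr)
  have hgF : ∀ a, g (algebraMap F S[X] a) = algebraMap F D a := fun a => by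
    rw [IsScalarTower.algebraMap_apply F S S[X], g.commutes, ← IsScalarTower.algebraMap_apply]
  -- Since `e` is algebraic over the sheared polynomial ring, it divides a nonzero element of it;
  -- staying off the hypersurface `e₂ = 0` keeps `e` nonzero.
  obtain ⟨e₂, he₂, hee₂⟩ : ∃ e₂ : S[X], e₂ ≠ 0 ∧ e ∣ g e₂ := by
    let _ : Algebra S[X] D := g.toRingHom.toAlgebra
    have : FaithfulSMul S[X] D := (faithfulSMul_iff_algebraMap_injective _ D).2 hginj
    have : Module.IsTorsionFree S[X] D := FaithfulSMul.to_isTorsionFree _ D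
    have he' : IsIntegral S[X] e := hr e
    exact he'.isAlgebraic.exists_nonzero_dvd (mem_nonZeroDivisors_of_ne_zero he)
  have hgX : g X = h := aeval_X _
  have hgC : ∀ t : S, g (C t) = f (C t) := fun t => by
    rw [aeval_C, halg]
  have hx₁h : x₁ h = 0 := by
    rw [hh, map_mul, hmval x₁ hx₁F, minpoly.aeval, zero_mul]
  -- Second move, in the sheared coordinates: `h` vanishes at `x₁`, and openness lifts a nearby
  -- point of affine space where `h` equals a nonzero `v` in `F`.
  obtain ⟨w, ⟨hwF, hwint, ⟨v, hv, hwv⟩, hwe⟩, y, hys, hy⟩ := ((frequently_eval_ne_zero h0 h1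
    (x₁.comp g.toRingHom) (fun a => by
      change x₁ (g _) = _
      rw [hgF, hx₁F]) (fun i => by
      change IsIntegral F (x₁ (g _))
      rw [hgC, hx₁f]
      exact hw₁int _) (by
      change x₁ (g X) = 0
      rw [hgX, hx₁h]) he₂).and_eventually
    (eventually_exists_extension_ringHom (f := g.toRingHom) hginj hr _ (hs'nhds x₁ hx₁s))).exists
  have hyg : ∀ P, y (g P) = w P := fun P => RingHom.congr_fun hy P
  have hyF : ∀ a, y (algebraMap F D a) = algebraMap F K a := fun a => by
    rw [← hgF, hyg, hwF]
  refine ⟨{ y with commutes' := hyF }, hs's hys, ?_, ?_, ?_⟩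
  · exact isIntegral_of_ringHom_isIntegral hr y fun P => by
      change IsIntegral F (y (g P))
      rw [hyg]; exact hwint P
  · intro (hye : y e = 0)
    obtain ⟨d, hd⟩ := hee₂
    exact hwe (by rw [← hyg, hd, map_mul, hye, zero_mul])
  · change y θ ∈ F⟮y z⟯
    have key : aeval (y z) m₀ * (y z ^ r - y θ) = algebraMap F K v := by
      rw [← hwv, ← hyg, hgX, hh, map_mul, hmval y hyF, map_sub, map_pow]
    have hne : aeval (y z) m₀ ≠ 0 := fun h => by
      rw [h, zero_mul] at key
      exact hv ((map_eq_zero (algebraMap F K)).1 key.symm)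
    -- The equation `m₀(z) (z ^ r - θ) = v` with `v ≠ 0` forces `m₀(z) ≠ 0` and can be solved for
    -- `θ`.
    have : y θ = y z ^ r - algebraMap F K v / aeval (y z) m₀ := by
      rw [← key, mul_div_cancel_left₀ _ hne]
      ring
    rw [this]
    have hmem : y z ∈ F⟮y z⟯ := mem_adjoin_simple_self F _
    refine sub_mem (pow_mem hmem r) (div_mem (IntermediateField.algebraMap_mem _ v) ?_)
    exact IntermediateField.algebra_adjoin_le_adjoin F _ (aeval_mem_adjoin_singleton F _)

end Specialize

end SparseDense

namespace SparseDense

/-! ### Two distinct closed points above a nearby algebraic point. -/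

section TwoPoints

open Polynomial Filter Topology

lemma isIntegrallyClosed_integralClosure (R E : Type*) [CommRing R] [IsDomain R] [Field E]
    [Algebra R E] [Algebra.IsAlgebraic R E] [FaithfulSMul R E] :
    IsIntegrallyClosed (integralClosure R E) := by
  have : IsFractionRing (integralClosure R E) E := integralClosure.isFractionRing_of_algebraic
    fun x hx => (FaithfulSMul.algebraMap_injective R E) (by rw [hx, map_zero])
  exact (isIntegrallyClosed_iff_isIntegrallyClosedIn E).2 inferInstance

lemma exists_ringHom_extension' {R D K : Type*} [CommRing R] [CommRing D] [Field K] [IsAlgClosed K]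
    {g : R →+* D} (hg : g.IsIntegral) (hinj : Function.Injective g) (v : R →+* K) :
    ∃ y : D →+* K, y.comp g = v := by
  let _ := g.toAlgebra
  have : Algebra.IsIntegral R D := ⟨hg⟩
  exact exists_ringHom_extension (C := D) v
    (((RingHom.injective_iff_ker_eq_bot g).1 hinj).le.trans bot_le)

/-- A simple root of a polynomial of degree at least two over an algebraically closed field is
not its only root. -/
lemma exists_root_ne {K : Type*} [Field K] [IsAlgClosed K] {Q : K[X]} (hdeg : 2 ≤ Q.natDegree)
    {r : K} (hr : Q.eval r = 0) (hr' : Q.derivative.eval r ≠ 0) : ∃ r', r' ≠ r ∧ Q.eval r' = 0 := by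
  obtain ⟨Q₁, rfl⟩ := dvd_iff_isRoot.2 hr
  have hQ₁ : Q₁ ≠ 0 := by rintro rfl; simp at hdeg
  rw [natDegree_mul (X_sub_C_ne_zero r) hQ₁, natDegree_X_sub_C] at hdeg
  obtain ⟨r', hr₁⟩ := IsAlgClosed.exists_root Q₁ (by
    rw [degree_eq_natDegree hQ₁]
    norm_cast
    omega)
  refine ⟨r', ?_, by rw [Polynomial.eval_mul, hr₁.eq_zero, mul_zero]⟩
  rintro rfl
  apply hr'
  simp [derivative_mul, hr₁.eq_zero]

/-- Where the derivative does not vanish, `y θ` is a simple root of the specialised minimal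
polynomial; having degree at least two, this has a second root, which is the value of `θ` at another
extension. -/
lemma exists_ringHom_apply_ne {R D K : Type*} [CommRing R] [CommRing D] [Algebra R D] [IsDomain R]
    [IsIntegrallyClosed R] [IsDomain D] [Module.IsTorsionFree R D] [Algebra.IsIntegral R D]
    [Field K] [IsAlgClosed K] (y : D →+* K) {θ : D} (hdeg : 2 ≤ (minpoly R θ).natDegree)
    (hy : y (aeval θ (minpoly R θ).derivative) ≠ 0) :
    ∃ y' : D →+* K, y'.comp (algebraMap R D) = y.comp (algebraMap R D) ∧ y' θ ≠ y θ := by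
  have hmon := minpoly.monic (Algebra.IsIntegral.isIntegral (R := R) θ)
  obtain ⟨r', hr', hroot⟩ := exists_root_ne
    (Q := (minpoly R θ).map (y.comp (algebraMap R D))) (r := y θ)
    (by rwa [hmon.natDegree_map]) (by
      rw [Polynomial.eval_map, ← hom_eval₂, ← aeval_def, minpoly.aeval, map_zero]) (by
      rwa [derivative_map, Polynomial.eval_map, ← hom_eval₂, ← aeval_def])
  rw [Polynomial.eval_map] at hroot
  obtain ⟨y', h1, h2⟩ := exists_ringHom_extension_apply_eq _ θ hroot
  exact ⟨y', h1, h2 ▸ hr'⟩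

/-- In characteristic zero the derivative is nonzero and of smaller degree than the minimal
polynomial. Its value at `θ` is a nonzero element, so requiring it not to vanish is an admissible
open condition. -/
lemma aeval_derivative_minpoly_ne_zero {R D : Type*} [CommRing R] [CommRing D] [Algebra R D]
    [IsDomain R] [IsIntegrallyClosed R] [IsDomain D] [Module.IsTorsionFree R D]
    [Algebra.IsIntegral R D] [CharZero R] (θ : D) :
    aeval θ (minpoly R θ).derivative ≠ 0 := by
  intro h
  have hint : IsIntegral R θ := Algebra.IsIntegral.isIntegral θ
  have hpos := minpoly.natDegree_pos hint
  have hne : (minpoly R θ).derivative ≠ 0 := fun h0 =>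
    hpos.ne' (Polynomial.derivative_eq_zero.1 h0)
  have h1 := minpoly.IsIntegrallyClosed.degree_le_of_ne_zero hne h
  exact absurd h1 (not_le.2 (degree_derivative_lt (minpoly.ne_zero hint)))

/-- A homomorphism to a field extends to a subalgebra of the fraction field that is generated by
elements whose denominators do not vanish. -/
lemma exists_algHom_of_denominators {F K D Ω : Type*} [Field F] [Field K] [Algebra F K] [CommRing D]
    [IsDomain D] [Algebra F D] [Field Ω] [Algebra F Ω] (i : D →ₐ[F] Ω) (hi : Function.Injective i)
    (A' : Subalgebra F Ω) {G : Set Ω} (hG : Algebra.adjoin F G = A') {g : D}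
    (hg : ∀ t ∈ G, ∃ d, i g * t = i d) (y : D →ₐ[F] K) (hy : y g ≠ 0) :
    ∃ ψ : A' →ₐ[F] K, ∀ (a : A') (d : D), (a : Ω) = i d → ψ a = y d := by
  have hg0 : g ≠ 0 := fun h => hy (by rw [h, map_zero])
  have hig : i g ≠ 0 := fun h => hg0 (hi (by rw [h, map_zero]))
  let L := Localization.Away g
  have hui : ∀ m : Submonoid.powers g, IsUnit ((i : D →ₐ[F] Ω) m) := by
    rintro ⟨_, k, rfl⟩
    simp [hig]
  have huy : ∀ m : Submonoid.powers g, IsUnit ((y : D →ₐ[F] K) m) := by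
    rintro ⟨_, k, rfl⟩
    simp [hy]
  let j : L →ₐ[F] Ω := IsLocalization.liftAlgHom (M := Submonoid.powers g) (f := i) hui
  let l : L →ₐ[F] K := IsLocalization.liftAlgHom (M := Submonoid.powers g) (f := y) huy
  have hjd : ∀ d, j (algebraMap D L d) = i d := fun d => IsLocalization.lift_eq _ d
  have hld : ∀ d, l (algebraMap D L d) = y d := fun d => IsLocalization.lift_eq _ d
  have hj : Function.Injective j := by
    rw [injective_iff_map_eq_zero]
    intro z hz
    obtain ⟨d, m, rfl⟩ := IsLocalization.exists_mk'_eq (Submonoid.powers g) z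
    have h1 : j (IsLocalization.mk' L d m * algebraMap D L m) = 0 := by rw [map_mul, hz, zero_mul]
    rw [IsLocalization.mk'_spec, hjd, map_eq_zero_iff i hi] at h1
    rw [h1, IsLocalization.mk'_zero]
  have hle : A' ≤ j.range := by
    rw [← hG, Algebra.adjoin_le_iff]
    intro t ht
    obtain ⟨d, hd⟩ := hg t ht
    refine ⟨IsLocalization.mk' L d ⟨g, Submonoid.mem_powers g⟩, ?_⟩
    have h1 := congrArg j (IsLocalization.mk'_spec L d ⟨g, Submonoid.mem_powers g⟩)
    rw [map_mul, hjd, hjd, ← hd, mul_comm] at h1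
    exact mul_left_cancel₀ hig h1
  let ε := AlgEquiv.ofInjective j hj
  refine ⟨(l.comp (ε.symm : j.range →ₐ[F] L)).comp (Subalgebra.inclusion hle), fun a d had => ?_⟩
  change l (ε.symm (Subalgebra.inclusion hle a)) = y d
  rw [← hld]
  congr 1
  rw [AlgEquiv.symm_apply_eq]
  ext
  rw [AlgEquiv.ofInjective_apply, hjd]
  exact had

open IntermediateField in
/-- Every point of an algebra `D` integral over `R` has algebraic points nearby at which the value
of a given `θ` is a rational function of the value of `t`. -/
def HasRationalSpecializations.{v, w} (F : Type*) (K : Type w) (R : Type*) [Field F]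
    [NormedField K] [Algebra F K] [CommRing R] [Algebra F R] (t : R) : Prop :=
  ∀ (D : Type v) [CommRing D] [IsDomain D] [Algebra F D] (f : R →ₐ[F] D),
    Function.Injective f → (f : R →+* D).IsIntegral → ∀ θ e : D, e ≠ 0 → ∀ x : D →ₐ[F] K,
    ∀ s ∈ nhdsHom (x : D →+* K), ∃ y : D →ₐ[F] K, (y : D →+* K) ∈ s ∧ (∀ c, IsIntegral F (y c)) ∧
      y e ≠ 0 ∧ y θ ∈ F⟮y (f t)⟯

open IntermediateField in
/-- Let `A` be integral over a polynomial ring, and `A'` a finitely generated algebra containing `A`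
and some `θ` outside the fraction field of `A`. Near every point of `A` there are algebraic points
with at least two points of `A'` above them. -/
theorem exists_two_specializations_of_isIntegral.{v} {F K R A E : Type*} {Ω : Type v} [Field F] [CharZero F]
    [NormedField K] [IsAlgClosed K] [Algebra F K]
    [CommRing R] [IsDomain R] [Algebra F R] {t : R}
    (hR : HasRationalSpecializations.{v} F K R t) [CommRing A] [IsDomain A] [Field E] [Field Ω] [Algebra F A]
    [Algebra R A] [IsScalarTower F R A]
    [Algebra A E] [IsFractionRing A E] [Algebra E Ω] [Algebra A Ω] [IsScalarTower A E Ω]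
    [Algebra R Ω] [Algebra R E]
    [IsScalarTower R A Ω] [IsScalarTower R A E]
    [IsScalarTower R E Ω] [Algebra F Ω]
    [IsScalarTower F R Ω] [IsScalarTower F A Ω]
    [Algebra.IsIntegral R A] [FaithfulSMul R A]
    [Algebra.IsAlgebraic A Ω] (A' : Subalgebra F Ω) (hA' : A'.FG)
    (hAA' : ∀ a, algebraMap A Ω a ∈ A') {θ₀ : Ω} (hθ₀ : θ₀ ∈ A')
    (hθ₀E : θ₀ ∉ Set.range (algebraMap E Ω)) (x : A →ₐ[F] K) {s : Set (A →+* K)}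
    (hs : s ∈ nhdsHom (x : A →+* K)) :
    ∃ y : A →ₐ[F] K, (y : A →+* K) ∈ s ∧ (∀ a, IsIntegral F (y a)) ∧
      ∃ ψ₁ ψ₂ : A' →ₐ[F] K, (∀ a, ψ₁ ⟨algebraMap A Ω a, hAA' a⟩ = y a) ∧
        (∀ a, ψ₂ ⟨algebraMap A Ω a, hAA' a⟩ = y a) ∧ ∃ c, ψ₁ c = 0 ∧ ψ₂ c ≠ 0 := by
  classical
  have hRA : Function.Injective (algebraMap R A) := FaithfulSMul.algebraMap_injective R A
  have hAE : Function.Injective (algebraMap A E) := IsFractionRing.injective A E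
  have hEΩ : Function.Injective (algebraMap E Ω) := (algebraMap E Ω).injective
  have hAΩ : Function.Injective (algebraMap A Ω) := by
    rw [IsScalarTower.algebraMap_eq A E Ω]; exact hEΩ.comp hAE
  have hRΩ : Function.Injective (algebraMap R Ω) := by
    rw [IsScalarTower.algebraMap_eq R A Ω]; exact hAΩ.comp hRA
  have hRE : Function.Injective (algebraMap R E) := by
    rw [IsScalarTower.algebraMap_eq R A E]; exact hAE.comp hRA
  have : FaithfulSMul R Ω := (faithfulSMul_iff_algebraMap_injective R Ω).2 hRΩ
  have : FaithfulSMul R E := (faithfulSMul_iff_algebraMap_injective R E).2 hRE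
  have : FaithfulSMul A Ω := (faithfulSMul_iff_algebraMap_injective A Ω).2 hAΩ
  have : Algebra.IsAlgebraic R A := inferInstance
  have : Algebra.IsAlgebraic R Ω := Algebra.IsAlgebraic.trans R A Ω
  have : Algebra.IsAlgebraic A E := IsLocalization.isAlgebraic E (nonZeroDivisors A)
  have : Algebra.IsAlgebraic R E := Algebra.IsAlgebraic.trans R A E
  have := isIntegrallyClosed_integralClosure R E
  obtain ⟨G, hG⟩ := hA'
  -- `ρ` is a common denominator in `R` for `θ₀` and the generators of `A'`, so points of `D` with
  -- `ρ ≠ 0` induce points of `A'`.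
  obtain ⟨ρ, hρ, hρint⟩ := Algebra.IsAlgebraic.exists_integral_multiples R (insert θ₀ G)
  -- `A` need not be normal, so minimal polynomials are taken over `A₁`, the integral closure of `R`
  -- in `E`. Points of `D` that agree on `A₁` agree on `A`.
  set D := integralClosure R Ω
  set A₁ := integralClosure R E
  let ι : A₁ →ₐ[R] D := (IsScalarTower.toAlgHom R E Ω).mapIntegralClosure
  let _ : Algebra A₁ D := ι.toRingHom.toAlgebra
  have hι : ∀ c : A₁, ((algebraMap A₁ D c : D) : Ω) = algebraMap E Ω c := fun c => rfl
  have : IsScalarTower R A₁ D := IsScalarTower.of_algebraMap_eq fun r => (ι.commutes r).symm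
  have : Algebra.IsIntegral A₁ D := Algebra.IsIntegral.tower_top (R := R) (S := A₁) (T := D)
  have hιinj : Function.Injective (algebraMap A₁ D) := fun a b hab =>
    Subtype.ext (hEΩ (by rw [← hι, ← hι, hab]))
  have : FaithfulSMul A₁ D := (faithfulSMul_iff_algebraMap_injective A₁ D).2 hιinj
  have : Module.IsTorsionFree A₁ D := FaithfulSMul.to_isTorsionFree A₁ D
  have : CharZero R := charZero_of_injective_algebraMap
    (algebraMap F R).injective
  have : CharZero A₁ := charZero_of_injective_algebraMap (R := R)
    (fun a b hab => hRE (congrArg (fun c : A₁ => (c : E)) hab))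
  let jA : A →ₐ[R] D := (IsScalarTower.toAlgHom R A Ω).codRestrict D fun a =>
    (Algebra.IsIntegral.isIntegral (R := R) a).map (IsScalarTower.toAlgHom R A Ω)
  let jA₁ : A →ₐ[R] A₁ := (IsScalarTower.toAlgHom R A E).codRestrict A₁ fun a =>
    (Algebra.IsIntegral.isIntegral (R := R) a).map (IsScalarTower.toAlgHom R A E)
  have hjA : ∀ a, ((jA a : D) : Ω) = algebraMap A Ω a := fun a => rfl
  have hjA₁ : ∀ a, algebraMap A₁ D (jA₁ a) = jA a := fun a => Subtype.ext (by
    rw [hι, hjA, IsScalarTower.algebraMap_apply A E Ω]; rfl)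
  have hjAinj : Function.Injective jA := fun a b hab => hAΩ (by rw [← hjA, ← hjA, hab])
  have hjAint : (jA : A →+* D).IsIntegral := by
    refine RingHom.IsIntegral.tower_top (algebraMap R A) _ ?_
    rw [show (jA : A →+* D).comp (algebraMap R A) = algebraMap R D from jA.comp_algebraMap]
    exact algebraMap_isIntegral_iff.2 inferInstance
  let fD : R →ₐ[F] D := IsScalarTower.toAlgHom F R D
  have hfDinj : Function.Injective fD := fun a b hab => hRΩ (congrArg (fun d : D => (d : Ω)) hab)
  have hfDint : (fD : R →+* D).IsIntegral := algebraMap_isIntegral_iff.2 inferInstance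
  have hjAF : ∀ a : F, jA (algebraMap F A a) = algebraMap F D a := fun a => Subtype.ext (by
    rw [hjA, ← IsScalarTower.algebraMap_apply]; rfl)
  obtain ⟨xD, hxD⟩ := exists_ringHom_extension' hjAint hjAinj (x : A →+* K)
  have hxDA : ∀ a, xD (jA a) = x a := fun a => RingHom.congr_fun hxD a
  have hxDF : ∀ a, xD (algebraMap F D a) = algebraMap F K a := fun a => by
    rw [← hjAF, hxDA, x.commutes]
  let xD' : D →ₐ[F] K := { xD with commutes' := hxDF }
  have hs' : (fun y : D →+* K => y.comp (jA : A →+* D)) ⁻¹' s ∈ nhdsHom (xD' : D →+* K) := by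
    have ht : Tendsto (fun y : D →+* K => y.comp (jA : A →+* D)) (nhdsHom (xD' : D →+* K))
        (nhdsHom (x : A →+* K)) := by
      refine tendsto_nhdsHom_iff.2 fun a => ?_
      have := tendsto_apply_nhdsHom (xD' : D →+* K) (jA a)
      rw [show (xD' : D →+* K) (jA a) = (x : A →+* K) a from hxDA a] at this
      exact this
    exact ht hs
  let θ : D := ⟨ρ • θ₀, hρint _ (Finset.mem_insert_self _ _)⟩
  let g : D := algebraMap R D ρ
  have hg : g ≠ 0 := fun h => hρ (hfDinj (h.trans (map_zero fD).symm))
  have hθΩ : (θ : Ω) = algebraMap R Ω ρ * θ₀ := Algebra.smul_def _ _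
  -- The element kept nonzero is the product of the derivative, which yields a second root, and `ρ`,
  -- which lets the points descend to `A'`.
  obtain ⟨y, hys, hyint, hye, hyθ⟩ := hR D fD hfDinj hfDint θ _
    (mul_ne_zero (aeval_derivative_minpoly_ne_zero (R := A₁) θ) hg) xD' _ hs'
  rw [map_mul, mul_ne_zero_iff] at hye
  -- Degree one would put `θ`, hence `θ₀ = θ / ρ`, in `E`.
  have hdeg : 2 ≤ (minpoly A₁ θ).natDegree := by
    have hint : IsIntegral A₁ θ := Algebra.IsIntegral.isIntegral θ
    have hpos := minpoly.natDegree_pos hint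
    by_contra hlt
    obtain ⟨c, hc⟩ := minpoly.mem_range_of_degree_eq_one A₁ θ
      ((degree_eq_iff_natDegree_eq_of_pos one_pos).2 (by omega))
    refine hθ₀E ⟨(algebraMap R E ρ)⁻¹ * (c : E), ?_⟩
    have hρΩ : algebraMap R Ω ρ ≠ 0 := fun h => hρ (hRΩ (by rw [h, map_zero]))
    rw [map_mul, map_inv₀, ← IsScalarTower.algebraMap_apply, ← hι, hc, hθΩ,
      inv_mul_cancel_left₀ hρΩ]
  obtain ⟨y', hy', hne⟩ := exists_ringHom_apply_ne (R := A₁) (y : D →+* K) hdeg hye.1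
  have hy'A₁ : ∀ c : A₁, y' (algebraMap A₁ D c) = y (algebraMap A₁ D c) :=
    fun c => RingHom.congr_fun hy' c
  have hy'A : ∀ a, y' (jA a) = y (jA a) := fun a => by rw [← hjA₁, hy'A₁]
  have hy'F : ∀ a, y' (algebraMap F D a) = algebraMap F K a := fun a => by
    rw [← hjAF, hy'A, hjAF, y.commutes]
  let y'F : D →ₐ[F] K := { y' with commutes' := hy'F }
  let jAF : A →ₐ[F] D := { (jA : A →+* D) with commutes' := hjAF }
  let i : D →ₐ[F] Ω := { (D.val : D →+* Ω) with commutes' := fun a => rfl }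
  have hi : Function.Injective i := Subtype.val_injective
  have hden : ∀ t ∈ (G : Set Ω), ∃ d, i g * t = i d := fun t ht =>
    ⟨⟨ρ • t, hρint _ (Finset.mem_insert_of_mem ht)⟩, (Algebra.smul_def ρ t).symm⟩
  obtain ⟨ψ₁, hψ₁⟩ := exists_algHom_of_denominators i hi A' hG hden y hye.2
  have hgA : g = jA (algebraMap R A ρ) := (jA.commutes ρ).symm
  obtain ⟨ψ₂, hψ₂⟩ := exists_algHom_of_denominators i hi A' hG hden y'F (by
    change y' g ≠ 0
    rw [hgA, hy'A, ← hgA]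
    exact hye.2)
  -- The value of `t` is algebraic, so the field it generates over `F` consists of polynomials in
  -- it, and the value of `θ` is that of a polynomial in `t`. The function `θ - α` then separates
  -- the two points even up to conjugation.
  obtain ⟨α, hα⟩ : ∃ α : A, y (jA α) = y θ := by
    have h2 : y θ ∈ (F⟮y (fD t)⟯).toSubalgebra := hyθ
    rw [IntermediateField.adjoin_simple_toSubalgebra_of_isAlgebraic (hyint _).isAlgebraic,
      Algebra.adjoin_singleton_eq_range_aeval] at h2
    obtain ⟨q, hq⟩ := h2
    refine ⟨aeval (algebraMap R A t) q, ?_⟩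
    change aeval (y (fD t)) q = _ at hq
    rw [← hq]
    change (y.comp jAF) _ = _
    rw [← aeval_algHom_apply]
    congr 2
    change y (jA _) = _
    rw [jA.commutes]
    rfl
  have hθA' : (θ : Ω) ∈ A' := by
    rw [hθΩ, IsScalarTower.algebraMap_apply R A Ω]
    exact mul_mem (hAA' _) hθ₀
  refine ⟨y.comp jAF, hys, fun a => hyint _, ψ₁, ψ₂, fun a => hψ₁ _ (jA a) rfl,
    fun a => (hψ₂ _ (jA a) rfl).trans (hy'A a), ⟨θ, hθA'⟩ - ⟨algebraMap A Ω α, hAA' α⟩, ?_, ?_⟩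
  · rw [map_sub, hψ₁ _ θ rfl, hψ₁ _ (jA α) rfl, hα, sub_self]
  · rw [map_sub, hψ₂ _ θ rfl, hψ₂ _ (jA α) rfl]
    change y' θ - y' (jA α) ≠ 0
    rw [hy'A, hα, sub_ne_zero]
    exact hne

lemma exists_two_specializations_of_algHom.{v} {F K R A E : Type*} {Ω : Type v} [Field F] [CharZero F]
    [NormedField K] [IsAlgClosed K] [Algebra F K] [CommRing R] [IsDomain R] [Algebra F R] {t : R}
    (hR : HasRationalSpecializations.{v} F K R t) [CommRing A] [IsDomain A] [Algebra F A] [Field E] [Field Ω]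
    [Algebra A E] [IsFractionRing A E] [Algebra E Ω] [Algebra A Ω] [IsScalarTower A E Ω]
    [Algebra F Ω] [IsScalarTower F A Ω] [Algebra.IsAlgebraic A Ω] (f : R →ₐ[F] A)
    (hf : Function.Injective f) (hfint : (f : R →+* A).IsIntegral)
    (A' : Subalgebra F Ω) (hA' : A'.FG)
    (hAA' : ∀ a, algebraMap A Ω a ∈ A') {θ₀ : Ω} (hθ₀ : θ₀ ∈ A')
    (hθ₀E : θ₀ ∉ Set.range (algebraMap E Ω)) (x : A →ₐ[F] K) {s : Set (A →+* K)}
    (hs : s ∈ nhdsHom (x : A →+* K)) :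
    ∃ y : A →ₐ[F] K, (y : A →+* K) ∈ s ∧ (∀ a, IsIntegral F (y a)) ∧
      ∃ ψ₁ ψ₂ : A' →ₐ[F] K, (∀ a, ψ₁ ⟨algebraMap A Ω a, hAA' a⟩ = y a) ∧
        (∀ a, ψ₂ ⟨algebraMap A Ω a, hAA' a⟩ = y a) ∧ ∃ c, ψ₁ c = 0 ∧ ψ₂ c ≠ 0 := by
  let _ : Algebra R A := (f : R →+* A).toAlgebra
  have : IsScalarTower F R A := IsScalarTower.of_algebraMap_eq fun a => (f.commutes a).symm
  let _ : Algebra R E := ((algebraMap A E).comp (f : R →+* A)).toAlgebra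
  let _ : Algebra R Ω := ((algebraMap A Ω).comp (f : R →+* A)).toAlgebra
  have : IsScalarTower R A E := IsScalarTower.of_algebraMap_eq fun a => rfl
  have : IsScalarTower R A Ω := IsScalarTower.of_algebraMap_eq fun a => rfl
  have : IsScalarTower R E Ω := IsScalarTower.of_algebraMap_eq fun a =>
    IsScalarTower.algebraMap_apply A E Ω _
  have : IsScalarTower F R Ω := IsScalarTower.of_algebraMap_eq fun a => by
    rw [IsScalarTower.algebraMap_apply F A Ω, IsScalarTower.algebraMap_apply R A Ω,
      ← IsScalarTower.algebraMap_apply F R A]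
  have : Algebra.IsIntegral R A := ⟨hfint⟩
  have : FaithfulSMul R A := (faithfulSMul_iff_algebraMap_injective R A).2 hf
  exact exists_two_specializations_of_isIntegral (E := E) hR A' hA' hAA' hθ₀ hθ₀E x hs

/-- Near every point of a positive-dimensional finitely generated domain `A` there are algebraic
points with at least two points of `A'` above them, for a finitely generated algebra `A'` that
contains `A` and is not contained in its fraction field. -/
theorem exists_two_specializations {F K A E Ω : Type*} [Field F] [CharZero F]
    [NormedField K] [IsAlgClosed K] [Algebra F K]
    (hdense : Dense {z : K | IsIntegral F z}) {ϖ : F} (h0 : ϖ ≠ 0) (h1' : ‖algebraMap F K ϖ‖ < 1)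
    [CommRing A] [IsDomain A] [Algebra F A] [Algebra.FiniteType F A] [Field E] [Field Ω]
    [Algebra A E] [IsFractionRing A E] [Algebra E Ω] [Algebra A Ω] [IsScalarTower A E Ω]
    [Algebra F Ω] [IsScalarTower F A Ω] [Algebra.IsAlgebraic A Ω]
    (hA : ¬ Algebra.IsIntegral F A) (A' : Subalgebra F Ω) (hA' : A'.FG)
    (hAA' : ∀ a, algebraMap A Ω a ∈ A') {θ₀ : Ω} (hθ₀ : θ₀ ∈ A')
    (hθ₀E : θ₀ ∉ Set.range (algebraMap E Ω)) (x : A →ₐ[F] K) {s : Set (A →+* K)}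
    (hs : s ∈ nhdsHom (x : A →+* K)) :
    ∃ y : A →ₐ[F] K, (y : A →+* K) ∈ s ∧ (∀ a, IsIntegral F (y a)) ∧
      ∃ ψ₁ ψ₂ : A' →ₐ[F] K, (∀ a, ψ₁ ⟨algebraMap A Ω a, hAA' a⟩ = y a) ∧
        (∀ a, ψ₂ ⟨algebraMap A Ω a, hAA' a⟩ = y a) ∧ ∃ c, ψ₁ c = 0 ∧ ψ₂ c ≠ 0 := by
  obtain ⟨n, f₀, hf₀, hf₀int⟩ := exists_integral_inj_algHom_of_fg F A
  cases n with
  -- With no variables in the Noether normalisation, `A` would be integral over `F`.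
  | zero =>
    have h1 : f₀ = (Algebra.ofId F A).comp
        (MvPolynomial.isEmptyAlgEquiv F (Fin 0) : MvPolynomial (Fin 0) F →ₐ[F] F) :=
      MvPolynomial.algHom_ext fun i => i.elim0
    rw [h1] at hf₀int
    exact absurd ⟨RingHom.IsIntegral.tower_top _ _ hf₀int⟩ hA
  | succ n =>
    let ε := (MvPolynomial.finSuccEquiv F n).symm
    let f : (MvPolynomial (Fin n) F)[X] →ₐ[F] A := f₀.comp ε
    have h1 : f₀ = f.comp (MvPolynomial.finSuccEquiv F n :
        MvPolynomial (Fin (n + 1)) F →ₐ[F] (MvPolynomial (Fin n) F)[X]) :=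
      AlgHom.ext fun p => by simp [f, ε]
    have hspec : HasRationalSpecializations F K (MvPolynomial (Fin n) F)[X] X :=
      fun D _ _ _ f hf hi θ e he x s hs =>
        exists_specialization hdense h0 h1' f hf hi θ he x hs
    refine exists_two_specializations_of_algHom (E := E) hspec f (hf₀.comp ε.injective) ?_ A' hA'
      hAA' hθ₀ hθ₀E x hs
    rw [h1] at hf₀int
    exact RingHom.IsIntegral.tower_top _ _ hf₀int

end TwoPoints

end SparseDense

namespace SparseDense

/-! ### Divided differences and integer values of `s ^ D * g (1 / s)`. -/

section DividedDifferences

open Polynomial Filter Topology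

/-- Rolle's theorem between consecutive zeros, listed in increasing order so that the new zeros are
distinct. -/
lemma exists_zeros_of_hasDerivAt {f f' : ℝ → ℝ} {a : ℝ} (hf : ∀ x > a, HasDerivAt f (f' x) x)
    {n : ℕ} {S : Finset ℝ} (hcard : S.card = n + 1) (hS : ∀ x ∈ S, a < x ∧ f x = 0) :
    ∃ S' : Finset ℝ, S'.card = n ∧ ∀ x ∈ S', a < x ∧ f' x = 0 := by
  let e := S.orderEmbOfFin hcard
  have he : ∀ i, a < e i ∧ f (e i) = 0 := fun i => hS _ (S.orderEmbOfFin_mem hcard i)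
  have hroll : ∀ i : Fin n, ∃ c ∈ Set.Ioo (e i.castSucc) (e i.succ), f' c = 0 := fun i =>
    exists_hasDerivAt_eq_zero (e.strictMono i.castSucc_lt_succ)
      (fun x hx => (hf x ((he _).1.trans_le hx.1)).continuousAt.continuousWithinAt)
      ((he _).2.trans (he _).2.symm) (fun x hx => hf x ((he _).1.trans hx.1))
  choose c hc hc0 using hroll
  have hmono : StrictMono c := fun i j hij =>
    (hc i).2.trans_le ((e.monotone (Fin.succ_le_castSucc_iff.2 hij)).trans (hc j).1.le)
  refine ⟨Finset.univ.map ⟨c, hmono.injective⟩, by simp, fun x hx => ?_⟩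
  obtain ⟨i, -, rfl⟩ := Finset.mem_map.1 hx
  exact ⟨(he _).1.trans (hc i).1, hc0 i⟩

lemma exists_zero_of_zeros {Φ : ℕ → ℝ → ℝ} {a : ℝ}
    (hΦ : ∀ k, ∀ x > a, HasDerivAt (Φ k) (Φ (k + 1) x) x) (m k : ℕ) {S : Finset ℝ}
    (hcard : S.card = m + 1) (hS : ∀ x ∈ S, a < x ∧ Φ k x = 0) : ∃ ξ > a, Φ (k + m) ξ = 0 := by
  induction m generalizing k S with
  | zero =>
    obtain ⟨x, hx⟩ := Finset.card_pos.1 (show 0 < S.card by omega)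
    exact ⟨x, hS x hx⟩
  | succ m ih =>
    obtain ⟨S', hcard', hS'⟩ := exists_zeros_of_hasDerivAt (hΦ k) hcard hS
    have := ih (k + 1) hcard' hS'
    rwa [Nat.add_right_comm, Nat.add_assoc] at this

/-- The mean value theorem for divided differences. -/
lemma exists_eq_divided_difference {Φ : ℕ → ℝ → ℝ} {a : ℝ}
    (hΦ : ∀ k, ∀ x > a, HasDerivAt (Φ k) (Φ (k + 1) x) x) {m : ℕ} {S : Finset ℝ}
    (hcard : S.card = m + 1) (hS : ∀ x ∈ S, a < x) :
    ∃ ξ > a, Φ m ξ = m.factorial * ∑ x ∈ S, Φ 0 x / ∏ y ∈ S.erase x, (x - y) := by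
  set p := Lagrange.interpolate S id (Φ 0)
  have hinj : Set.InjOn (id : ℝ → ℝ) S := Set.injOn_id _
  have hp : ∀ x ∈ S, p.eval x = Φ 0 x := fun x hx =>
    Lagrange.eval_interpolate_at_node (v := id) _ hinj hx
  -- The difference between `Φ 0` and its interpolant vanishes at `m + 1` points, so its `m`-th
  -- derivative has a zero; the `m`-th derivative of the interpolant is `m!` times its top
  -- coefficient, the divided difference.
  obtain ⟨ξ, hξ, h⟩ := exists_zero_of_zeros
    (Φ := fun k x => Φ k x - (derivative^[k] p).eval x) (a := a) (fun k x hx => by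
      refine (hΦ k x hx).sub ?_
      rw [Function.iterate_succ_apply']
      exact Polynomial.hasDerivAt _ _) m 0 hcard
    (fun x hx => ⟨hS x hx, by simp [hp x hx]⟩)
  refine ⟨ξ, hξ, ?_⟩
  rw [zero_add, sub_eq_zero] at h
  rw [h, Lagrange.eval_iterate_derivative_eq_sum hinj (Lagrange.degree_interpolate_lt _ hinj)
    (k := m) (by omega)]
  congr 1
  refine Finset.sum_congr rfl fun x hx => ?_
  rw [hcard, Nat.sub_self, Finset.powersetCard_zero, Finset.sum_singleton, Finset.prod_empty,
    mul_one]
  simp only [id]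
  rw [hp x hx]

/-- The derivatives of `s ^ D * g (1 / s)` for `g` analytic at zero. -/
lemma exists_derivatives {g : ℝ → ℝ} (hg : AnalyticAt ℝ g 0) (D : ℕ) :
    ∃ (Φ : ℕ → ℝ → ℝ) (a : ℝ) (h : ℝ → ℝ), 0 < a ∧
      (∀ k, ∀ x > a, HasDerivAt (Φ k) (Φ (k + 1) x) x) ∧ (∀ x, Φ 0 x = x ^ D * g x⁻¹) ∧
      AnalyticAt ℝ h 0 ∧ h 0 = 0 ∧ ∀ x > a, Φ (D + 1) x = h x⁻¹ := by
  obtain ⟨U, hU, hgU⟩ := hg.exists_mem_nhds_analyticOnNhd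
  obtain ⟨ε, hε, hεU⟩ := Metric.mem_nhds_iff.1 hU
  -- With `u = 1 / x`, differentiating `x ^ (D - k) * G k u` gives `x ^ (D - k - 1) * ((D - k) * G k
  -- u - u * (G k)' u)`. After `D + 1` steps the prefactor is `x⁻¹ = u`, hence `h u = u * G (D + 1)
  -- u` vanishes at zero.
  let G : ℕ → ℝ → ℝ := fun k => Nat.rec g (fun k f u => ((D : ℝ) - k) * f u - u * deriv f u) k
  have hGs : ∀ k, G (k + 1) = fun u => ((D : ℝ) - k) * G k u - u * deriv (G k) u := fun k => rfl
  have hG : ∀ k, AnalyticOnNhd ℝ (G k) (Metric.ball 0 ε) := by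
    intro k
    induction k with
    | zero => exact hgU.mono hεU
    | succ k ih =>
      rw [hGs]
      exact (analyticOnNhd_const.mul ih).sub (analyticOnNhd_id.mul ih.deriv)
  refine ⟨fun k x => x ^ ((D : ℤ) - k) * G k x⁻¹, ε⁻¹, fun u => u * G (D + 1) u, by positivity,
    ?_, ?_, ?_, by simp, ?_⟩
  · intro k x hx
    have hx0 : 0 < x := (inv_pos.2 hε).trans hx
    have hxb : x⁻¹ ∈ Metric.ball (0 : ℝ) ε := by
      rw [mem_ball_zero_iff, Real.norm_of_nonneg (by positivity)]
      exact inv_lt_of_inv_lt₀ hε hx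
    have h1 := (hasDerivAt_zpow ((D : ℤ) - k) x (Or.inl hx0.ne')).mul
      (((hG k _ hxb).differentiableAt.hasDerivAt).comp x (hasDerivAt_inv hx0.ne'))
    convert! h1 using 1
    change x ^ ((D : ℤ) - (k + 1 : ℕ)) * G (k + 1) x⁻¹ = _
    rw [hGs]
    have e1 : x ^ ((D : ℤ) - k) = x ^ ((D : ℤ) - (k + 1 : ℕ)) * x := by
      rw [← zpow_add_one₀ hx0.ne']; congr 1; push_cast; ring
    have e2 : ((D : ℤ) - k - 1) = ((D : ℤ) - (k + 1 : ℕ)) := by push_cast; ring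
    rw [e2, e1]
    push_cast
    simp only [Function.comp]
    field_simp
    ring
  · intro x
    simp [G]
  · exact analyticAt_id.mul (hG (D + 1) 0 (Metric.mem_ball_self hε))
  · intro x hx
    simp [zpow_neg]

/-- By isolation of zeros, the `(D + 1)`-st derivative of `s ^ D * g (1 / s)` is, for large `s`,
either identically zero, and the function is a polynomial of degree at most `D`, or never zero while
tending to zero. In the second case `D + 2` integer values in a short interval would give a nonzero
divided difference of bounded denominator that is too small. -/
lemma eventually_or_eventually {g : ℝ → ℝ} (hg : AnalyticAt ℝ g 0) (D : ℕ) :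
    (∃ q : ℝ[X], ∀ᶠ s : ℕ in atTop, g (s : ℝ)⁻¹ = q.eval (s : ℝ)⁻¹) ∨
      ∃ n : ℕ, ∀ L : ℕ, ∀ᶠ T : ℕ in atTop, ∀ S : Finset ℕ,
        (∀ s ∈ S, T ≤ s ∧ s ≤ T + L ∧ ∃ z : ℤ, (s : ℝ) ^ D * g (s : ℝ)⁻¹ = z) → S.card ≤ n := by
  classical
  obtain ⟨Φ, a, h, ha, hΦ, hΦ0, hh, hh0, hΦh⟩ := exists_derivatives hg D
  have hcast : Function.Injective (Nat.cast : ℕ → ℝ) := Nat.cast_injective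
  rcases hh.eventually_eq_zero_or_eventually_ne_zero with hzero | hne
  · left
    obtain ⟨ε, hε, hzero⟩ := Metric.eventually_nhds_iff.1 hzero
    obtain ⟨N, hN⟩ := exists_nat_gt (max a ε⁻¹)
    have hNa : ∀ s : ℕ, N ≤ s → max a ε⁻¹ < s := fun s hs =>
      hN.trans_le (by exact_mod_cast hs)
    have hvan : ∀ x > max a ε⁻¹, Φ (D + 1) x = 0 := fun x hx => by
      have hx0 : 0 < x := ha.trans ((le_max_left _ _).trans_lt hx)
      rw [hΦh x ((le_max_left _ _).trans_lt hx)]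
      refine hzero ?_
      rw [dist_zero_right, Real.norm_of_nonneg (by positivity)]
      exact inv_lt_of_inv_lt₀ hε ((le_max_right _ _).trans_lt hx)
    -- The interpolant `p` at `D + 1` fixed nodes is the polynomial sought: adding any later node
    -- `s` contributes a top coefficient equal to a vanishing divided difference, so the interpolant
    -- does not change and agrees with the function at `s`. Reflecting `p` in degree `D` converts it
    -- to a polynomial in `1 / s`.
    let S₀ : Finset ℝ := (Finset.Ico N (N + (D + 1))).map ⟨_, hcast⟩
    have hS₀ : S₀.card = D + 1 := by simp [S₀]
    set p := Lagrange.interpolate S₀ id (Φ 0)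
    have hinj : ∀ S : Finset ℝ, Set.InjOn (id : ℝ → ℝ) S := fun S => Set.injOn_id _
    have hpdeg : p.degree < S₀.card := Lagrange.degree_interpolate_lt _ (hinj _)
    refine ⟨p.reflect D, ?_⟩
    filter_upwards [eventually_ge_atTop (N + (D + 1))] with s hs
    have hsN := hNa s (by omega)
    have hs0 : (0 : ℝ) < s := ha.trans ((le_max_left _ _).trans_lt hsN)
    have hsS : (s : ℝ) ∉ S₀ := by
      simp only [S₀, Finset.mem_map, Finset.mem_Ico, Function.Embedding.coeFn_mk, Nat.cast_inj,
        exists_eq_right]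
      omega
    set S := insert (s : ℝ) S₀
    have hScard : S.card = D + 1 + 1 := by rw [Finset.card_insert_of_notMem hsS, hS₀]
    have hSa : ∀ x ∈ S, max a ε⁻¹ < x := by
      intro x hx
      rcases Finset.mem_insert.1 hx with rfl | hx
      · exact hsN
      · obtain ⟨k, hk, rfl⟩ := Finset.mem_map.1 hx
        exact hNa k (Finset.mem_Ico.1 hk).1
    set p' := Lagrange.interpolate S id (Φ 0)
    have hp'deg : p'.degree < S.card := Lagrange.degree_interpolate_lt _ (hinj _)
    have hp'eval : ∀ x ∈ S, p'.eval x = Φ 0 x := fun x hx =>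
      Lagrange.eval_interpolate_at_node (v := id) _ (hinj _) hx
    obtain ⟨ξ, hξ, hξe⟩ := exists_eq_divided_difference
      (fun k x hx => hΦ k x ((le_max_left _ _).trans_lt hx)) hScard hSa
    rw [hvan ξ hξ] at hξe
    have hcoeff : p'.coeff (D + 1) = 0 := by
      have h1 := Lagrange.coeff_eq_sum (hinj S) hp'deg
      rw [hScard, Nat.add_sub_cancel] at h1
      rw [h1]
      have h2 := (mul_eq_zero.1 hξe.symm).resolve_left
        (by exact_mod_cast (Nat.factorial_pos _).ne')
      rw [← h2]
      exact Finset.sum_congr rfl fun x hx => by simp only [id]; rw [hp'eval x hx]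
    have hpp' : p' = p := by
      refine Polynomial.eq_of_degrees_lt_of_eval_finset_eq S₀ ?_ hpdeg fun x hx => ?_
      · rw [hS₀]
        rw [hScard] at hp'deg
        rw [degree_lt_iff_coeff_zero]
        intro k hk
        rcases Nat.eq_or_lt_of_le hk with rfl | hk
        · exact hcoeff
        · exact (degree_lt_iff_coeff_zero _ _).1 hp'deg k hk
      · rw [hp'eval x (Finset.mem_insert_of_mem hx)]
        exact (Lagrange.eval_interpolate_at_node (v := id) _ (hinj _) hx).symm
    have hfin : p.eval (s : ℝ) = (s : ℝ) ^ D * g (s : ℝ)⁻¹ := by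
      rw [← hΦ0, ← hpp', hp'eval _ (Finset.mem_insert_self _ _)]
    let _ : Invertible (s : ℝ) := invertibleOfNonzero hs0.ne'
    have hpnat : p.natDegree ≤ D := by
      rw [hS₀] at hpdeg
      exact natDegree_le_iff_coeff_eq_zero.2 fun k hk =>
        coeff_eq_zero_of_degree_lt (hpdeg.trans_le (by exact_mod_cast hk))
    have hrefl := eval₂_reflect_mul_pow (RingHom.id ℝ) (s : ℝ) D p hpnat
    rw [invOf_eq_inv, ← Polynomial.eval, ← Polynomial.eval, hfin, mul_comm] at hrefl
    exact (mul_left_cancel₀ (pow_ne_zero _ hs0.ne') hrefl).symm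
  · right
    refine ⟨D + 1, fun L => ?_⟩
    -- A crude bound for the product of all differences of `D + 2` integers in an interval of length
    -- `L`.
    set B : ℝ := ((L : ℝ) + 1) ^ ((D + 2) * (D + 2)) with hB
    have hB0 : 0 < B := by positivity
    have hsmall : ∀ᶠ u in 𝓝 (0 : ℝ), ‖h u‖ < B⁻¹ := by
      have := hh.continuousAt.norm
      rw [ContinuousAt, hh0, norm_zero] at this
      exact this.eventually (gt_mem_nhds (inv_pos.2 hB0))
    obtain ⟨ε, hε, hsn⟩ := Metric.eventually_nhds_iff.1
      (hsmall.and (eventually_nhdsWithin_iff.1 hne))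
    obtain ⟨N, hN⟩ := exists_nat_gt (max a ε⁻¹)
    filter_upwards [eventually_ge_atTop N] with T hT S hS
    by_contra! hlt
    obtain ⟨S₁, hS₁S, hS₁card⟩ := Finset.exists_subset_card_eq (show D + 1 + 1 ≤ S.card by omega)
    have hS₁T := fun s hs => hS s (hS₁S hs)
    let S' : Finset ℝ := S₁.map ⟨_, hcast⟩
    have hS'card : S'.card = D + 1 + 1 := by simp [S', hS₁card]
    obtain ⟨ξ, hξ, hξe⟩ := exists_eq_divided_difference
      (a := max a ε⁻¹) (fun k x hx => hΦ k x ((le_max_left _ _).trans_lt hx)) hS'card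
      (fun x hx => by
        obtain ⟨k, hk, rfl⟩ := Finset.mem_map.1 hx
        exact hN.trans_le (Nat.cast_le.2 (hT.trans (hS₁T k hk).1)))
    have hξ0 : 0 < ξ := ha.trans ((le_max_left _ _).trans_lt hξ)
    obtain ⟨hlt1, hne1⟩ := hsn (y := ξ⁻¹) (by
      rw [dist_zero_right, Real.norm_of_nonneg (by positivity)]
      exact inv_lt_of_inv_lt₀ hε ((le_max_right _ _).trans_lt hξ))
    have hne1 := hne1 (inv_pos.2 hξ0).ne'
    rw [← hΦh ξ ((le_max_left _ _).trans_lt hξ)] at hlt1 hne1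
    -- `V` clears every denominator of the divided difference, so `V * Φ (D + 1) ξ` is an integer.
    -- It has absolute value below `B * B⁻¹ = 1`, yet neither factor vanishes.
    set V : ℤ := ∏ s ∈ S₁, ∏ t ∈ S₁.erase s, ((s : ℤ) - t) with hV
    have hV0 : V ≠ 0 := Finset.prod_ne_zero_iff.2 fun s _ => Finset.prod_ne_zero_iff.2
      fun t ht => sub_ne_zero.2 (by exact_mod_cast (Finset.ne_of_mem_erase ht).symm)
    have hVB : |(V : ℝ)| ≤ B := by
      rw [hV]
      push_cast
      rw [Finset.abs_prod]
      calc _ ≤ ∏ s ∈ S₁, ((L : ℝ) + 1) ^ (D + 2) := by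
            refine Finset.prod_le_prod (fun _ _ => abs_nonneg _) fun s hs => ?_
            rw [Finset.abs_prod]
            calc _ ≤ ∏ t ∈ S₁.erase s, ((L : ℝ) + 1) := by
                  refine Finset.prod_le_prod (fun _ _ => abs_nonneg _) fun t ht => ?_
                  obtain ⟨h1, h2, -⟩ := hS₁T s hs
                  obtain ⟨h3, h4, -⟩ := hS₁T t (Finset.mem_of_mem_erase ht)
                  have h1 : (T : ℝ) ≤ s := by exact_mod_cast h1
                  have h2 : (s : ℝ) ≤ T + L := by exact_mod_cast h2
                  have h3 : (T : ℝ) ≤ t := by exact_mod_cast h3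
                  have h4 : (t : ℝ) ≤ T + L := by exact_mod_cast h4
                  rw [abs_le]
                  constructor <;> linarith
              _ = ((L : ℝ) + 1) ^ (S₁.erase s).card := by rw [Finset.prod_const]
              _ ≤ _ := pow_le_pow_right₀ (by linarith [(Nat.cast_nonneg L : (0 : ℝ) ≤ L)])
                  ((Finset.card_erase_le).trans hS₁card.le)
        _ = B := by rw [Finset.prod_const, hS₁card, ← pow_mul, hB]
    choose! z hz using fun s hs => (hS₁T s hs).2.2
    have hint : ∃ w : ℤ, (V : ℝ) * Φ (D + 1) ξ = w := by
      refine ⟨(D + 1).factorial * ∑ s ∈ S₁, z s * ∏ s' ∈ S₁.erase s,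
        ∏ t ∈ S₁.erase s', ((s' : ℤ) - t), ?_⟩
      rw [hξe, Finset.sum_map]
      push_cast
      rw [mul_left_comm, Finset.mul_sum]
      congr 1
      refine Finset.sum_congr rfl fun s hs => ?_
      have e1 : ∏ y ∈ S'.erase (s : ℝ), ((s : ℝ) - y) = ∏ t ∈ S₁.erase s, ((s : ℝ) - t) := by
        have : S'.erase (s : ℝ) = (S₁.erase s).map ⟨_, hcast⟩ := by
          rw [Finset.map_erase]; rfl
        rw [this, Finset.prod_map]
        rfl
      have hne : ∏ t ∈ S₁.erase s, ((s : ℝ) - t) ≠ 0 := Finset.prod_ne_zero_iff.2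
        fun t ht => sub_ne_zero.2 (by exact_mod_cast (Finset.ne_of_mem_erase ht).symm)
      simp only [Function.Embedding.coeFn_mk]
      rw [e1, hΦ0, hz s hs, hV, ← Finset.mul_prod_erase S₁ _ hs]
      push_cast
      field_simp
    obtain ⟨w, hw⟩ := hint
    have hw1 : |(w : ℝ)| < 1 := by
      rw [← hw, abs_mul]
      calc _ ≤ B * |Φ (D + 1) ξ| := by gcongr
        _ < B * B⁻¹ := by gcongr; exact hlt1
        _ = 1 := mul_inv_cancel₀ hB0.ne'
    have hw0 : w = 0 := Int.abs_lt_one_iff.1 (by exact_mod_cast hw1)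
    rw [hw0, Int.cast_zero, mul_eq_zero] at hw
    exact hw.elim (by exact_mod_cast hV0) hne1

end DividedDifferences

end SparseDense

namespace SparseDense

/-! ### Hilbert irreducibility: denominators of factors and analytic root branches. -/

section HilbertIrreducibility

open Polynomial Filter Topology

/-- The denominators of the coefficients of a monic factor of a monic polynomial. -/
lemma exists_int_eq_pow_mul_coeff {p q : ℚ[X]} (hp : p.Monic) (hq : q.Monic) (hqp : q ∣ p) {N : ℕ}
    (hpN : ∀ i, ∃ z : ℤ, (N : ℚ) * p.coeff i = z) (k : ℕ) :
    ∃ z : ℤ, (N : ℚ) ^ p.natDegree * q.coeff k = z := by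
  -- Scaling the roots by `N` multiplies the coefficient of index `i` by `N ^ (deg p - i)`, which
  -- makes `p` integral; by Gauss's lemma the scaled factor is integral as well.
  have hlift : p.scaleRoots (N : ℚ) ∈ lifts (algebraMap ℤ ℚ) := by
    rw [lifts_iff_coeff_lifts]
    intro i
    rw [coeff_scaleRoots]
    rcases lt_trichotomy i p.natDegree with hi | hi | hi
    · obtain ⟨z, hz⟩ := hpN i
      obtain ⟨e, he⟩ := Nat.exists_eq_add_of_lt hi
      refine ⟨z * (N : ℤ) ^ e, ?_⟩
      have : p.natDegree - i = e + 1 := by omega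
      rw [this, pow_succ']
      simp only [algebraMap_int_eq, eq_intCast, Int.cast_mul, Int.cast_pow, Int.cast_natCast]
      rw [← hz]; ring
    · refine ⟨1, ?_⟩
      rw [hi, hp.coeff_natDegree]; simp
    · exact ⟨0, by rw [coeff_eq_zero_of_natDegree_lt hi]; simp⟩
  obtain ⟨P, hP, -, hPm⟩ := lifts_and_degree_eq_and_monic hlift ((monic_scaleRoots_iff _).2 hp)
  obtain ⟨Q, hQ⟩ := IsIntegrallyClosed.eq_map_mul_C_of_dvd ℚ hPm
    (g := q.scaleRoots (N : ℚ)) (by rw [hP]; exact scaleRoots_dvd _ _ hqp)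
  rw [leadingCoeff_scaleRoots, hq.leadingCoeff, C_1, mul_one] at hQ
  have hdeg := natDegree_le_of_dvd hqp hp.ne_zero
  have h1 : (Q.coeff k : ℚ) = q.coeff k * (N : ℚ) ^ (q.natDegree - k) := by
    rw [← coeff_scaleRoots, ← hQ, coeff_map]; simp
  refine ⟨Q.coeff k * (N : ℤ) ^ (p.natDegree - (q.natDegree - k)), ?_⟩
  push_cast
  rw [h1, mul_assoc, ← pow_add, mul_comm, Nat.add_sub_cancel' (by omega)]

lemma exists_denominator_eval_inv (c : ℚ[X]) :
    ∃ m e : ℕ, m ≠ 0 ∧ ∀ s : ℕ, s ≠ 0 → ∃ z : ℤ, (m : ℚ) * s ^ e * c.eval (s : ℚ)⁻¹ = z := by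
  induction c using Polynomial.induction_on' with
  | add p q hp hq =>
    obtain ⟨m, e, hm, h⟩ := hp
    obtain ⟨m', e', hm', h'⟩ := hq
    refine ⟨m * m', e + e', mul_ne_zero hm hm', fun s hs => ?_⟩
    obtain ⟨z, hz⟩ := h s hs
    obtain ⟨z', hz'⟩ := h' s hs
    refine ⟨z * (m' * s ^ e') + z' * (m * s ^ e), ?_⟩
    push_cast
    rw [← hz, ← hz', Polynomial.eval_add]; ring
  | monomial n a =>
    refine ⟨a.den, n, a.den_ne_zero, fun s hs => ⟨a.num, ?_⟩⟩
    have hs' : (s : ℚ) ≠ 0 := by exact_mod_cast hs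
    rw [Polynomial.eval_monomial, ← Rat.mul_den_eq_num a, inv_pow]
    field_simp

lemma exists_denominator_coeff_eval_inv (P : ℚ[X][X]) :
    ∃ m e : ℕ, m ≠ 0 ∧ ∀ s : ℕ, s ≠ 0 → ∀ i, ∃ z : ℤ,
      (m : ℚ) * s ^ e * (P.map (evalRingHom (s : ℚ)⁻¹)).coeff i = z := by
  induction P using Polynomial.induction_on' with
  | add p q hp hq =>
    obtain ⟨m, e, hm, h⟩ := hp
    obtain ⟨m', e', hm', h'⟩ := hq
    refine ⟨m * m', e + e', mul_ne_zero hm hm', fun s hs i => ?_⟩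
    obtain ⟨z, hz⟩ := h s hs i
    obtain ⟨z', hz'⟩ := h' s hs i
    refine ⟨z * (m' * s ^ e') + z' * (m * s ^ e), ?_⟩
    push_cast
    rw [← hz, ← hz', Polynomial.map_add, coeff_add]; ring
  | monomial n c =>
    obtain ⟨m, e, hm, h⟩ := exists_denominator_eval_inv c
    refine ⟨m, e, hm, fun s hs i => ?_⟩
    rw [coeff_map, coeff_monomial]
    split_ifs
    · exact h s hs
    · exact ⟨0, by simp⟩

/-- Monic factors of the specialization of a monic polynomial at `1 / s` have bounded
denominators. -/
lemma exists_denominator_factors {P : ℚ[X][X]} (hP : P.Monic) :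
    ∃ m e : ℕ, m ≠ 0 ∧ ∀ s : ℕ, s ≠ 0 → ∀ q : ℚ[X], q.Monic →
      q ∣ P.map (evalRingHom (s : ℚ)⁻¹) → ∀ k, ∃ z : ℤ, (m : ℚ) * s ^ e * q.coeff k = z := by
  obtain ⟨m, e, hm, h⟩ := exists_denominator_coeff_eval_inv P
  refine ⟨m ^ P.natDegree, e * P.natDegree, pow_ne_zero _ hm, fun s hs q hq hqP k => ?_⟩
  obtain ⟨z, hz⟩ := exists_int_eq_pow_mul_coeff (hP.map (evalRingHom (s : ℚ)⁻¹)) hq hqP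
    (N := m * s ^ e) (by push_cast; exact h s hs) k
  refine ⟨z, ?_⟩
  rw [← hz, hP.natDegree_map]
  push_cast
  ring

lemma Monic.eq_prod_X_sub_C {K ι : Type*} [Field K] {p : K[X]} (hp : p.Monic) {Z : Finset ι}
    {a : ι → K} (ha : Set.InjOn a Z) (hroot : ∀ r ∈ Z, p.eval (a r) = 0)
    (hdeg : p.natDegree = Z.card) : p = ∏ r ∈ Z, (X - C (a r)) := by
  refine Polynomial.eq_of_monic_of_dvd_of_natDegree_le (monic_prod_X_sub_C _ _) hp
    (Finset.prod_dvd_of_coprime ?_ fun r hr => dvd_iff_isRoot.2 (hroot r hr)) ?_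
  · intro r hr r' hr' h
    exact isCoprime_X_sub_C_of_isUnit_sub (sub_ne_zero.2 (fun h' => h (ha hr hr' h'))).isUnit
  · rw [natDegree_finsetProd_X_sub_C_eq_card, hdeg]

lemma Monic.exists_eq_prod_of_dvd {K ι : Type*} [Field K] {q : K[X]} (hq : q.Monic)
    {Z : Finset ι} {a : ι → K} (hdvd : q ∣ ∏ r ∈ Z, (X - C (a r))) :
    ∃ I ⊆ Z, q = ∏ r ∈ I, (X - C (a r)) := by
  classical
  induction Z using Finset.induction_on generalizing q with
  | empty =>
    refine ⟨∅, subset_rfl, ?_⟩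
    rw [Finset.prod_empty] at hdvd ⊢
    exact hq.eq_one_of_isUnit (isUnit_of_dvd_one hdvd)
  | insert r Z hr ih =>
    rw [Finset.prod_insert hr] at hdvd
    by_cases h : X - C (a r) ∣ q
    · obtain ⟨q', rfl⟩ := h
      have hq' : q'.Monic := (monic_X_sub_C (a r)).of_mul_monic_left hq
      obtain ⟨I, hI, rfl⟩ := ih hq' ((mul_dvd_mul_iff_left (X_sub_C_ne_zero _)).1 hdvd)
      exact ⟨insert r I, Finset.insert_subset_insert _ hI,
        by rw [Finset.prod_insert fun h => hr (hI h)]⟩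
    · obtain ⟨I, hI, h⟩ := ih hq
        ((((irreducible_X_sub_C (a r)).coprime_iff_not_dvd.2 h).symm).dvd_of_dvd_mul_left hdvd)
      exact ⟨I, hI.trans (Finset.subset_insert _ _), h⟩

lemma isInvertible_of_apply_one_ne_zero {𝕜 : Type*} [NontriviallyNormedField 𝕜] (f : 𝕜 →L[𝕜] 𝕜)
    (hf : f 1 ≠ 0) : f.IsInvertible :=
  ⟨ContinuousLinearEquiv.unitsEquivAut 𝕜 (Units.mk0 _ hf), by ext; simp⟩

/-- A simple root of a polynomial with polynomial coefficients varies analytically with the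
parameter. -/
lemma exists_analyticAt_root (P : ℂ[X][X]) {r : ℂ}
    (hr : (P.map (evalRingHom 0)).eval r = 0)
    (hr' : (derivative (P.map (evalRingHom 0))).eval r ≠ 0) :
    ∃ ψ : ℂ → ℂ, AnalyticAt ℂ ψ 0 ∧ ψ 0 = r ∧
      ∀ᶠ t in 𝓝 (0 : ℂ), (P.map (evalRingHom t)).eval (ψ t) = 0 := by
  let f : ℂ × ℂ → ℂ := fun v => ∑ i ∈ Finset.range (P.natDegree + 1),
    aeval v.1 (P.coeff i) * v.2 ^ i
  have hf : ∀ v, f v = (P.map (evalRingHom v.1)).eval v.2 := fun v => by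
    rw [Polynomial.eval_map, eval₂_eq_sum_range]
    rfl
  have hfa : AnalyticAt ℂ f (0, r) := by
    refine Finset.analyticAt_fun_sum _ fun i _ => ?_
    exact (analyticAt_fst.aeval_polynomial _).mul (analyticAt_snd.pow _)
  have cdf : ContDiffAt ℂ ⊤ f (0, r) := hfa.contDiffAt
  have hder : HasDerivAt (fun y : ℂ => f (0, y))
      ((derivative (P.map (evalRingHom 0))).eval r) r := by
    simp only [hf]
    exact Polynomial.hasDerivAt _ _
  have hder' : (fderiv ℂ f (0, r) ∘L .inr ℂ ℂ ℂ) 1 =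
      (derivative (P.map (evalRingHom 0))).eval r := by
    have h1 := (hfa.differentiableAt.hasFDerivAt).comp_hasDerivAt r
      ((hasDerivAt_const r (0 : ℂ)).prodMk (hasDerivAt_id r))
    exact h1.unique hder
  have hinv := isInvertible_of_apply_one_ne_zero _ (hder'.trans_ne hr')
  have h0 : (⊤ : WithTop ℕ∞) ≠ 0 := by simp
  refine ⟨cdf.implicitFunction h0 hinv, (cdf.contDiffAt_implicitFunction h0 hinv).analyticAt,
    cdf.implicitFunction_apply_self h0 hinv, ?_⟩
  filter_upwards [cdf.eventually_apply_implicitFunction h0 hinv] with t ht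
  rw [hf, hf] at ht
  exact ht.trans hr

/-- A monic polynomial whose specialization at zero is separable splits into linear factors with
analytic roots near zero. -/
lemma exists_analyticAt_roots {P : ℂ[X][X]} (hP : P.Monic)
    (hsep : (P.map (evalRingHom 0)).Separable) :
    ∃ (Z : Finset ℂ) (ψ : ℂ → ℂ → ℂ), Z.card = P.natDegree ∧ (∀ r ∈ Z, AnalyticAt ℂ (ψ r) 0) ∧
      ∀ᶠ t in 𝓝 (0 : ℂ), P.map (evalRingHom t) = ∏ r ∈ Z, (X - C (ψ r t)) := by
  classical
  let Z := (P.map (evalRingHom (0 : ℂ))).roots.toFinset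
  have hZ : Z.card = P.natDegree := by
    rw [Multiset.toFinset_card_of_nodup (nodup_roots hsep), ← hP.natDegree_map (evalRingHom (0:ℂ))]
    exact (IsAlgClosed.splits _).natDegree_eq_card_roots.symm
  have hroot : ∀ r : ℂ, ∃ ψ : ℂ → ℂ, r ∈ Z → (AnalyticAt ℂ ψ 0 ∧ ψ 0 = r ∧
      ∀ᶠ t in 𝓝 (0 : ℂ), (P.map (evalRingHom t)).eval (ψ t) = 0) := by
    intro r
    by_cases hr : r ∈ Z
    · have hr0 : (P.map (evalRingHom 0)).eval r = 0 :=
        (mem_roots'.1 (Multiset.mem_toFinset.1 hr)).2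
      obtain ⟨ψ, h⟩ := exists_analyticAt_root P hr0 (hsep.eval₂_derivative_ne_zero (RingHom.id ℂ)
        (by simpa [eval₂_id] using hr0))
      exact ⟨ψ, fun _ => h⟩
    · exact ⟨0, fun h => absurd h hr⟩
  choose ψ hψ using hroot
  refine ⟨Z, ψ, hZ, fun r hr => (hψ r hr).1, ?_⟩
  have h1 : ∀ᶠ t in 𝓝 (0 : ℂ), ∀ r ∈ Z, (P.map (evalRingHom t)).eval (ψ r t) = 0 :=
    (Finset.eventually_all Z).2 fun r hr => (hψ r hr).2.2
  have h2 : ∀ᶠ t in 𝓝 (0 : ℂ), ∀ r ∈ Z, ∀ r' ∈ Z, r ≠ r' → ψ r t ≠ ψ r' t := by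
    refine (Finset.eventually_all Z).2 fun r hr => (Finset.eventually_all Z).2 fun r' hr' => ?_
    by_cases h : r = r'
    · exact Eventually.of_forall fun _ h' => absurd h h'
    · have hsub := ((hψ r hr).1.continuousAt.sub (hψ r' hr').1.continuousAt).eventually_ne
        (y := 0) (by rw [Pi.sub_apply, (hψ r hr).2.1, (hψ r' hr').2.1]; exact sub_ne_zero.2 h)
      filter_upwards [hsub] with t ht _ using sub_ne_zero.1 ht
  filter_upwards [h1, h2] with t ht1 ht2
  refine Monic.eq_prod_X_sub_C (hP.map _) (fun r hr r' hr' h => ?_) ht1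
    (by rw [hP.natDegree_map, hZ])
  by_contra hne
  exact ht2 r hr r' hr' hne h

/-- A complex polynomial taking rational values at infinitely many rational points has rational
coefficients. -/
lemma exists_map_eq_of_infinite (q : ℂ[X]) {T : Set ℚ} (hT : T.Infinite)
    (h : ∀ t ∈ T, ∃ v : ℚ, q.eval (t : ℂ) = v) :
    ∃ q' : ℚ[X], q'.map (algebraMap ℚ ℂ) = q := by
  classical
  choose! v hv using h
  obtain ⟨S, hST, hS⟩ := hT.exists_subset_card_eq (q.natDegree + 1)
  let q' : ℚ[X] := Lagrange.interpolate S id v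
  have hinj : Set.InjOn (id : ℚ → ℚ) S := Function.injective_id.injOn
  refine ⟨q', ?_⟩
  have hc : (S.image (algebraMap ℚ ℂ)).card = S.card :=
    Finset.card_image_of_injective _ (algebraMap ℚ ℂ).injective
  refine eq_of_degrees_lt_of_eval_finset_eq (S.image (algebraMap ℚ ℂ)) ?_ ?_ ?_
  · rw [hc, degree_map]
    exact Lagrange.degree_interpolate_lt _ hinj
  · rw [hc, hS]
    exact (degree_le_natDegree).trans_lt (by exact_mod_cast Nat.lt_succ_self _)
  · intro x hx
    obtain ⟨t, ht, rfl⟩ := Finset.mem_image.1 hx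
    rw [Polynomial.eval_map_algebraMap, aeval_algebraMap_apply]
    have h1 : q'.eval t = v t := Lagrange.eval_interpolate_at_node (v := id) v hinj ht
    rw [coe_aeval_eq_eval, h1]
    simpa using (hv t (hST ht)).symm

lemma map_map_evalRingHom {R S : Type*} [CommRing R] [CommRing S] (f : R →+* S) (P : R[X][X])
    (t : R) :
    (P.map (mapRingHom f)).map (evalRingHom (f t)) = (P.map (evalRingHom t)).map f := by
  rw [Polynomial.map_map, Polynomial.map_map]
  congr 1
  ext <;> simp

lemma analyticAt_coeff_prod {ι : Type*} {I : Finset ι} {ψ : ι → ℂ → ℂ} {z : ℂ}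
    (hψ : ∀ r ∈ I, AnalyticAt ℂ (ψ r) z) (k : ℕ) :
    AnalyticAt ℂ (fun t => (∏ r ∈ I, (X - C (ψ r t))).coeff k) z := by
  classical
  induction I using Finset.induction_on generalizing k with
  | empty =>
    simp only [Finset.prod_empty]
    exact analyticAt_const
  | insert r I hr ih =>
    have ih' := ih fun r hr => hψ r (Finset.mem_insert_of_mem hr)
    have h1 := hψ r (Finset.mem_insert_self _ _)
    simp only [Finset.prod_insert hr, sub_mul, coeff_sub, coeff_C_mul]
    cases k with
    | zero =>
      simp only [coeff_X_mul_zero]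
      exact analyticAt_const.sub (h1.mul (ih' 0))
    | succ k =>
      simp only [coeff_X_mul]
      exact (ih' k).sub (h1.mul (ih' (k + 1)))

lemma dvd_of_infinite_dvd_map_eval {P Q : ℚ[X][X]} (hQ : Q.Monic) {T : Set ℚ} (hT : T.Infinite)
    (h : ∀ t ∈ T, Q.map (evalRingHom t) ∣ P.map (evalRingHom t)) : Q ∣ P := by
  rw [← modByMonic_eq_zero_iff_dvd hQ]
  ext1 i
  refine eq_zero_of_infinite_isRoot _ (hT.mono fun t ht => ?_)
  have h1 := (modByMonic_eq_zero_iff_dvd (hQ.map (evalRingHom t))).2 (h t ht)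
  rw [← map_modByMonic _ hQ] at h1
  have h2 := congrArg (fun p => coeff p i) h1
  simpa [coeff_map] using h2

/-- An irreducible polynomial with analytic roots has few specializations `1 / s`, with `s` in a
short interval, at which a given proper subset of the roots defines a rational factor. -/
lemma exists_bound_card_factor {P : ℚ[X][X]} (hP : P.Monic) (hirr : Irreducible P) {Z : Finset ℂ}
    {ψ : ℂ → ℂ → ℂ} (hZ : Z.card = P.natDegree) (hψ : ∀ r ∈ Z, AnalyticAt ℂ (ψ r) 0)
    {I : Finset ℂ} (hI : I ⊆ Z) (hI0 : I.Nonempty) (hIZ : I ≠ Z) :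
    ∃ n : ℕ, ∀ L : ℕ, ∀ᶠ T : ℕ in atTop, ∀ S : Finset ℕ,
      (∀ s ∈ S, T ≤ s ∧ s ≤ T + L ∧ ∃ Q : ℚ[X], Q.Monic ∧ Q ∣ P.map (evalRingHom (s : ℚ)⁻¹) ∧
        Q.map (algebraMap ℚ ℂ) = ∏ r ∈ I, (X - C (ψ r (s : ℂ)⁻¹))) → S.card ≤ n := by
  classical
  obtain ⟨m, e, hm, hden⟩ := exists_denominator_factors hP
  have hm' : (m : ℂ) ≠ 0 := by exact_mod_cast hm
  let Φ : ℂ → ℂ[X] := fun t => ∏ r ∈ I, (X - C (ψ r t))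
  have hΦm : ∀ t, (Φ t).Monic := fun t => monic_prod_X_sub_C _ _
  have hΦd : ∀ t, (Φ t).natDegree = I.card := fun t => natDegree_finsetProd_X_sub_C_eq_card _ _
  have hΦ : ∀ k, AnalyticAt ℂ (fun t => (m : ℂ) * (Φ t).coeff k) ((0 : ℝ) : ℂ) := fun k =>
    analyticAt_const.mul (by
      rw [Complex.ofReal_zero]
      exact analyticAt_coeff_prod (fun r hr => hψ r (hI hr)) k)
  have hint : ∀ s : ℕ, s ≠ 0 → ∀ Q : ℚ[X], Q.Monic → Q ∣ P.map (evalRingHom (s : ℚ)⁻¹) →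
      Q.map (algebraMap ℚ ℂ) = Φ (s : ℂ)⁻¹ → ∀ k, ∃ z : ℤ,
        (s : ℝ) ^ e * ((m : ℂ) * (Φ ((s : ℝ)⁻¹ : ℝ)).coeff k).re = z ∧
        (s : ℝ) ^ e * ((m : ℂ) * (Φ ((s : ℝ)⁻¹ : ℝ)).coeff k).im = (0 : ℤ) := by
    intro s hs Q hQ hQP hQΦ k
    obtain ⟨z, hz⟩ := hden s hs Q hQ hQP k
    have h1 : (Φ ((s : ℝ)⁻¹ : ℝ)).coeff k = ((Q.coeff k : ℚ) : ℝ) := by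
      have : (((s : ℝ)⁻¹ : ℝ) : ℂ) = (s : ℂ)⁻¹ := by push_cast; rfl
      rw [this, ← hQΦ, coeff_map]
      simp
    refine ⟨z, ?_, ?_⟩
    · rw [h1, ← Complex.ofReal_natCast, ← Complex.ofReal_mul, Complex.ofReal_re]
      have : ((m * s ^ e * Q.coeff k : ℚ) : ℝ) = z := by rw [hz]; simp
      rw [← this]; push_cast; ring
    · rw [h1, ← Complex.ofReal_natCast, ← Complex.ofReal_mul, Complex.ofReal_im]
      simp
  have hre := fun k => eventually_or_eventually (hΦ k).re_ofReal e
  have him := fun k => eventually_or_eventually (hΦ k).im_ofReal e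
  -- A rational factor makes the real part of every scaled coefficient an integer and its imaginary
  -- part zero. If a single one of these real functions takes integer values rarely, the bound
  -- follows; otherwise all coefficients are eventually polynomials in `1 / s`.
  by_cases hsparse : ∃ k, (∃ n : ℕ, ∀ L : ℕ, ∀ᶠ T : ℕ in atTop, ∀ S : Finset ℕ,
        (∀ s ∈ S, T ≤ s ∧ s ≤ T + L ∧ ∃ z : ℤ, (s : ℝ) ^ e *
          ((m : ℂ) * (Φ ((s : ℝ)⁻¹ : ℝ)).coeff k).re = z) → S.card ≤ n) ∨
      (∃ n : ℕ, ∀ L : ℕ, ∀ᶠ T : ℕ in atTop, ∀ S : Finset ℕ,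
        (∀ s ∈ S, T ≤ s ∧ s ≤ T + L ∧ ∃ z : ℤ, (s : ℝ) ^ e *
          ((m : ℂ) * (Φ ((s : ℝ)⁻¹ : ℝ)).coeff k).im = z) → S.card ≤ n)
  · obtain ⟨k, ⟨n, hn⟩ | ⟨n, hn⟩⟩ := hsparse
    · refine ⟨n, fun L => ?_⟩
      filter_upwards [hn L, eventually_ge_atTop 1] with T hT hT1 S hS
      refine hT S fun s hs => ?_
      obtain ⟨h1, h2, Q, hQ, hQP, hQΦ⟩ := hS s hs
      obtain ⟨z, hz, -⟩ := hint s (by omega) Q hQ hQP hQΦ k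
      exact ⟨h1, h2, z, hz⟩
    · refine ⟨n, fun L => ?_⟩
      filter_upwards [hn L, eventually_ge_atTop 1] with T hT hT1 S hS
      refine hT S fun s hs => ?_
      obtain ⟨h1, h2, Q, hQ, hQP, hQΦ⟩ := hS s hs
      obtain ⟨z, -, hz⟩ := hint s (by omega) Q hQ hQP hQΦ k
      exact ⟨h1, h2, 0, hz⟩
  have hpoly : ∀ k, ∃ q : ℂ[X], ∀ᶠ s : ℕ in atTop,
      (Φ (s : ℂ)⁻¹).coeff k = q.eval (s : ℂ)⁻¹ := by
    intro k
    rw [not_exists] at hsparse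
    have := not_or.1 (hsparse k)
    obtain ⟨a, ha⟩ := (hre k).resolve_right this.1
    obtain ⟨b, hb⟩ := (him k).resolve_right this.2
    refine ⟨C (m : ℂ)⁻¹ * (a.map (algebraMap ℝ ℂ) + C Complex.I * b.map (algebraMap ℝ ℂ)), ?_⟩
    filter_upwards [ha, hb] with s h1 h2
    have hs : (s : ℂ)⁻¹ = algebraMap ℝ ℂ (s : ℝ)⁻¹ := by simp
    rw [Polynomial.eval_mul, Polynomial.eval_add, Polynomial.eval_mul, Polynomial.eval_C,
      Polynomial.eval_C, hs, Polynomial.eval_map_algebraMap, Polynomial.eval_map_algebraMap,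
      aeval_algebraMap_apply, aeval_algebraMap_apply, coe_aeval_eq_eval,
      ← h1, ← h2, eq_inv_mul_iff_mul_eq₀ hm', mul_comm Complex.I]
    exact (Complex.re_add_im _).symm
  choose q hq using hpoly
  -- If only finitely many `s` give a rational factor, late intervals contain none. If infinitely
  -- many do, the polynomial coefficients take rational values infinitely often, hence are rational,
  -- and assemble to a factor of `P`.
  by_cases hfin : {s : ℕ | ∃ Q : ℚ[X], Q.Monic ∧ Q ∣ P.map (evalRingHom (s : ℚ)⁻¹) ∧
        Q.map (algebraMap ℚ ℂ) = Φ (s : ℂ)⁻¹}.Finite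
  · obtain ⟨N, hN⟩ := hfin.bddAbove
    refine ⟨0, fun L => ?_⟩
    filter_upwards [eventually_gt_atTop N] with T hT S hS
    rw [Nat.le_zero, Finset.card_eq_zero, Finset.eq_empty_iff_forall_notMem]
    intro s hs
    obtain ⟨h1, -, h2⟩ := hS s hs
    exact absurd (hN h2) (by omega)
  exfalso
  have hall : ∀ᶠ s : ℕ in atTop, ∀ k ∈ Finset.range I.card,
      (Φ (s : ℂ)⁻¹).coeff k = (q k).eval (s : ℂ)⁻¹ :=
    (Finset.eventually_all _).2 fun k _ => hq k
  obtain ⟨N, hN⟩ := eventually_atTop.1 hall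
  have hinf := Set.Infinite.sdiff hfin (Set.finite_lt_nat N)
  have hinj : Function.Injective (fun s : ℕ => (s : ℚ)⁻¹) := fun a b h => by
    simpa using h
  have hTinf := hinf.image hinj.injOn
  have hrat : ∀ k ∈ Finset.range I.card, ∃ q' : ℚ[X], q'.map (algebraMap ℚ ℂ) = q k := by
    intro k hk
    refine exists_map_eq_of_infinite _ hTinf ?_
    rintro _ ⟨s, ⟨⟨Q, -, -, hQ⟩, hs⟩, rfl⟩
    refine ⟨Q.coeff k, ?_⟩
    have h1 := hN s (not_lt.1 hs) k hk
    rw [← hQ, coeff_map] at h1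
    simpa using h1.symm
  choose! q' hq' using hrat
  have hdeg : (∑ k ∈ Finset.range I.card, C (q' k) * X ^ k).degree < ((I.card : ℕ) : WithBot ℕ) := by
    refine (degree_sum_le _ _).trans_lt ?_
    rw [Finset.sup_lt_iff (WithBot.bot_lt_coe _)]
    intro k hk
    exact (degree_C_mul_X_pow_le _ _).trans_lt (by exact_mod_cast Finset.mem_range.1 hk)
  let R : ℚ[X][X] := X ^ I.card + ∑ k ∈ Finset.range I.card, C (q' k) * X ^ k
  have hR : R.Monic := monic_X_pow_add hdeg
  have hRd : R.natDegree = I.card := by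
    rw [natDegree_eq_of_degree_eq_some]
    rw [degree_add_eq_left_of_degree_lt] <;> rw [degree_X_pow]
    exact hdeg
  -- The remainder of `P` modulo the monic `R` has coefficients vanishing at infinitely many `1 /
  -- s`. Then `R` has degree strictly between `0` and `deg P`, against irreducibility.
  have hRP : R ∣ P := by
    refine dvd_of_infinite_dvd_map_eval hR hTinf ?_
    rintro _ ⟨s, ⟨⟨Q, -, hQP, hQ⟩, hs⟩, rfl⟩
    convert! hQP
    refine map_injective _ (algebraMap ℚ ℂ).injective ?_
    rw [hQ, (hΦm _).as_sum, hΦd]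
    simp only [R, Polynomial.map_add, Polynomial.map_pow, map_X, Polynomial.map_sum,
      Polynomial.map_mul, map_C]
    congr 1
    refine Finset.sum_congr rfl fun k hk => ?_
    rw [hN s (not_lt.1 hs) k hk, ← hq' k hk]
    congr 2
    have hs' : (s : ℂ)⁻¹ = algebraMap ℚ ℂ (s : ℚ)⁻¹ := by simp
    rw [hs', Polynomial.eval_map_algebraMap, aeval_algebraMap_apply, coe_aeval_eq_eval]
    rfl
  obtain ⟨W, hW⟩ := hRP
  rcases hirr.isUnit_or_isUnit hW with h | h
  · have := hR.eq_one_of_isUnit h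
    rw [this, natDegree_one] at hRd
    exact hI0.card_pos.ne hRd
  · have := (hR.of_mul_monic_left (hW ▸ hP)).eq_one_of_isUnit h
    rw [this, mul_one] at hW
    exact hIZ (Finset.eq_of_subset_of_card_le hI (by rw [hZ, hW, hRd]))

end HilbertIrreducibility

end SparseDense

namespace SparseDense

/-! ### Hilbert's irreducibility theorem and one-point fibers. -/

section HilbertIrreducibility

open Polynomial Filter Topology

/-- If all large `s` gave reducible specialisations, each would be charged to a proper nonempty
subset of the root branches. There are finitely many subsets, and each accounts for a bounded number
of `s` in any late interval, whatever its length. -/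
lemma frequently_irreducible_of_separable {P : ℚ[X][X]} (hP : P.Monic) (hirr : Irreducible P)
    (hsep : (P.map (evalRingHom 0)).Separable) :
    ∃ᶠ s : ℕ in atTop, Irreducible (P.map (evalRingHom (s : ℚ)⁻¹)) := by
  classical
  let PC : ℂ[X][X] := P.map (mapRingHom (algebraMap ℚ ℂ))
  have hPC : PC.Monic := hP.map _
  have hPCs : (PC.map (evalRingHom 0)).Separable := by
    have h := map_map_evalRingHom (algebraMap ℚ ℂ) P 0
    rw [map_zero] at h
    rw [h]
    exact hsep.map
  obtain ⟨Z, ψ, hZ, hψ, hprod⟩ := exists_analyticAt_roots hPC hPCs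
  rw [hP.natDegree_map] at hZ
  have hd : 0 < P.natDegree := by
    rw [Nat.pos_iff_ne_zero]
    intro h
    exact hirr.not_isUnit (by rw [hP.natDegree_eq_zero.1 h]; exact isUnit_one)
  intro hred
  have hlim : Tendsto (fun s : ℕ => (s : ℂ)⁻¹) atTop (𝓝 0) := tendsto_inv_atTop_nhds_zero_nat (𝕜 := ℂ)
  have hfac : ∀ᶠ s : ℕ in atTop, ∃ I ∈ Z.powerset.filter fun I => I.Nonempty ∧ I ≠ Z,
      ∃ Q : ℚ[X], Q.Monic ∧ Q ∣ P.map (evalRingHom (s : ℚ)⁻¹) ∧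
        Q.map (algebraMap ℚ ℂ) = ∏ r ∈ I, (X - C (ψ r (s : ℂ)⁻¹)) := by
    filter_upwards [hred, hlim.eventually hprod] with s hs hprod
    have hPs := hP.map (evalRingHom (s : ℚ)⁻¹)
    have hne : P.map (evalRingHom (s : ℚ)⁻¹) ≠ 1 := fun h => by
      rw [← hP.natDegree_map (evalRingHom (s : ℚ)⁻¹), h, natDegree_one] at hd
      exact lt_irrefl _ hd
    rw [hPs.irreducible_iff_natDegree', not_and] at hs
    have := hs hne
    push Not at this
    obtain ⟨f, Q, -, hQ, hfQ, hdeg⟩ := this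
    rw [Finset.mem_Ioc, hP.natDegree_map] at hdeg
    have hQP : Q ∣ P.map (evalRingHom (s : ℚ)⁻¹) := ⟨f, by rw [← hfQ, mul_comm]⟩
    have hdvd : Q.map (algebraMap ℚ ℂ) ∣ ∏ r ∈ Z, (X - C (ψ r (s : ℂ)⁻¹)) := by
      rw [← hprod]
      have h := map_map_evalRingHom (algebraMap ℚ ℂ) P (s : ℚ)⁻¹
      rw [map_inv₀, map_natCast] at h
      rw [h]
      exact Polynomial.map_dvd _ hQP
    obtain ⟨I, hI, hQI⟩ := Monic.exists_eq_prod_of_dvd (hQ.map _) hdvd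
    have hcard : I.card = Q.natDegree := by
      rw [← natDegree_map (algebraMap ℚ ℂ), hQI, natDegree_finsetProd_X_sub_C_eq_card]
    refine ⟨I, Finset.mem_filter.2 ⟨Finset.mem_powerset.2 hI, ?_, ?_⟩, Q, hQ, hQP, hQI⟩
    · exact Finset.card_pos.1 (by omega)
    · rintro rfl
      omega
  have hbound : ∀ I ∈ Z.powerset.filter fun I => I.Nonempty ∧ I ≠ Z, _ := fun I hI =>
    exists_bound_card_factor hP hirr hZ hψ (Finset.mem_powerset.1 (Finset.mem_filter.1 hI).1)
      (Finset.mem_filter.1 hI).2.1 (Finset.mem_filter.1 hI).2.2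
  choose! n hn using hbound
  -- An interval of length `L` contains `L + 1` integers, one more than the subsets can account for.
  -- This is possible because the bounds `n I` do not depend on `L`.
  let L := ∑ I ∈ Z.powerset.filter fun I => I.Nonempty ∧ I ≠ Z, n I
  obtain ⟨T, hT1, hT2⟩ := ((eventually_forall_ge_atTop.2 hfac).and
    ((Finset.eventually_all _).2 fun I hI => hn I hI L)).exists
  have hsub : Finset.Icc T (T + L) ⊆ (Z.powerset.filter fun I => I.Nonempty ∧ I ≠ Z).biUnion
      fun I => (Finset.Icc T (T + L)).filter fun s : ℕ => ∃ Q : ℚ[X], Q.Monic ∧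
        Q ∣ P.map (evalRingHom (s : ℚ)⁻¹) ∧
        Q.map (algebraMap ℚ ℂ) = ∏ r ∈ I, (X - C (ψ r (s : ℂ)⁻¹)) := by
    intro s hs
    obtain ⟨I, hI, h⟩ := hT1 s (Finset.mem_Icc.1 hs).1
    exact Finset.mem_biUnion.2 ⟨I, hI, Finset.mem_filter.2 ⟨hs, h⟩⟩
  have h1 := (Finset.card_le_card hsub).trans (Finset.card_biUnion_le.trans
    (Finset.sum_le_sum fun I hI => hT2 I hI _ fun s hs => by
      rw [Finset.mem_filter, Finset.mem_Icc] at hs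
      exact ⟨hs.1.1, hs.1.2, hs.2⟩))
  rw [Nat.card_Icc] at h1
  change T + L + 1 - T ≤ L at h1
  omega

lemma exists_eval_ne_zero (e : ℚ[X]) (he : e ≠ 0) : ∃ t, e.eval t ≠ 0 := by
  by_contra! h
  exact he (Polynomial.funext fun t => by simpa using h t)

/-- A Bézout identity between `P` and its derivative over the fraction field, cleared of
denominators, specialises to one wherever the common denominator does not vanish. -/
lemma exists_separable_specialization {P : ℚ[X][X]} (hP : P.Monic) (hirr : Irreducible P) :
    ∃ t : ℚ, (P.map (evalRingHom t)).Separable := by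
  have hirrK := (hP.irreducible_iff_irreducible_map_fraction_map (K := FractionRing ℚ[X])).1 hirr
  obtain ⟨a, b, hab⟩ := hirrK.separable
  obtain ⟨c, hc, hca⟩ := IsLocalization.integerNormalization_spec (nonZeroDivisors ℚ[X]) a
  obtain ⟨d, hd, hdb⟩ := IsLocalization.integerNormalization_spec (nonZeroDivisors ℚ[X]) b
  generalize IsLocalization.integerNormalization (nonZeroDivisors ℚ[X]) a = a' at hca
  generalize IsLocalization.integerNormalization (nonZeroDivisors ℚ[X]) b = b' at hdb
  have key : C d * a' * P + C c * b' * derivative P = C (c * d) := by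
    refine map_injective (algebraMap ℚ[X] (FractionRing ℚ[X])) (IsFractionRing.injective _ _) ?_
    simp only [Polynomial.map_add, Polynomial.map_mul, map_C, hca, hdb, ← derivative_map, map_mul]
    rw [Algebra.smul_def, Algebra.smul_def]
    change C _ * (C _ * a) * _ + C _ * (C _ * b) * _ = _
    rw [← mul_one (C _ * C _), ← hab]
    ring
  obtain ⟨t, ht⟩ := exists_eval_ne_zero (c * d)
    (mul_ne_zero (nonZeroDivisors.ne_zero hc) (nonZeroDivisors.ne_zero hd))
  refine ⟨t, C ((c * d).eval t)⁻¹ * (C d * a').map (evalRingHom t),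
    C ((c * d).eval t)⁻¹ * (C c * b').map (evalRingHom t), ?_⟩
  have h := congrArg (Polynomial.map (evalRingHom t)) key
  rw [Polynomial.map_add, Polynomial.map_mul, Polynomial.map_mul (q := derivative P), map_C,
    ← derivative_map, coe_evalRingHom] at h
  rw [mul_assoc, mul_assoc, ← mul_add, h, ← C_mul, inv_mul_cancel₀ ht, C_1]

/-- **Hilbert's irreducibility theorem** for one parameter over the rational numbers. -/
theorem exists_irreducible_specialization {P : ℚ[X][X]} (hP : P.Monic) (hirr : Irreducible P)
    {e : ℚ[X]} (he : e ≠ 0) :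
    ∃ t : ℚ, e.eval t ≠ 0 ∧ Irreducible (P.map (evalRingHom t)) := by
  obtain ⟨x₀, hx₀⟩ := exists_separable_specialization hP hirr
  -- Translate the parameter so that the separable specialisation sits at zero, the limit of the
  -- points `1 / s`.
  let σ : ℚ[X] ≃+* ℚ[X] := (taylorEquiv x₀).toRingEquiv
  have hσ : ∀ t, (P.map (σ : ℚ[X] →+* ℚ[X])).map (evalRingHom t) =
      P.map (evalRingHom (t + x₀)) := fun t => by
    rw [Polynomial.map_map]
    congr 1
    refine RingHom.ext fun p => ?_
    exact taylor_eval x₀ p t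
  have hfreq := frequently_irreducible_of_separable (hP.map (σ : ℚ[X] →+* ℚ[X]))
    ((MulEquiv.irreducible_iff (mapEquiv σ)).2 hirr) (by rw [hσ, zero_add]; exact hx₀)
  have hinf := Nat.frequently_atTop_iff_infinite.1 hfreq
  have hinj : Function.Injective (fun s : ℕ => (s : ℚ)⁻¹ + x₀) := fun a b h => by
    simpa using h
  obtain ⟨_, ⟨s, hs, rfl⟩, h⟩ := (hinf.image hinj.injOn).exists_notMem_finset e.roots.toFinset
  refine ⟨_, fun h0 => h (by simpa [he] using h0), ?_⟩
  rw [← hσ]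
  exact hs

/-- The specialization of a polynomial expression along a ring homomorphism lying over `X ↦ t`. -/
lemma map_aeval_eq_aeval_map_eval {M k : Type*} [CommRing M] [Algebra ℚ[X] M] [CommRing k]
    [Algebra ℚ k] (φ : M →+* k) {t : ℚ} (hφ : φ (algebraMap ℚ[X] M X) = algebraMap ℚ k t) (θ : M)
    (q : ℚ[X][X]) : φ (aeval θ q) = aeval (φ θ) (q.map (evalRingHom t)) := by
  have h : φ.comp (algebraMap ℚ[X] M) = (algebraMap ℚ k).comp (evalRingHom t) := by
    refine Polynomial.ringHom_ext' (Subsingleton.elim _ _) ?_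
    simp [hφ]
  rw [aeval_def, hom_eval₂, h, aeval_def, eval₂_map]

/-- A finite set of elements of an algebraic extension of domains lies, up to denominators, in the
algebra generated by one integral element. -/
lemma exists_isIntegral_forall_smul_eq_aeval {R M : Type*} [CommRing R] [IsDomain R] [CharZero R]
    [CommRing M] [IsDomain M] [Algebra R M] [FaithfulSMul R M] [Algebra.IsAlgebraic R M]
    (S : Finset M) :
    ∃ θ : M, IsIntegral R θ ∧ ∃ r : R, r ≠ 0 ∧ ∀ s ∈ S, ∃ q : R[X], r • s = aeval θ q := by
  classical
  let K := FractionRing R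
  let E := FractionRing M
  let _ : Algebra K E := FractionRing.liftAlgebra R E
  have : IsScalarTower R K E := FractionRing.isScalarTower_liftAlgebra R E
  have : Algebra.IsAlgebraic M E := IsLocalization.isAlgebraic E (nonZeroDivisors M)
  have : Algebra.IsAlgebraic R E := Algebra.IsAlgebraic.trans R M E
  have : Algebra.IsAlgebraic K E := Algebra.IsAlgebraic.extendScalars (IsFractionRing.injective R K)
  have : CharZero K := charZero_of_injective_algebraMap (IsFractionRing.injective R K)
  have hME : Function.Injective (algebraMap M E) := IsFractionRing.injective M E
  have hRE : Function.Injective (algebraMap R E) := by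
    rw [IsScalarTower.algebraMap_eq R M E]
    exact hME.comp (FaithfulSMul.algebraMap_injective R M)
  let L := IntermediateField.adjoin K (S.image (algebraMap M E) : Set E)
  have : FiniteDimensional K L :=
    IntermediateField.finiteDimensional_adjoin fun x _ => Algebra.IsIntegral.isIntegral x
  obtain ⟨α, hα⟩ := Field.exists_primitive_element K L
  -- Because `M` is algebraic over `R`, inverting the nonzero elements of `R` already yields `E`; so
  -- the primitive element has a denominator from `R`.
  obtain ⟨m, ⟨_, r, hr, rfl⟩, hm⟩ := IsLocalization.exists_mk'_eq
    (Algebra.algebraMapSubmonoid M (nonZeroDivisors R)) (α : E)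
  obtain ⟨r', hr', hint⟩ := (Algebra.IsAlgebraic.isAlgebraic (R := R) m).exists_integral_multiple
  have hr0 : algebraMap R E (r' * r) ≠ 0 := (map_ne_zero_iff _ hRE).2
    (mul_ne_zero hr' (nonZeroDivisors.ne_zero hr))
  have hαθ : (α : E) * algebraMap R E (r' * r) = algebraMap M E (r' • m) := by
    rw [IsLocalization.mk'_eq_iff_eq_mul] at hm
    rw [Algebra.smul_def, map_mul, map_mul, hm, IsScalarTower.algebraMap_apply R M E,
      IsScalarTower.algebraMap_apply R M E]
    ring
  refine ⟨r' • m, hint, ?_⟩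
  have key : ∀ s ∈ S, ∃ c : R, c ≠ 0 ∧ ∃ q : R[X], c • s = aeval (r' • m) q := by
    intro s hs
    have hsL : algebraMap M E s ∈ L := IntermediateField.subset_adjoin K _
      (by exact_mod_cast Finset.mem_image_of_mem _ hs)
    have hmem : (⟨_, hsL⟩ : L) ∈ (IntermediateField.adjoin K {α}).toSubalgebra := by
      rw [hα]; trivial
    rw [IntermediateField.adjoin_simple_toSubalgebra_of_isAlgebraic
      (Algebra.IsAlgebraic.isAlgebraic α), Algebra.adjoin_singleton_eq_range_aeval] at hmem
    obtain ⟨p, hp⟩ := hmem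
    have hp' : aeval (α : E) p = algebraMap M E s := by
      have h : L.val (aeval α p) = algebraMap M E s := congrArg L.val hp
      rw [← aeval_algHom_apply] at h
      exact h
    let p₂ := p.comp (C (algebraMap R K (r' * r))⁻¹ * X)
    have hp₂ : aeval (algebraMap M E (r' • m)) p₂ = algebraMap M E s := by
      rw [← hp', aeval_comp]
      congr 2
      rw [map_mul, aeval_C, aeval_X, map_inv₀, ← IsScalarTower.algebraMap_apply R K E, ← hαθ,
        mul_comm (α : E), inv_mul_cancel_left₀ hr0]
    obtain ⟨c, hc, hcp⟩ := IsLocalization.integerNormalization_spec (nonZeroDivisors R) p₂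
    refine ⟨c, nonZeroDivisors.ne_zero hc,
      IsLocalization.integerNormalization (nonZeroDivisors R) p₂, hME ?_⟩
    rw [← aeval_algebraMap_apply, ← aeval_map_algebraMap K, hcp, Algebra.smul_def, map_mul,
      ← IsScalarTower.algebraMap_apply, ← hp₂, ← Algebra.smul_def]
    rw [← algebraMap_smul K c p₂, map_smul (aeval (algebraMap M E (r' • m))), algebraMap_smul]
  choose! c hc q hq using key
  refine ⟨∏ s ∈ S, c s, Finset.prod_ne_zero_iff.2 hc, fun s hs => ?_⟩
  refine ⟨C (∏ s ∈ S.erase s, c s) * q s, ?_⟩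
  rw [map_mul, aeval_C, ← hq s hs, ← Finset.prod_erase_mul _ _ hs, mul_smul, Algebra.smul_def]

/-- A finite torsion-free domain over a principal open subset of the affine line over `ℚ` has exactly
one prime over some rational point of the open subset. -/
theorem exists_existsUnique_prime {R' M : Type*} [CommRing R'] [Algebra ℚ[X] R'] {g : ℚ[X]}
    (hg : g ≠ 0) [IsLocalization.Away g R'] [CommRing M] [IsDomain M] [Algebra ℚ[X] M]
    [Algebra R' M] [IsScalarTower ℚ[X] R' M] [Module.Finite R' M] [FaithfulSMul R' M] :
    ∃ t : ℚ, g.eval t ≠ 0 ∧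
      ∃! Q : Ideal M, Q.IsPrime ∧ algebraMap ℚ[X] M (X - C t) ∈ Q := by
  classical
  have hgM : Submonoid.powers g ≤ nonZeroDivisors ℚ[X] :=
    powers_le_nonZeroDivisors_of_noZeroDivisors hg
  have hR' : Function.Injective (algebraMap ℚ[X] R') := IsLocalization.injective R' hgM
  have hR'M := FaithfulSMul.algebraMap_injective R' M
  have hM : Function.Injective (algebraMap ℚ[X] M) := by
    rw [IsScalarTower.algebraMap_eq ℚ[X] R' M]
    exact hR'M.comp hR'
  have : IsDomain R' := hR'M.isDomain
  have : FaithfulSMul ℚ[X] M := (faithfulSMul_iff_algebraMap_injective _ _).2 hM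
  have : Algebra.IsAlgebraic ℚ[X] R' := IsLocalization.isAlgebraic R' (Submonoid.powers g)
  have : Algebra.IsAlgebraic ℚ[X] M := Algebra.IsAlgebraic.trans ℚ[X] R' M
  obtain ⟨S, hS⟩ := Module.Finite.fg_top (R := R') (M := M)
  obtain ⟨θ, hθ, r, hr, hrS⟩ := exists_isIntegral_forall_smul_eq_aeval (R := ℚ[X]) S
  have hall : ∀ m : M, ∃ n : ℕ, ∃ q : ℚ[X][X], (g ^ n * r) • m = aeval θ q := by
    intro m
    have hm : m ∈ Submodule.span R' (S : Set M) := by rw [hS]; trivial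
    induction hm using Submodule.span_induction with
    | mem s hs =>
      obtain ⟨q, hq⟩ := hrS s hs
      exact ⟨0, q, by simpa using hq⟩
    | zero => exact ⟨0, 0, by simp⟩
    | add a b _ _ ha hb =>
      obtain ⟨n, q, hq⟩ := ha
      obtain ⟨n', q', hq'⟩ := hb
      refine ⟨n + n', C (g ^ n') * q + C (g ^ n) * q', ?_⟩
      rw [map_add, map_mul, map_mul, aeval_C, aeval_C, ← hq, ← hq']
      simp only [Algebra.smul_def, map_mul, map_pow, pow_add]
      ring
    | smul a m _ hm =>
      obtain ⟨n, q, hq⟩ := hm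
      obtain ⟨⟨b, ⟨_, k, rfl⟩⟩, hb⟩ := IsLocalization.surj (Submonoid.powers g) a
      refine ⟨k + n, C b * q, ?_⟩
      rw [map_mul, aeval_C, ← hq]
      have hb' := congrArg (algebraMap R' M) hb
      simp only [map_mul, map_pow, ← IsScalarTower.algebraMap_apply] at hb'
      simp only [Algebra.smul_def, map_mul, map_pow, pow_add]
      rw [← hb']
      ring
  have hP : (minpoly ℚ[X] θ).Monic := minpoly.monic hθ
  obtain ⟨t, ht, hirr⟩ := exists_irreducible_specialization hP (minpoly.irreducible hθ)
    (mul_ne_zero hg hr)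
  rw [Polynomial.eval_mul] at ht
  have hgt := left_ne_zero_of_mul ht
  have hrt := right_ne_zero_of_mul ht
  -- Modulo any prime `Q` over `t`, the irreducible specialised polynomial is the minimal polynomial
  -- of the class of `θ`. Membership in `Q` thus becomes a divisibility that does not mention `Q`,
  -- whence uniqueness.
  have hmem : ∀ Q : Ideal M, Q.IsPrime → algebraMap ℚ[X] M (X - C t) ∈ Q →
      ∀ (m : M) (n : ℕ) (q : ℚ[X][X]), (g ^ n * r) • m = aeval θ q →
        (m ∈ Q ↔ (minpoly ℚ[X] θ).map (evalRingHom t) ∣ q.map (evalRingHom t)) := by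
    intro Q hQ hQt m n q hq
    let φ := Ideal.Quotient.mk Q
    let _ : Algebra ℚ (M ⧸ Q) := (φ.comp ((algebraMap ℚ[X] M).comp C)).toAlgebra
    have hφ : φ (algebraMap ℚ[X] M X) = algebraMap ℚ (M ⧸ Q) t := by
      rw [map_sub, ← Ideal.Quotient.eq_zero_iff_mem, map_sub, sub_eq_zero] at hQt
      exact hQt
    have h0 := map_aeval_eq_aeval_map_eval φ hφ θ (minpoly ℚ[X] θ)
    rw [minpoly.aeval, map_zero] at h0
    have hmin := minpoly.eq_of_irreducible_of_monic hirr h0.symm (hP.map _)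
    rw [hmin, minpoly.dvd_iff, ← map_aeval_eq_aeval_map_eval φ hφ, ← hq,
      Ideal.Quotient.eq_zero_iff_mem, Algebra.smul_def]
    refine ⟨fun h => Ideal.mul_mem_left _ _ h, fun h => (hQ.mem_or_mem h).resolve_left fun h => ?_⟩
    have hC := map_aeval_eq_aeval_map_eval φ hφ θ (C (g ^ n * r))
    rw [aeval_C, Ideal.Quotient.eq_zero_iff_mem.2 h, map_C, aeval_C, eq_comm,
      map_eq_zero_iff _ (algebraMap ℚ (M ⧸ Q)).injective] at hC
    simp [hgt, hrt] at hC
  refine ⟨t, hgt, existsUnique_of_exists_of_unique ?_ ?_⟩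
  · let ev : R' →+* ℚ := IsLocalization.Away.lift (g := evalRingHom t) g (isUnit_iff_ne_zero.2 hgt)
    have hev : ∀ p, ev (algebraMap ℚ[X] R' p) = p.eval t := fun p =>
      IsLocalization.Away.lift_eq g _ p
    have := RingHom.ker_isPrime ev
    obtain ⟨Q, -, hQ, hQv⟩ := Ideal.exists_ideal_over_prime_of_isIntegral (S := M)
      (RingHom.ker ev) ⊥ (by
        rw [← RingHom.ker_eq_comap_bot, (RingHom.injective_iff_ker_eq_bot _).1 hR'M]
        exact bot_le)
    refine ⟨Q, hQ, ?_⟩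
    rw [IsScalarTower.algebraMap_apply ℚ[X] R' M, ← Ideal.mem_comap, hQv, RingHom.mem_ker, hev]
    simp
  · rintro Q₁ Q₂ ⟨h₁, h₁'⟩ ⟨h₂, h₂'⟩
    ext m
    obtain ⟨n, q, hq⟩ := hall m
    rw [hmem Q₁ h₁ h₁' m n q hq, hmem Q₂ h₂ h₂' m n q hq]

end HilbertIrreducibility

end SparseDense

namespace SparseDense

/-! ### Density of algebraic numbers and the topology on points. -/

section Topology

open Polynomial Filter Topology

/-- The algebraic closure of `ℚ_[p]` is dense in `ℂ_[p]`, and approximating a minimal polynomial by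
one with rational coefficients approximates its roots by numbers algebraic over `ℚ`. -/
lemma dense_isIntegral_padicComplex (p : ℕ) [Fact p.Prime] (F : Type*) [Field F] [CharZero F]
    [Algebra F ℂ_[p]] : Dense {z : ℂ_[p] | IsIntegral F z} := by
  have h1 : ∀ a : PadicAlgCl p, ∀ δ > 0, ∃ b : PadicAlgCl p, ‖a - b‖ < δ ∧
      ∃ g : ℚ[X], g.Monic ∧ aeval b g = 0 := by
    intro a δ hδ
    have ha : IsIntegral ℚ_[p] a := Algebra.IsIntegral.isIntegral a
    let f := minpoly ℚ_[p] a
    have hfm : f.Monic := minpoly.monic ha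
    have hn : f.natDegree ≠ 0 := (minpoly.natDegree_pos ha).ne'
    have hε : 0 < (δ / max ‖a‖ 1) ^ f.natDegree / (f.natDegree + 1) := by positivity
    obtain ⟨g, gm, gdeg, gcoeff⟩ :=
      exists_monic_and_natDegree_eq_and_norm_map_algebraMap_coeff_sub_lt (K := ℚ) (L := ℚ_[p])
        (by
          rw [show (algebraMap ℚ ℚ_[p] : ℚ → ℚ_[p]) = Rat.cast from funext fun r => by simp]
          exact Padic.denseRange_ratCast p) hfm hε
    obtain ⟨b, hb, hab⟩ := exists_aroots_norm_sub_lt_of_norm_coeff_sub_lt (L := PadicAlgCl p)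
      hε (minpoly.aeval _ a) hfm (gm.map _) (gdeg ▸ g.natDegree_map _) gcoeff
      (IsAlgClosed.splits _)
    refine ⟨b, ?_, g, gm, ?_⟩
    · rw [mul_div_cancel₀ _ (by positivity), ← Real.rpow_natCast,
        ← Real.rpow_mul (by positivity), mul_inv_cancel₀ (by exact_mod_cast hn), Real.rpow_one,
        div_mul_cancel₀ _ (by positivity)] at hab
      exact hab
    · have h := (mem_aroots.1 hb).2
      rwa [aeval_map_algebraMap] at h
  rw [Metric.dense_iff]
  intro z ε hε
  obtain ⟨a, ha⟩ := Metric.denseRange_iff.1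
    (UniformSpace.Completion.denseRange_coe (α := PadicAlgCl p)) z (ε / 2) (half_pos hε)
  obtain ⟨b, hab, g, gm, hgb⟩ := h1 a (ε / 2) (half_pos hε)
  refine ⟨(b : ℂ_[p]), ?_, g.map (algebraMap ℚ F), gm.map _, ?_⟩
  · rw [Metric.mem_ball, dist_comm]
    refine (dist_triangle _ (a : ℂ_[p]) _).trans_lt ?_
    rw [UniformSpace.Completion.dist_eq, dist_eq_norm a b]
    linarith
  · rw [eval₂_map]
    have h2 : (algebraMap F ℂ_[p]).comp (algebraMap ℚ F) =
        (algebraMap (PadicAlgCl p) ℂ_[p]).comp (algebraMap ℚ (PadicAlgCl p)) :=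
      Subsingleton.elim _ _
    rw [h2, PadicComplex.coe_eq, ← hom_eval₂, ← aeval_def, hgb, map_zero]

variable {F K : Type u} [Field F] [NormedField K] {X : Scheme.{u}} {s : X ⟶ Spec (.of F)}
  {i : F →+* K}

lemma Points.point_eq {K : Type u} [Field K] {i : F →+* K} {Y : Scheme.{u}} (ι : Y ⟶ X)
    (φ : Spec (.of K) ⟶ Y) (x : Points i s) (hx : φ ≫ ι = x.1) :
    x.point = ι (φ (IsLocalRing.closedPoint K)) := by
  rw [Points.point, ← hx]
  rfl

lemma mem_asIdeal_closedPoint_iff {K : Type u} [Field K] {A : CommRingCat.{u}} (φ : A ⟶ .of K)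
    (a : A) :
    a ∈ (Spec.map φ (IsLocalRing.closedPoint K) : PrimeSpectrum A).asIdeal ↔ φ.hom a = 0 := by
  change φ.hom a ∈ IsLocalRing.maximalIdeal K ↔ _
  rw [IsLocalRing.mem_maximalIdeal, mem_nonunits_iff, isUnit_iff_ne_zero, not_not]

/-- Two affine open subschemes are related, near a common point, by fractions. -/
lemma exists_away_hom {K : Type u} [Field K] {A A' : CommRingCat.{u}} (ι : Spec A ⟶ X)
    (ι' : Spec A' ⟶ X) [IsOpenImmersion ι'] (φ : A ⟶ .of K) (φ' : A' ⟶ .of K)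
    (h : Spec.map φ ≫ ι = Spec.map φ' ≫ ι') :
    ∃ (g : A) (e : A' ⟶ .of (Localization.Away g)), φ.hom g ≠ 0 ∧
      Spec.map e ≫ ι' =
        Spec.map (CommRingCat.ofHom (algebraMap A (Localization.Away g))) ≫ ι := by
  let pt : Spec A := Spec.map φ (IsLocalRing.closedPoint K)
  have hpt : pt ∈ ι ⁻¹ᵁ ι'.opensRange := by
    refine ⟨Spec.map φ' (IsLocalRing.closedPoint K), ?_⟩
    exact (congrArg (fun f : Spec (.of K) ⟶ X => f (IsLocalRing.closedPoint K)) h).symm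
  obtain ⟨_, ⟨_, ⟨g, rfl⟩, rfl⟩, hg, hgU⟩ :=
    PrimeSpectrum.isBasis_basic_opens.exists_subset_of_mem_open hpt (ι ⁻¹ᵁ ι'.opensRange).2
  let loc : A ⟶ .of (Localization.Away g) :=
    CommRingCat.ofHom (algebraMap A (Localization.Away g))
  have hrange : Set.range (Spec.map loc ≫ ι) ⊆ Set.range ι' := by
    rintro _ ⟨q, rfl⟩
    have hq : PrimeSpectrum.comap (algebraMap A (Localization.Away g)) q ∈
        Set.range (PrimeSpectrum.comap (algebraMap A (Localization.Away g))) := ⟨q, rfl⟩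
    rw [PrimeSpectrum.localization_away_comap_range (Localization.Away g) g] at hq
    exact hgU hq
  refine ⟨g, Spec.preimage (IsOpenImmersion.lift ι' (Spec.map loc ≫ ι) hrange), ?_, ?_⟩
  · exact fun h0 => hg ((mem_asIdeal_closedPoint_iff φ g).2 h0)
  · rw [Spec.map_preimage, IsOpenImmersion.lift_fac]

/-- A function on another chart is, near the given point, a fraction `b / g ^ n` on this one, and
such fractions are continuous where `g` does not vanish. -/
lemma eventually_mem_basicSet {A A' : CommRingCat.{u}} (ι : Spec A ⟶ X) (ι' : Spec A' ⟶ X)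
    [IsOpenImmersion ι'] (φ : A ⟶ .of K) (x : Points i s) (hx : Spec.map φ ≫ ι = x.1)
    {a : A'} {V : Set K} (hV : IsOpen V) (hxV : x ∈ Points.basicSet i s ι' a V) :
    ∀ᶠ v in nhdsHom φ.hom, ∀ y : Points i s, Spec.map (CommRingCat.ofHom v) ≫ ι = y.1 →
      y ∈ Points.basicSet i s ι' a V := by
  obtain ⟨φ', hφ', haV⟩ := hxV
  obtain ⟨g, e, hg, he⟩ := exists_away_hom ι ι' φ φ' (hx.trans hφ'.symm)
  obtain ⟨⟨b, _, n, rfl⟩, hb⟩ := IsLocalization.surj (Submonoid.powers g) (e.hom a)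
  have hlift : ∀ v : A →+* K, v g ≠ 0 → ∃ w : A' →+* K, w a = v b / v g ^ n ∧
      Spec.map (CommRingCat.ofHom w) ≫ ι' = Spec.map (CommRingCat.ofHom v) ≫ ι := by
    intro v hv
    let vg : Localization.Away g →+* K :=
      IsLocalization.Away.lift (g := v) g (isUnit_iff_ne_zero.2 hv)
    have hvg : ∀ c, vg (algebraMap A _ c) = v c := fun c => IsLocalization.Away.lift_eq g _ c
    refine ⟨vg.comp e.hom, ?_, ?_⟩
    · rw [eq_div_iff (pow_ne_zero n hv), RingHom.comp_apply, ← map_pow, ← hvg, ← hvg, ← map_mul]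
      exact congrArg vg hb
    · have h1 : CommRingCat.ofHom (vg.comp e.hom) = e ≫ CommRingCat.ofHom vg := rfl
      have h2 : CommRingCat.ofHom v =
          CommRingCat.ofHom (algebraMap A (Localization.Away g)) ≫ CommRingCat.ofHom vg := by
        ext c
        exact (hvg c).symm
      rw [h1, h2, Spec.map_comp, Spec.map_comp, Category.assoc, Category.assoc, he]
  obtain ⟨w, hw, hwι⟩ := hlift φ.hom hg
  have hwφ : CommRingCat.ofHom w = φ' := by
    have : Spec.map (CommRingCat.ofHom w) = Spec.map φ' := by
      rw [← cancel_mono ι', hwι, hφ', ← hx]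
      rfl
    exact Spec.map_injective this
  rw [← hwφ] at haV
  change w a ∈ V at haV
  rw [hw] at haV
  have h1 := (tendsto_apply_nhdsHom φ.hom b).div ((tendsto_apply_nhdsHom φ.hom g).pow n)
    (pow_ne_zero n hg)
  filter_upwards [h1.eventually (hV.mem_nhds haV),
    (tendsto_apply_nhdsHom φ.hom g).eventually_ne hg] with v hv hvg y hy
  obtain ⟨u, hu, huι⟩ := hlift v hvg
  exact ⟨CommRingCat.ofHom u, huι.trans hy, by rw [CommRingCat.hom_ofHom, hu]; exact hv⟩

/-- The map from the ring homomorphisms on an affine open subset to the points of a scheme is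
continuous. -/
lemma eventually_mem_of_isOpen {A : CommRingCat.{u}} (ι : Spec A ⟶ X) (φ : A ⟶ .of K)
    (x : Points i s) (hx : Spec.map φ ≫ ι = x.1) {W : Set (Points i s)} (hW : IsOpen W)
    (hxW : x ∈ W) :
    ∀ᶠ v in nhdsHom φ.hom, ∀ y : Points i s, Spec.map (CommRingCat.ofHom v) ≫ ι = y.1 →
      y ∈ W := by
  induction hW with
  | basic W hW =>
    obtain ⟨A', ι', a, V, hι', hV, rfl⟩ := hW
    exact eventually_mem_basicSet ι ι' φ x hx hV hxW
  | univ => exact Eventually.of_forall fun _ _ _ => trivial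
  | inter W₁ W₂ _ _ h₁ h₂ =>
    filter_upwards [h₁ hxW.1, h₂ hxW.2] with v hv₁ hv₂ y hy using ⟨hv₁ y hy, hv₂ y hy⟩
  | sUnion S _ h =>
    obtain ⟨W, hWS, hxW⟩ := hxW
    filter_upwards [h W hWS hxW] with v hv y hy using ⟨W, hWS, hv y hy⟩

end Topology

end SparseDense

namespace SparseDense

/-! ### From affine schemes and residue fields to the algebraic statement. -/

section PartOne

open Polynomial Filter Topology

/-- A version of `exists_two_specializations` for a homomorphism of finitely generated algebras and
the homomorphism induced on the residue fields at two given primes. -/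
lemma exists_two_extensions {F K A₀ A₀' E Ω : Type*} [Field F] [CharZero F]
    [NormedField K] [IsAlgClosed K] [Algebra F K] (hdense : Dense {z : K | IsIntegral F z}) {ϖ : F}
    (h0 : ϖ ≠ 0) (h1 : ‖algebraMap F K ϖ‖ < 1) [CommRing A₀] [Algebra F A₀]
    [Algebra.FiniteType F A₀] [CommRing A₀'] [Algebra F A₀'] [Algebra.FiniteType F A₀'] [Field E]
    [Field Ω] (h : A₀ →ₐ[F] A₀') (e : A₀ →+* E) (e' : A₀' →+* Ω) (f : E →+* Ω)
    (hfe : ∀ a, f (e a) = e' (h a)) (he : ∀ z, ∃ a b, z = e a / e b)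
    (he' : ∀ z, ∃ a b, z = e' a / e' b) (hf : f.IsIntegral) (hfs : ¬ Function.Surjective f)
    (hint : ¬ ∀ a, ∃ g : F[X], g.Monic ∧ e (aeval a g) = 0) (φ : A₀ →ₐ[F] K)
    (hφ : ∀ a, e a = 0 → φ a = 0) {t : Set (A₀ →+* K)} (ht : t ∈ nhdsHom (φ : A₀ →+* K)) :
    ∃ y : A₀ →ₐ[F] K, (y : A₀ →+* K) ∈ t ∧ (∀ a, IsIntegral F (y a)) ∧
      ∃ ψ₁ ψ₂ : A₀' →ₐ[F] K, (∀ a, ψ₁ (h a) = y a) ∧ (∀ a, ψ₂ (h a) = y a) ∧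
        ∃ c, ψ₁ c = 0 ∧ ψ₂ c ≠ 0 := by
  have := RingHom.ker_isPrime e
  let A := A₀ ⧸ RingHom.ker e
  let mk : A₀ →ₐ[F] A := Ideal.Quotient.mkₐ F (RingHom.ker e)
  have hmk : Function.Surjective mk := Ideal.Quotient.mk_surjective
  let eA : A →+* E := RingHom.kerLift e
  have heA : ∀ a, eA (mk a) = e a := fun a => RingHom.kerLift_mk e a
  let _ : Algebra A E := eA.toAlgebra
  let _ : Algebra E Ω := f.toAlgebra
  let _ : Algebra A Ω := (f.comp eA).toAlgebra
  have : IsScalarTower A E Ω := IsScalarTower.of_algebraMap_eq fun _ => rfl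
  let _ : Algebra F Ω := ((f.comp eA).comp (algebraMap F A)).toAlgebra
  have : IsScalarTower F A Ω := IsScalarTower.of_algebraMap_eq fun _ => rfl
  have : FaithfulSMul A E :=
    (faithfulSMul_iff_algebraMap_injective A E).2 (RingHom.kerLift_injective e)
  have : IsFractionRing A E := IsFractionRing.of_field A E fun z => by
    obtain ⟨a, b, rfl⟩ := he z
    exact ⟨mk a, mk b, rfl⟩
  have : Algebra.IsAlgebraic A E := IsLocalization.isAlgebraic E (nonZeroDivisors A)
  have : Algebra.IsIntegral E Ω := ⟨hf⟩
  have : Algebra.IsAlgebraic A Ω := Algebra.IsAlgebraic.trans A E Ω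
  let e'' : A₀' →ₐ[F] Ω :=
    { e' with
      commutes' := fun r => by
        change e' (algebraMap F A₀' r) = f (eA (mk (algebraMap F A₀ r)))
        rw [heA, hfe, h.commutes] }
  have hFG : e''.range.FG := by
    rw [← Algebra.map_top]
    exact Subalgebra.FG.map _ Algebra.FiniteType.out
  have hAA' : ∀ a : A, algebraMap A Ω a ∈ e''.range := fun a => by
    obtain ⟨a, rfl⟩ := hmk a
    exact ⟨h a, by change e' (h a) = f (eA (mk a)); rw [heA, hfe]⟩
  -- The image of `A₀'` generates `Ω` as a field, so if it lay in `E` the extension would be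
  -- trivial.
  obtain ⟨θ₀, hθ₀, hθ₀E⟩ : ∃ θ₀ ∈ e''.range, θ₀ ∉ Set.range (algebraMap E Ω) := by
    by_contra! hall
    refine hfs fun z => ?_
    obtain ⟨a, b, rfl⟩ := he' z
    obtain ⟨a', ha'⟩ := hall (e' a) ⟨a, rfl⟩
    obtain ⟨b', hb'⟩ := hall (e' b) ⟨b, rfl⟩
    exact ⟨a' / b', by rw [map_div₀, ← ha', ← hb']; rfl⟩
  have hA : ¬ Algebra.IsIntegral F A := fun hA => hint fun a => by
    obtain ⟨g, hg, hga⟩ := hA.isIntegral (mk a)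
    refine ⟨g, hg, ?_⟩
    rw [← heA, ← aeval_algHom_apply, aeval_def, hga, map_zero]
  let x : A →ₐ[F] K := Ideal.Quotient.liftₐ (RingHom.ker e) φ fun a ha => hφ a ha
  have hx : ∀ a, x (mk a) = φ a := fun a => rfl
  have hts : Tendsto (fun v : A →+* K => v.comp (mk : A₀ →+* A)) (nhdsHom (x : A →+* K))
      (nhdsHom (φ : A₀ →+* K)) :=
    tendsto_nhdsHom_iff.2 fun a => tendsto_apply_nhdsHom (x : A →+* K) (mk a)
  obtain ⟨y, hy, hyint, ψ₁, ψ₂, h₁, h₂, ⟨_, c, rfl⟩, hc₁, hc₂⟩ :=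
    exists_two_specializations hdense h0 h1 (A := A) (E := E) (Ω := Ω) hA e''.range hFG hAA' hθ₀
      hθ₀E x (hts ht)
  have hrange : ∀ a, e''.rangeRestrict (h a) = ⟨algebraMap A Ω (mk a), hAA' (mk a)⟩ := fun a =>
    Subtype.ext (by change e' (h a) = f (eA (mk a)); rw [heA, hfe])
  refine ⟨y.comp mk, hy, fun a => hyint _, ψ₁.comp e''.rangeRestrict, ψ₂.comp e''.rangeRestrict,
    fun a => ?_, fun a => ?_, c, hc₁, hc₂⟩
  · rw [AlgHom.comp_apply, hrange, h₁]; rfl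
  · rw [AlgHom.comp_apply, hrange, h₂]; rfl

/-- The roots of polynomials over a subfield lie in any algebraically closed intermediate field. -/
lemma mem_range_of_isIntegral {F L K : Type*} [Field F] [Field L] [IsAlgClosed L] [Field K]
    (i : F →+* L) (j : L →+* K) {z : K} (hz : (j.comp i).IsIntegralElem z) : z ∈ j.range := by
  obtain ⟨g, hg, hgz⟩ := hz
  rw [← eval₂_map, ← Polynomial.eval_map] at hgz
  have hz : z ∈ ((g.map i).map j).roots :=
    (mem_roots ((hg.map i).map j).ne_zero).2 hgz
  rw [Splits.roots_map (IsAlgClosed.splits (g.map i))] at hz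
  obtain ⟨w, -, hw⟩ := Multiset.mem_map.1 hz
  exact ⟨w, hw⟩

lemma exists_comp_eq {A L K : Type*} [CommRing A] [Field L] [Field K] (j : L →+* K) (y : A →+* K)
    (h : ∀ a, y a ∈ j.range) : ∃ w : A →+* L, j.comp w = y := by
  let e : L ≃+* j.range := RingEquiv.ofBijective j.rangeRestrict
    ⟨j.rangeRestrict.injective, j.rangeRestrict_surjective⟩
  refine ⟨(e.symm : j.range →+* L).comp (y.codRestrict j.range h), RingHom.ext fun a => ?_⟩
  exact congrArg Subtype.val (e.apply_symm_apply (y.codRestrict j.range h a))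

/-- The evaluation of functions on an affine scheme at a point. -/
noncomputable def specEval (A : CommRingCat.{u}) (x : Spec A) : A ⟶ (Spec A).residueField x :=
  (Scheme.ΓSpecIso A).inv ≫ (Spec A).Γevaluation x

lemma specEval_eq (A : CommRingCat.{u}) (x : PrimeSpectrum A) : specEval A x =
    CommRingCat.ofHom (algebraMap A x.asIdeal.ResidueField) ≫
      (Scheme.Spec.residueFieldIso A x).inv :=
  (Scheme.Spec.algebraMap_residueFieldIso_inv A x).symm

lemma comp_iso_hom_eq_zero_iff {R S T : CommRingCat.{u}} {f : R ⟶ S} {g : S ≅ T} {k : R ⟶ T}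
    (hk : k = f ≫ g.hom) (a : R) : k.hom a = 0 ↔ f.hom a = 0 := by
  rw [hk, CommRingCat.hom_comp, RingHom.comp_apply]
  exact map_eq_zero_iff _ (ConcreteCategory.bijective_of_isIso g.hom).1

lemma comp_iso_hom_exists_mul_eq {R S T : CommRingCat.{u}} {f : R ⟶ S} {g : S ≅ T} {k : R ⟶ T}
    (hk : k = f ≫ g.hom) (hf : ∀ z, ∃ a b, f.hom b ≠ 0 ∧ z * f.hom b = f.hom a) (z : T) :
    ∃ a b, k.hom b ≠ 0 ∧ z * k.hom b = k.hom a := by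
  obtain ⟨z, rfl⟩ := (ConcreteCategory.bijective_of_isIso g.hom).2 z
  obtain ⟨a, b, hb, hab⟩ := hf z
  refine ⟨a, b, (comp_iso_hom_eq_zero_iff hk b).not.2 hb, ?_⟩
  rw [hk]
  exact (map_mul g.hom.hom _ _).symm.trans (congrArg g.hom.hom hab)

lemma specEval_eq_zero_iff {A : CommRingCat.{u}} (x : Spec A) (a : A) :
    (specEval A x).hom a = 0 ↔ a ∈ (x : PrimeSpectrum A).asIdeal :=
  (comp_iso_hom_eq_zero_iff (g := (Scheme.Spec.residueFieldIso A x).symm)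
    (specEval_eq A x) a).trans
    (have := PrimeSpectrum.isPrime x; Ideal.algebraMap_residueField_eq_zero)

lemma exists_mul_specEval_eq {A : CommRingCat.{u}} (x : Spec A) (z : (Spec A).residueField x) :
    ∃ a b, (specEval A x).hom b ≠ 0 ∧ z * (specEval A x).hom b = (specEval A x).hom a := by
  refine comp_iso_hom_exists_mul_eq (g := (Scheme.Spec.residueFieldIso A x).symm)
    (specEval_eq A x) (fun z => ?_) z
  have := (x : PrimeSpectrum A).2
  obtain ⟨a, b, hb, hab⟩ := IsFractionRing.div_surjective
    (A := A ⧸ (x : PrimeSpectrum A).asIdeal) (K := (x : PrimeSpectrum A).asIdeal.ResidueField) z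
  obtain ⟨a, rfl⟩ := Ideal.Quotient.mk_surjective a
  obtain ⟨b, rfl⟩ := Ideal.Quotient.mk_surjective b
  have hb0 := (map_ne_zero_of_mem_nonZeroDivisors (algebraMap _
    (x : PrimeSpectrum A).asIdeal.ResidueField)
    (IsFractionRing.injective (A ⧸ (x : PrimeSpectrum A).asIdeal) _) hb)
  exact ⟨a, b, hb0, (div_eq_iff hb0).1 hab |>.symm⟩

lemma residueFieldMap_specEval {A A' : CommRingCat.{u}} (h : A ⟶ A') (x : Spec A') (a : A) :
    ((Spec.map h).residueFieldMap x).hom ((specEval A (Spec.map h x)).hom a) =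
      (specEval A' x).hom (h.hom a) := by
  have : specEval A (Spec.map h x) ≫ (Spec.map h).residueFieldMap x = h ≫ specEval A' x := by
    rw [specEval, specEval, Category.assoc, Scheme.Γevaluation_naturality,
      Scheme.ΓSpecIso_inv_naturality_assoc]
  exact congrArg (fun f => f.hom a) this

lemma Scheme.Hom.finite_residueFieldMap {X Y : Scheme.{u}} (f : X ⟶ Y) (x : X)
    (h : 1 < f.residueDegree x) :
    (f.residueFieldMap x).hom.IsIntegral ∧ ¬ Function.Surjective (f.residueFieldMap x).hom := by
  let _ := (f.residueFieldMap x).hom.toAlgebra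
  have hfr : 1 < Module.finrank (Y.residueField (f x)) (X.residueField x) := h
  -- An infinite extension has `finrank` zero by convention, so degree above one also encodes
  -- finiteness.
  have : FiniteDimensional (Y.residueField (f x)) (X.residueField x) :=
    Module.finite_of_finrank_pos (by omega)
  refine ⟨Algebra.IsIntegral.isIntegral (R := Y.residueField (f x)), fun hs => ?_⟩
  have hbot : (⊥ : Subalgebra (Y.residueField (f x)) (X.residueField x)) = ⊤ :=
    Algebra.surjective_algebraMap_iff.1 hs |>.symm
  rw [Subalgebra.bot_eq_top_iff_finrank_eq_one] at hbot
  omega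

lemma integral_not_surjective_transfer {A B C A' B' : CommRingCat.{u}} (f : A ⟶ B) (g : A' ⟶ B')
    (e₁ : A ⟶ C) (e₂ : C ⟶ A')
    (e' : B ⟶ B') [IsIso e₁] [IsIso e₂] [IsIso e'] (h : f ≫ e' = e₁ ≫ e₂ ≫ g)
    (hf : f.hom.IsIntegral ∧ ¬ Function.Surjective f.hom) :
    g.hom.IsIntegral ∧ ¬ Function.Surjective g.hom := by
  let e := e₁ ≫ e₂
  replace h : f ≫ e' = e ≫ g := h.trans (Category.assoc _ _ _).symm
  have hg : g = inv e ≫ f ≫ e' := by rw [h, IsIso.inv_hom_id_assoc]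
  have hf' : f = e ≫ g ≫ inv e' := by rw [← Category.assoc, ← h, Category.assoc, IsIso.hom_inv_id,
    Category.comp_id]
  have hs : ∀ {A B : CommRingCat.{u}} (k : A ⟶ B) [IsIso k], Function.Surjective k.hom := fun k _ =>
    (ConcreteCategory.bijective_of_isIso k).2
  constructor
  · rw [hg]
    exact RingHom.IsIntegral.trans _ _ (RingHom.isIntegral_of_surjective _ (hs _))
      (RingHom.IsIntegral.trans _ _ hf.1 (RingHom.isIntegral_of_surjective _ (hs _)))
  · intro hgs
    refine hf.2 ?_
    rw [hf']
    exact ((hs (inv e')).comp hgs).comp (hs e)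

/-- Passing to affine open subschemes does not change the residue field extensions. -/
lemma residueFieldMap_of_comp_eq {X Y : Scheme.{u}} (π : X ⟶ Y) {A A' : CommRingCat.{u}}
    (ι : Spec A ⟶ Y) (ι' : Spec A' ⟶ X) [IsOpenImmersion ι] [IsOpenImmersion ι'] (h : A ⟶ A')
    (hcomp : Spec.map h ≫ ι = ι' ≫ π) (x : Spec A') (hdeg : 1 < π.residueDegree (ι' x)) :
    ((Spec.map h).residueFieldMap x).hom.IsIntegral ∧
      ¬ Function.Surjective ((Spec.map h).residueFieldMap x).hom := by
  have h1 := Scheme.Hom.residueFieldMap_congr hcomp.symm x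
  rw [Scheme.residueFieldMap_comp, Scheme.residueFieldMap_comp] at h1
  have hpt : π (ι' x) = ι (Spec.map h x) := congrArg (fun f => f x) hcomp.symm
  exact integral_not_surjective_transfer (π.residueFieldMap (ι' x)) _
    (Y.residueFieldCongr hpt).hom (ι.residueFieldMap (Spec.map h x)) (ι'.residueFieldMap x) h1 (Scheme.Hom.finite_residueFieldMap π _ hdeg)

end PartOne

end SparseDense

namespace SparseDense

/-! ### Sparseness and density in part (i). -/

section PartOne

open Polynomial Filter Topology

lemma exists_spec_map_comp_eq {X : Scheme.{u}} {A C : CommRingCat.{u}} (ι : Spec A ⟶ X)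
    [IsOpenImmersion ι] (g : Spec C ⟶ X) (hg : Set.range g ⊆ Set.range ι) :
    ∃ φ : A ⟶ C, Spec.map φ ≫ ι = g :=
  ⟨Spec.preimage (IsOpenImmersion.lift ι g hg), by
    rw [Spec.map_preimage, IsOpenImmersion.lift_fac]⟩

lemma jacobsonSpace_of_locallyOfFiniteType {F : Type u} [Field F] {X : Scheme.{u}}
    (s : X ⟶ Spec (.of F)) [LocallyOfFiniteType s] : JacobsonSpace X :=
  LocallyOfFiniteType.jacobsonSpace s

/-- A domain integral over a field is a field. This serves twice: to rule out integrality at a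
generic point that is not closed, and to see that algebraic points are closed. -/
lemma isMaximal_of_forall_monic {F A : Type*} [Field F] [CommRing A] [Algebra F A] (P : Ideal A)
    [P.IsPrime] (h : ∀ a, ∃ g : F[X], g.Monic ∧ aeval a g ∈ P) : P.IsMaximal := by
  have : Algebra.IsIntegral F (A ⧸ P) := ⟨fun a => by
    obtain ⟨a, rfl⟩ := Ideal.Quotient.mk_surjective a
    obtain ⟨g, hg, hga⟩ := h a
    refine ⟨g, hg, ?_⟩
    rw [← aeval_def]
    refine (aeval_algHom_apply (Ideal.Quotient.mkₐ F P) a g).trans ?_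
    exact Ideal.Quotient.eq_zero_iff_mem.2 hga⟩
  exact Ideal.Quotient.maximal_of_isField _ (isField_of_isIntegral_of_isField' (Field.toIsField F))

lemma mem_closedPoints_of_isMaximal {X : Scheme.{u}} [JacobsonSpace X] {A : CommRingCat.{u}}
    (ι : Spec A ⟶ X) [IsOpenImmersion ι] (x : Spec A)
    (hx : (x : PrimeSpectrum A).asIdeal.IsMaximal) : ι x ∈ closedPoints X := by
  have h : x ∈ ι ⁻¹' closedPoints X := by
    rw [ι.isOpenEmbedding.preimage_closedPoints]
    exact (PrimeSpectrum.isClosed_singleton_iff_isMaximal x).2 hx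
  exact h

lemma topologicalKrullDim_le_zero_of_isClosed_genericPoint {X : Type*} [TopologicalSpace X]
    [IrreducibleSpace X] [QuasiSober X] [T0Space X] (h : IsClosed {genericPoint X}) :
    topologicalKrullDim X ≤ 0 := by
  have h1 : (Set.univ : Set X) = {genericPoint X} := by
    rw [← genericPoint_closure (α := X), h.closure_eq]
  have : Subsingleton X := Set.subsingleton_univ_iff.1 (h1 ▸ Set.subsingleton_singleton)
  exact topologicalKrullDim_zero_of_discreteTopology X

lemma map_genericPoint_of_isDominant {X Y : Scheme.{u}} [IrreducibleSpace X] [IrreducibleSpace Y]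
    (f : X ⟶ Y) [IsDominant f] : f (genericPoint X) = genericPoint Y := by
  refine ((genericPoint_spec X).image f.continuous).eq ?_
  rw [Set.image_univ, f.denseRange.closure_range]
  exact genericPoint_spec Y

/-- A nonempty fiber over a closed point with a single closed point is a single point. -/
lemma isSparse_nonSingletonFibers {F : Type u} [Field F] {B' B : Scheme.{u}} [IrreducibleSpace B']
    {s' : B' ⟶ Spec (.of F)} {s : B ⟶ Spec (.of F)} (π : B' ⟶ B) (hs' : IsVariety s')
    (hπ : π ≫ s = s') (hdom : IsDominant π) (hfin : IsGenericallyFinite π) :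
    IsSparse s (nonSingletonFibers π) := by
  have := hs'.locallyOfFiniteType
  have : JacobsonSpace B' := jacobsonSpace_of_locallyOfFiniteType s'
  refine ⟨B', s', π, hs', inferInstance, hπ, hdom, hfin, fun b hb => ?_⟩
  have hclosed : IsClosed (π ⁻¹' {(b : B)}) := IsClosed.preimage π.continuous b.2
  rw [or_iff_not_imp_left, ← ne_eq, ← Set.nonempty_iff_ne_empty]
  intro hne
  by_contra hnt
  rw [Set.not_nontrivial_iff] at hnt
  obtain ⟨b', hb'⟩ := nonempty_inter_closedPoints hne hclosed.isLocallyClosed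
  have h1 := hnt.eq_singleton_of_mem hb'
  refine hb ⟨b', hb'.2, ?_⟩
  -- In a Jacobson space a closed set is the closure of its closed points, so the fiber equals its
  -- unique closed point.
  rw [← closure_inter_closedPoints hclosed, h1]
  exact IsClosed.closure_eq hb'.2

/-- The points of an affine chart induced by a homomorphism compatible with the structure maps. -/
lemma spec_map_comp_comp_eq_iff {F K : Type u} [Field F] [Field K] {X : Scheme.{u}}
    (s : X ⟶ Spec (.of F)) {A : CommRingCat.{u}} (ι : Spec A ⟶ X) {τ : .of F ⟶ A}
    (hτ : Spec.map τ = ι ≫ s) (φ : A ⟶ .of K) (i : F →+* K) :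
    (Spec.map φ ≫ ι) ≫ s = Spec.map (CommRingCat.ofHom i) ↔ ∀ r, φ.hom (τ.hom r) = i r := by
  rw [Category.assoc, ← hτ, ← Spec.map_comp, Spec.map_inj]
  constructor
  · intro h r
    exact congrArg (fun f => f.hom r) h
  · intro h
    ext r
    exact h r

lemma finiteType_of_spec_map_eq {F : Type u} [Field F] {X : Scheme.{u}}
    (s : X ⟶ Spec (.of F)) [LocallyOfFiniteType s] {A : CommRingCat.{u}} (ι : Spec A ⟶ X)
    [IsOpenImmersion ι] {τ : .of F ⟶ A} (hτ : Spec.map τ = ι ≫ s) : τ.hom.FiniteType := by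
  rw [← HasRingHomProperty.Spec_iff (P := @LocallyOfFiniteType), hτ]
  infer_instance

/-- The points with at least two preimages under a generically finite morphism of degree greater
than one are dense. -/
theorem dense_map_associatedPoints {F L K : Type u} [Field F] [CharZero F] [Field L]
    [IsAlgClosed L] [NormedField K] [IsAlgClosed K] (i : F →+* L) (j : L →+* K)
    (hdense : Dense {z : K | (j.comp i).IsIntegralElem z}) {ϖ : F} (h0 : ϖ ≠ 0)
    (h1 : ‖j (i ϖ)‖ < 1) {B' B : Scheme.{u}} [IrreducibleSpace B'] [IrreducibleSpace B]
    {s' : B' ⟶ Spec (.of F)} {s : B ⟶ Spec (.of F)} (π : B' ⟶ B) (hs' : IsVariety s')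
    (hs : IsVariety s) (hπ : π ≫ s = s') [IsDominant π] (hdim : 0 < topologicalKrullDim B)
    (hdeg : 1 < genericDegree π) :
    Dense (Points.map j '' associatedPoints i s (nonSingletonFibers π)) := by
  have := hs.locallyOfFiniteType
  have := hs'.locallyOfFiniteType
  have hJ : JacobsonSpace B := jacobsonSpace_of_locallyOfFiniteType s
  have hJ' : JacobsonSpace B' := jacobsonSpace_of_locallyOfFiniteType s'
  let _ : Algebra F K := (j.comp i).toAlgebra
  rw [dense_iff_inter_open]
  rintro W hW ⟨x, hxW⟩
  -- affine charts
  obtain ⟨A, ι, hι, hxι, -⟩ := Scheme.exists_affine_mem_range_and_range_subset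
    (x := x.point) (U := ⊤) trivial
  have hη : genericPoint B ∈ ι.opensRange :=
    (genericPoint_specializes x.point).mem_open ι.opensRange.2 hxι
  have hη' : genericPoint B' ∈ π ⁻¹ᵁ ι.opensRange := by
    change π (genericPoint B') ∈ ι.opensRange
    rwa [map_genericPoint_of_isDominant]
  obtain ⟨A', ι', hι', ⟨q, hq⟩, hι'r⟩ := Scheme.exists_affine_mem_range_and_range_subset hη'
  obtain ⟨h, hcomp⟩ := exists_spec_map_comp_eq ι (ι' ≫ π) (by
    rintro _ ⟨z, rfl⟩
    exact hι'r ⟨z, rfl⟩)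
  obtain ⟨φ, hφ⟩ := exists_spec_map_comp_eq ι x.1 (by
    rintro _ ⟨z, rfl⟩
    rw [Subsingleton.elim z (IsLocalRing.closedPoint K)]
    exact hxι)
  -- algebra structures
  obtain ⟨τ, hτ⟩ : ∃ τ : .of F ⟶ A, Spec.map τ = ι ≫ s := ⟨_, Spec.map_preimage _⟩
  have hτ' : Spec.map (τ ≫ h) = ι' ≫ s' := by
    rw [Spec.map_comp, hτ, ← Category.assoc, hcomp, Category.assoc, hπ]
  have hτf := finiteType_of_spec_map_eq s ι hτ
  have hτf' := finiteType_of_spec_map_eq s' ι' hτ'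
  let _ : Algebra F A := τ.hom.toAlgebra
  let _ : Algebra F A' := (τ ≫ h).hom.toAlgebra
  have : Algebra.FiniteType F A := hτf
  have : Algebra.FiniteType F A' := hτf'
  let hA : A →ₐ[F] A' := { h.hom with commutes' := fun r => rfl }
  have hφτ := (spec_map_comp_comp_eq_iff s ι hτ φ (j.comp i)).1 (by rw [hφ]; exact x.2)
  let φA : A →ₐ[F] K := { φ.hom with commutes' := hφτ }
  -- residue fields
  have hιq : ι (Spec.map h q) = genericPoint B := by
    rw [← map_genericPoint_of_isDominant π, ← hq]
    exact congrArg (fun f => f q) hcomp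
  obtain ⟨hfint, hfs⟩ := residueFieldMap_of_comp_eq π ι ι' h hcomp q (by rw [hq]; exact hdeg)
  -- Otherwise the generic point of `B` would be closed and `B` of dimension zero.
  have hnint : ¬ ∀ a : A, ∃ g : F[X], g.Monic ∧ (specEval A (Spec.map h q)).hom (aeval a g) = 0 := by
    intro hall
    have := PrimeSpectrum.isPrime (Spec.map h q)
    have hmax := isMaximal_of_forall_monic (F := F)
      (Spec.map h q : PrimeSpectrum A).asIdeal fun a => by
        obtain ⟨g, hg, hga⟩ := hall a
        exact ⟨g, hg, (specEval_eq_zero_iff _ _).1 hga⟩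
    have := mem_closedPoints_of_isMaximal ι (Spec.map h q) hmax
    rw [hιq] at this
    exact absurd hdim (topologicalKrullDim_le_zero_of_isClosed_genericPoint this).not_gt
  -- Every point specialises from the generic one, so `φ` factors through the image of `A` in the
  -- function field; this is what disposes of nilpotents.
  have hφq : ∀ a : A, (specEval A (Spec.map h q)).hom a = 0 → φA a = 0 := by
    intro a ha
    have hspec : (Spec.map h q) ⤳ Spec.map φ (IsLocalRing.closedPoint K) := by
      rw [← ι.isOpenEmbedding.isInducing.specializes_iff, hιq]
      exact genericPoint_specializes _
    exact (mem_asIdeal_closedPoint_iff φ a).1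
      ((PrimeSpectrum.le_iff_specializes _ _).2 hspec ((specEval_eq_zero_iff _ _).1 ha))
  obtain ⟨y, hyW, hyint, ψ₁, ψ₂, hψ₁, hψ₂, c, hc₁, hc₂⟩ := exists_two_extensions hdense h0 h1 hA
    (specEval A (Spec.map h q)).hom (specEval A' q).hom ((Spec.map h).residueFieldMap q).hom
    (residueFieldMap_specEval h q)
    (fun z => by
      obtain ⟨a, b, hb, hab⟩ := exists_mul_specEval_eq _ z
      exact ⟨a, b, (eq_div_iff hb).2 hab⟩)
    (fun z => by
      obtain ⟨a, b, hb, hab⟩ := exists_mul_specEval_eq _ z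
      exact ⟨a, b, (eq_div_iff hb).2 hab⟩) hfint hfs hnint φA hφq
    (eventually_mem_of_isOpen ι φ x hφ hW hxW)
  -- the algebraic point
  obtain ⟨w, hw⟩ := exists_comp_eq j (y : A →+* K) fun a => mem_range_of_isIntegral i j (hyint a)
  have hwy : ∀ a, j (w a) = y a := fun a => congrArg (fun f => f a) hw
  have hyw : CommRingCat.ofHom (y : A →+* K) = CommRingCat.ofHom w ≫ CommRingCat.ofHom j := by
    rw [← hw]
    rfl
  let z : Points i s := ⟨Spec.map (CommRingCat.ofHom w) ≫ ι,
    (spec_map_comp_comp_eq_iff s ι hτ (CommRingCat.ofHom w) i).2 fun r =>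
      j.injective ((hwy _).trans (y.commutes r))⟩
  have hz : Spec.map (CommRingCat.ofHom (y : A →+* K)) ≫ ι = (Points.map j z).1 := by
    rw [hyw, Spec.map_comp, Category.assoc]
    rfl
  let pt : Spec A := Spec.map (CommRingCat.ofHom w) (IsLocalRing.closedPoint L)
  have hzpt : z.point = ι pt := Points.point_eq ι _ z rfl
  have hpt : ι pt ∈ closedPoints B := by
    have := PrimeSpectrum.isPrime pt
    refine mem_closedPoints_of_isMaximal ι pt (isMaximal_of_forall_monic (F := F) _ fun a => ?_)
    obtain ⟨g, hg, hga⟩ := hyint a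
    refine ⟨g, hg, (mem_asIdeal_closedPoint_iff (CommRingCat.ofHom w) _).2 (j.injective ?_)⟩
    rw [map_zero]
    exact (hwy _).trans ((aeval_algHom_apply y a g).symm.trans hga)
  have hptK : Spec.map (CommRingCat.ofHom (y : A →+* K)) (IsLocalRing.closedPoint K) = pt := by
    rw [hyw, Spec.map_comp]
    exact congrArg (Spec.map (CommRingCat.ofHom w)) (Subsingleton.elim _ _)
  have hfiber : ∀ ψ : A' →ₐ[F] K, (∀ a, ψ (hA a) = y a) →
      ι' (Spec.map (CommRingCat.ofHom (ψ : A' →+* K)) (IsLocalRing.closedPoint K)) ∈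
        π ⁻¹' {ι pt} := by
    intro ψ hψ
    have h1 : Spec.map (CommRingCat.ofHom (ψ : A' →+* K)) ≫ ι' ≫ π =
        Spec.map (CommRingCat.ofHom (y : A →+* K)) ≫ ι := by
      rw [← hcomp, ← Category.assoc, ← Spec.map_comp]
      congr 2
      ext a
      exact hψ a
    have h2 := congrArg (fun f : Spec (.of K) ⟶ B => f (IsLocalRing.closedPoint K)) h1
    exact h2.trans (congrArg ι hptK)
  -- Were the fiber one point, `ψ₁` and `ψ₂` would have the same kernel, but `c` lies in only one of
  -- the two kernels.
  refine ⟨Points.map j z, hyW _ hz, z, ⟨⟨ι pt, hpt⟩, ?_, hzpt.symm⟩, rfl⟩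
  rintro ⟨b', -, hb'⟩
  have h₁ := hfiber ψ₁ hψ₁
  have h₂ := hfiber ψ₂ hψ₂
  rw [hb'] at h₁ h₂
  have h₁₂ := ι'.isOpenEmbedding.injective (h₁.trans h₂.symm)
  have hc₁' := (mem_asIdeal_closedPoint_iff (CommRingCat.ofHom (ψ₁ : A' →+* K)) c).2 hc₁
  rw [h₁₂] at hc₁'
  exact hc₂ ((mem_asIdeal_closedPoint_iff (CommRingCat.ofHom (ψ₂ : A' →+* K)) c).1 hc₁')

end PartOne

end SparseDense

namespace SparseDense

/-! ### Rational points of the affine line are nowhere dense. -/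

section AffineLine

open Polynomial Filter Topology

lemma exists_isIso_affineLine (F : Type) [Field F] :
    ∃ ι : Spec (.of F[X]) ⟶ 𝔸(Fin 1; Spec (.of F)), IsIso ι ∧
      ι ≫ (𝔸(Fin 1; Spec (.of F)) ↘ Spec (.of F)) = Spec.map (CommRingCat.ofHom C) := by
  let e := (MvPolynomial.uniqueAlgEquiv F (Fin 1)).toRingEquiv.toCommRingCatIso
  refine ⟨Spec.map e.hom ≫ (AffineSpace.SpecIso (Fin 1) (.of F)).inv, inferInstance, ?_⟩
  rw [Category.assoc, AffineSpace.SpecIso_inv_over, ← Spec.map_comp]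
  congr 1
  refine CommRingCat.hom_ext (RingHom.ext fun r => ?_)
  exact (MvPolynomial.uniqueAlgEquiv F (Fin 1)).commutes r

lemma isClosed_range_algebraMap_padicComplex (p : ℕ) [Fact p.Prime] :
    IsClosed (Set.range (algebraMap ℚ_[p] ℂ_[p])) :=
  (algebraMap_isometry ℚ_[p] ℂ_[p]).isClosedEmbedding.isClosed_range

lemma Padic.mul_self_ne_prime (p : ℕ) [Fact p.Prime] (a : ℚ_[p]) : a * a ≠ p := by
  intro h
  have hp : p.Prime := Fact.out
  have ha : a ≠ 0 := by
    rintro rfl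
    rw [mul_zero] at h
    exact hp.ne_zero (by exact_mod_cast h.symm)
  have h1 := congrArg Padic.valuation h
  rw [Padic.valuation_mul ha ha, Padic.valuation_p] at h1
  omega

/-- A linear subspace with nonempty interior is the whole space, but a square root of `p` is not in
`ℚ_[p]`, where valuations are integers. -/
lemma dense_compl_range_algebraMap_padicComplex (p : ℕ) [Fact p.Prime] :
    Dense (Set.range (algebraMap ℚ_[p] ℂ_[p]))ᶜ := by
  rw [← interior_eq_empty_iff_dense_compl]
  by_contra h
  have htop := Submodule.eq_top_of_nonempty_interior'
    (LinearMap.range (Algebra.linearMap ℚ_[p] ℂ_[p])) (Set.nonempty_iff_ne_empty.2 h)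
  obtain ⟨z, hz⟩ := IsAlgClosed.exists_pow_nat_eq (p : ℂ_[p]) two_pos
  obtain ⟨a, ha⟩ := LinearMap.range_eq_top.1 htop z
  refine Padic.mul_self_ne_prime p a ((algebraMap ℚ_[p] ℂ_[p]).injective ?_)
  rw [map_mul, map_natCast, ← hz, sq, ← ha]
  rfl

lemma exists_spec_map_comp_eq_of_isIso {Y : Scheme.{u}} {A B : CommRingCat.{u}} (ι : Spec A ⟶ Y)
    [IsIso ι] (g : Spec B ⟶ Y) : ∃ φ : A ⟶ B, Spec.map φ ≫ ι = g :=
  ⟨Spec.preimage (g ≫ inv ι), by simp⟩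

lemma exists_apply_X_eq {F K : Type} [Field F] [Field K] {Y : Scheme.{0}} {s : Y ⟶ Spec (.of F)}
    (ι : Spec (.of F[X]) ⟶ Y) [IsIso ι] (hι : ι ≫ s = Spec.map (CommRingCat.ofHom C))
    {i : F →+* K} (z : Points i s) {b : closedPoints Y} (hb : b ∈ rationalClosedPoints s)
    (hz : (b : Y) = z.point) (φ : CommRingCat.of F[X] ⟶ .of K) (hφ : Spec.map φ ≫ ι = z.1) :
    ∃ r : F, φ.hom X = i r := by
  obtain ⟨x, hx⟩ := hb
  obtain ⟨ψ, hψ⟩ := exists_spec_map_comp_eq_of_isIso ι x.1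
  have hψC := (spec_map_comp_comp_eq_iff s ι hι.symm ψ _).1 (by rw [hψ]; exact x.2)
  have hφC := (spec_map_comp_comp_eq_iff s ι hι.symm φ _).1 (by rw [hφ]; exact z.2)
  refine ⟨ψ.hom X, ?_⟩
  have h1 : ι (Spec.map ψ (IsLocalRing.closedPoint F)) =
      ι (Spec.map φ (IsLocalRing.closedPoint K)) := by
    rw [← Points.point_eq ι _ x hψ, ← Points.point_eq ι _ z hφ, hx, hz]
  have h2 := ι.isOpenEmbedding.injective h1
  have h3 := (mem_asIdeal_closedPoint_iff ψ ((X - C (ψ.hom X) : F[X]))).2 (by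
    rw [map_sub, sub_eq_zero]
    exact (hψC _).symm)
  rw [h2] at h3
  have h4 := (mem_asIdeal_closedPoint_iff φ ((X - C (ψ.hom X) : F[X]))).1 h3
  rw [map_sub, sub_eq_zero] at h4
  exact h4.trans (hφC _)

/-- The rational points of the affine line are nowhere dense in its `p`-adic complex points. -/
theorem isNowhereDense_map_associatedPoints {Y : Scheme.{0}} {s : Y ⟶ Spec (.of ℚ)}
    (ι : Spec (.of ℚ[X]) ⟶ Y) [IsIso ι] (hι : ι ≫ s = Spec.map (CommRingCat.ofHom C)) (p : ℕ)
    [Fact p.Prime] {L : Type} [Field L] (i : ℚ →+* L) (j : L →+* ℂ_[p]) :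
    IsNowhereDense (Points.map j '' associatedPoints i s (rationalClosedPoints s)) := by
  let Q : Set ℂ_[p] := Set.range (algebraMap ℚ_[p] ℂ_[p])
  -- The closed set of points whose coordinate lies in `ℚ_[p]`; it contains all rational points.
  let Z : Set (Points (j.comp i) s) := (Points.basicSet (j.comp i) s ι X Qᶜ)ᶜ
  have hZ : IsClosed Z := by
    refine ⟨?_⟩
    rw [compl_compl]
    exact TopologicalSpace.GenerateOpen.basic _ ⟨_, ι, X, Qᶜ, inferInstance,
      (isClosed_range_algebraMap_padicComplex p).isOpen_compl, rfl⟩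
  have hsub : Points.map j '' associatedPoints i s (rationalClosedPoints s) ⊆ Z := by
    rintro _ ⟨z, ⟨b, hb, hbz⟩, rfl⟩ ⟨φ, hφ, hφX⟩
    obtain ⟨φL, hφL⟩ := exists_spec_map_comp_eq_of_isIso ι z.1
    obtain ⟨r, hr⟩ := exists_apply_X_eq ι hι z hb hbz φL hφL
    have h1 : φ = φL ≫ CommRingCat.ofHom j := by
      refine Spec.map_injective ((cancel_mono ι).1 (hφ.trans ?_))
      rw [Spec.map_comp, Category.assoc, hφL]
      rfl
    refine hφX ⟨(r : ℚ_[p]), ?_⟩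
    rw [h1]
    change _ = j (φL.hom X)
    rw [hr, map_ratCast]
    exact (map_ratCast (j.comp i) r).symm
  rw [IsNowhereDense, Set.eq_empty_iff_forall_notMem]
  intro x hx
  have hxZ := interior_mono (closure_minimal hsub hZ) hx
  obtain ⟨φ, hφ⟩ := exists_spec_map_comp_eq_of_isIso ι x.1
  have hev := eventually_mem_of_isOpen ι φ x hφ isOpen_interior hxZ
  -- The point with coordinate `c` depends continuously on `c`, so an interior point of `Z` could be
  -- moved to a coordinate outside `ℚ_[p]`.
  let v : ℂ_[p] → ℚ[X] →+* ℂ_[p] := fun c => eval₂RingHom (j.comp i) c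
  have hφC := (spec_map_comp_comp_eq_iff s ι hι.symm φ _).1 (by rw [hφ]; exact x.2)
  have hv : v (φ.hom X) = φ.hom := by
    refine Polynomial.ringHom_ext (fun r => ?_) ?_
    · exact (eval₂_C _ _).trans (hφC r).symm
    · exact eval₂_X _ _
  have htend : Tendsto v (𝓝 (φ.hom X)) (nhdsHom φ.hom) := by
    rw [tendsto_nhdsHom_iff]
    intro f
    rw [show φ.hom f = v (φ.hom X) f from (congrArg (fun w => w f) hv).symm]
    exact (Polynomial.continuous_eval₂ f (j.comp i)).tendsto (φ.hom X)
  have hmem := htend.eventually hev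
  obtain ⟨c, hcQ, hc⟩ := ((dense_compl_range_algebraMap_padicComplex p).inter_nhds_nonempty hmem)
  let y : Points (j.comp i) s := ⟨Spec.map (CommRingCat.ofHom (v c)) ≫ ι,
    (spec_map_comp_comp_eq_iff s ι hι.symm (CommRingCat.ofHom (v c)) (j.comp i)).2 fun r =>
      eval₂_C _ _⟩
  refine interior_subset (hc y rfl) ⟨CommRingCat.ofHom (v c), rfl, ?_⟩
  change eval₂ _ _ _ ∈ Qᶜ
  rw [eval₂_X]
  exact hcQ

end AffineLine

end SparseDense

namespace SparseDense

/-! ### Rational points of the affine line are not sparse. -/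

section NonSparse

open Polynomial Filter Topology

/-- A morphism that is finite over an open subset is affine locally given by a finite ring
homomorphism over that subset. -/
lemma exists_finite_of_isFinite_morphismRestrict {X Y : Scheme.{u}} (π : X ⟶ Y) (V : Y.Opens)
    (hV : IsFinite (π ∣_ V)) {R : CommRingCat.{u}} (κ : Spec R ⟶ Y) [IsOpenImmersion κ]
    (hκ : Set.range κ ⊆ V) :
    ∃ (A : CommRingCat.{u}) (κ' : Spec A ⟶ X) (ρ : R ⟶ A), IsOpenImmersion κ' ∧ ρ.hom.Finite ∧
      Spec.map ρ ≫ κ = κ' ≫ π ∧ Set.range κ' = π ⁻¹' Set.range κ := by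
  have hκ' : Set.range κ ⊆ Set.range V.ι := by rwa [Scheme.Opens.range_ι]
  let g := IsOpenImmersion.lift V.ι κ hκ'
  have hg : g ≫ V.ι = κ := IsOpenImmersion.lift_fac _ _ _
  have h := (IsPullback.of_hasPullback (π ∣_ V) g).paste_horiz
    (isPullback_morphismRestrict π V).flip
  rw [hg] at h
  have hfin : IsFinite (Limits.pullback.snd (π ∣_ V) g) :=
    MorphismProperty.of_isPullback (IsPullback.of_hasPullback (π ∣_ V) g) hV
  have hfin' : IsFinite (Limits.pullback.snd π κ) := by
    rw [← h.isoPullback_inv_snd]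
    infer_instance
  have : IsAffine (Limits.pullback π κ) := isAffine_of_isAffineHom (Limits.pullback.snd π κ)
  let e := (Limits.pullback π κ).isoSpec
  refine ⟨_, e.inv ≫ Limits.pullback.fst π κ, Spec.preimage (e.inv ≫ Limits.pullback.snd π κ),
    inferInstance, ?_, ?_, ?_⟩
  · rw [← IsFinite.SpecMap_iff, Spec.map_preimage]
    infer_instance
  · rw [Spec.map_preimage, Category.assoc, Category.assoc, Limits.pullback.condition]
  · have h1 : Function.Surjective e.inv := e.inv.homeomorph.surjective
    exact (h1.range_comp _).trans (IsOpenImmersion.range_pullbackFst κ π)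

lemma X_sub_C_mem_asIdeal_iff {F : Type u} [Field F] (t : F) (x : Spec (.of F[X])) :
    (X - C t : F[X]) ∈ (x : PrimeSpectrum F[X]).asIdeal ↔
      x = Spec.map (CommRingCat.ofHom (evalRingHom t)) (IsLocalRing.closedPoint F) := by
  have hmem : ∀ f : F[X], f ∈ (Spec.map (CommRingCat.ofHom (evalRingHom t))
      (IsLocalRing.closedPoint F) : PrimeSpectrum F[X]).asIdeal ↔ f.eval t = 0 := fun f =>
    mem_asIdeal_closedPoint_iff (CommRingCat.ofHom (evalRingHom t)) f
  constructor
  · intro hx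
    have hprime := PrimeSpectrum.isPrime (x : PrimeSpectrum F[X])
    refine PrimeSpectrum.ext (Ideal.ext fun f => ?_)
    refine Iff.trans ?_ (hmem f).symm
    have h1 : f - C (f.eval t) ∈ (x : PrimeSpectrum F[X]).asIdeal :=
      Ideal.mem_of_dvd _ (X_sub_C_dvd_sub_C_eval) hx
    constructor
    · intro hf
      by_contra h0
      refine hprime.ne_top (Ideal.eq_top_of_isUnit_mem _ ?_ (isUnit_C.2 (isUnit_iff_ne_zero.2 h0)))
      simpa using Ideal.sub_mem _ hf h1
    · intro hf
      simpa [hf] using h1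
  · rintro rfl
    rw [hmem]
    simp

lemma isClosed_singleton_spec_map_closedPoint {F : Type u} [Field F] {A : CommRingCat.{u}}
    (φ : A ⟶ .of F) (hφ : Function.Surjective φ.hom) :
    IsClosed {Spec.map φ (IsLocalRing.closedPoint F)} := by
  refine (PrimeSpectrum.isClosed_singleton_iff_isMaximal _).2 ?_
  have h : RingHom.ker φ.hom = (Spec.map φ (IsLocalRing.closedPoint F) :
      PrimeSpectrum A).asIdeal := by
    ext a
    exact (mem_asIdeal_closedPoint_iff φ a).symm
  rw [← h]
  exact RingHom.ker_isMaximal_of_surjective _ hφ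

/-- An ideal contained in every prime does not affect the spectrum; this replaces the coordinate
ring of a possibly non-reduced `B'` by a domain. -/
lemma existsUnique_primeSpectrum_of_quotient {A : Type*} [CommRing A] (N : Ideal A)
    (hN : ∀ x : PrimeSpectrum A, N ≤ x.asIdeal) (a : A)
    (h : ∃! Q : Ideal (A ⧸ N), Q.IsPrime ∧ Ideal.Quotient.mk N a ∈ Q) :
    ∃! x : PrimeSpectrum A, a ∈ x.asIdeal := by
  obtain ⟨Q, ⟨hQ, haQ⟩, huniq⟩ := h
  have hcomap : ∀ x : PrimeSpectrum A,
      (x.asIdeal.map (Ideal.Quotient.mk N)).comap (Ideal.Quotient.mk N) = x.asIdeal := by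
    intro x
    rw [Ideal.comap_map_of_surjective _ Ideal.Quotient.mk_surjective, ← RingHom.ker_eq_comap_bot,
      Ideal.mk_ker, sup_eq_left]
    exact hN x
  refine ⟨⟨Q.comap (Ideal.Quotient.mk N), inferInstance⟩, haQ, fun x hx => ?_⟩
  refine PrimeSpectrum.ext ?_
  rw [← hcomap x, huniq _ ⟨?_, Ideal.mem_map_of_mem _ hx⟩]
  refine Ideal.map_isPrime_of_surjective Ideal.Quotient.mk_surjective ?_
  rw [Ideal.mk_ker]
  exact hN x

/-- The rational points of the affine line over `ℚ` are not sparse. -/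
theorem not_isSparse_rationalClosedPoints {Y : Scheme.{0}} [IrreducibleSpace Y]
    {s : Y ⟶ Spec (.of ℚ)} (ι : Spec (.of ℚ[X]) ⟶ Y) [IsIso ι]
    (hι : ι ≫ s = Spec.map (CommRingCat.ofHom C)) : ¬ IsSparse s (rationalClosedPoints s) := by
  rintro ⟨B', s', π, -, hirr, -, hdom, ⟨V, ⟨v, hv⟩, hfin⟩, hS⟩
  have hηV : genericPoint Y ∈ V := (genericPoint_specializes v).mem_open V.2 hv
  have hηι : genericPoint Y ∈ Set.range ι := ι.homeomorph.surjective _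
  obtain ⟨q, hq⟩ := hηι
  obtain ⟨_, ⟨_, ⟨g, rfl⟩, rfl⟩, hqg, hgV⟩ :=
    PrimeSpectrum.isBasis_basic_opens.exists_subset_of_mem_open
      (show q ∈ ((ι ⁻¹ᵁ V : (Spec (.of ℚ[X])).Opens) : Set (Spec (.of ℚ[X]))) from
        (show ι q ∈ V from hq.symm ▸ hηV)) (ι ⁻¹ᵁ V).2
  have hg : g ≠ 0 := by
    rintro rfl
    exact hqg (zero_mem _)
  let R' := Localization.Away g
  let loc : CommRingCat.of ℚ[X] ⟶ .of R' := CommRingCat.ofHom (algebraMap ℚ[X] R')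
  have hloc : Set.range (Spec.map loc) = (PrimeSpectrum.basicOpen g : Set (PrimeSpectrum ℚ[X])) :=
    PrimeSpectrum.localization_away_comap_range R' g
  have : IsOpenImmersion (Spec.map loc) :=
    inferInstanceAs (IsOpenImmersion (Spec.map (CommRingCat.ofHom (algebraMap ℚ[X] R'))))
  obtain ⟨A, κ', ρ, hκ', hρ, hcomm, hrange⟩ :=
    exists_finite_of_isFinite_morphismRestrict π V hfin (Spec.map loc ≫ ι) (by
      rintro _ ⟨z, rfl⟩
      exact hgV (hloc ▸ ⟨z, rfl⟩))
  have hcommx : ∀ x : Spec A, π (κ' x) = ι (Spec.map loc (Spec.map ρ x)) := fun x =>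
    (congrArg (fun f : Spec A ⟶ Y => f x) hcomm).symm
  obtain ⟨z, hz⟩ : genericPoint B' ∈ Set.range κ' := by
    rw [hrange]
    rw [Set.mem_preimage, map_genericPoint_of_isDominant]
    obtain ⟨q', hq'⟩ : q ∈ Set.range (Spec.map loc) := hloc ▸ hqg
    exact ⟨q', by rw [← hq, ← hq']; rfl⟩
  -- The prime of the generic point lies in all others, so the quotient by it is a domain with the
  -- same spectrum.
  have hzle : ∀ x : Spec A, (z : PrimeSpectrum A).asIdeal ≤ (x : PrimeSpectrum A).asIdeal := by
    intro x
    refine (PrimeSpectrum.le_iff_specializes _ _).2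
      (κ'.isOpenEmbedding.isInducing.specializes_iff.1 ?_)
    rw [hz]
    exact genericPoint_specializes _
  -- By dominance the generic point lies over the zero ideal of `R'`, which makes `R' → A ⧸ N`
  -- injective.
  have hzbot : ∀ x : Spec (.of R'), (Spec.map ρ z : PrimeSpectrum R').asIdeal ≤
      (x : PrimeSpectrum R').asIdeal := by
    intro x
    refine (PrimeSpectrum.le_iff_specializes _ _).2
      ((Spec.map loc ≫ ι).isOpenEmbedding.isInducing.specializes_iff.1 ?_)
    have : (Spec.map loc ≫ ι) (Spec.map ρ z) = genericPoint Y := by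
      rw [← map_genericPoint_of_isDominant π, ← hz]
      exact (hcommx z).symm
    rw [this]
    exact genericPoint_specializes _
  have hR' : IsDomain R' := IsLocalization.isDomain_localization
    (powers_le_nonZeroDivisors_of_noZeroDivisors hg)
  -- the reduced coordinate ring
  let N : Ideal A := (z : PrimeSpectrum A).asIdeal
  have hN : N.IsPrime := PrimeSpectrum.isPrime (z : PrimeSpectrum A)
  let M := A ⧸ N
  let _ : Algebra R' M := ((Ideal.Quotient.mk N).comp ρ.hom).toAlgebra
  let _ : Algebra ℚ[X] M := ((algebraMap R' M).comp (algebraMap ℚ[X] R')).toAlgebra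
  have : IsScalarTower ℚ[X] R' M := IsScalarTower.of_algebraMap_eq fun _ => rfl
  have : Module.Finite R' M :=
    RingHom.Finite.comp (RingHom.Finite.of_surjective _ Ideal.Quotient.mk_surjective) hρ
  have : FaithfulSMul R' M := by
    rw [faithfulSMul_iff_algebraMap_injective, injective_iff_map_eq_zero]
    intro r hr
    have h1 : ρ.hom r ∈ N := Ideal.Quotient.eq_zero_iff_mem.1 hr
    exact hzbot (⟨⊥, Ideal.isPrime_bot⟩ : PrimeSpectrum R') h1
  -- Hilbert irreducibility supplies a rational `t` in the open subset with a single prime above it;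
  -- its fiber in `B'` is one point, neither empty nor containing two closed points.
  obtain ⟨t, ht, hQ⟩ := exists_existsUnique_prime (R' := R') (M := M) hg
  obtain ⟨P, hP, hPu⟩ := existsUnique_primeSpectrum_of_quotient N hzle
    (ρ.hom (algebraMap ℚ[X] R' (X - C t))) hQ
  -- the rational point with singleton fiber
  let ε : CommRingCat.of ℚ[X] ⟶ .of ℚ := CommRingCat.ofHom (evalRingHom t)
  let bt : Spec (.of ℚ[X]) := Spec.map ε (IsLocalRing.closedPoint ℚ)
  let x : Points (RingHom.id ℚ) s := ⟨Spec.map ε ≫ ι,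
    (spec_map_comp_comp_eq_iff s ι hι.symm ε _).2 fun r => eval_C⟩
  have hx : x.point = ι bt := Points.point_eq ι _ x rfl
  have hbt : ι bt ∈ closedPoints Y := by
    have := ι.isClosedEmbedding.isClosedMap _ (isClosed_singleton_spec_map_closedPoint ε fun r =>
      ⟨C r, eval_C⟩)
    rwa [Set.image_singleton] at this
  have hiff : ∀ y : Spec A, π (κ' y) = ι bt ↔
      ρ.hom (algebraMap ℚ[X] R' (X - C t)) ∈ (y : PrimeSpectrum A).asIdeal := by
    intro y
    rw [hcommx, ι.isOpenEmbedding.injective.eq_iff]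
    exact (X_sub_C_mem_asIdeal_iff t (Spec.map loc (Spec.map ρ y))).symm
  have hfiber : π ⁻¹' {ι bt} = {κ' P} := by
    ext w
    constructor
    · intro hw
      have hw' : π w = ι bt := hw
      have hbg : bt ∈ Set.range (Spec.map loc) := by
        rw [hloc]
        exact fun h0 => ht ((mem_asIdeal_closedPoint_iff ε g).1 h0)
      obtain ⟨y, rfl⟩ : w ∈ Set.range κ' := by
        rw [hrange]
        obtain ⟨u, hu⟩ := hbg
        exact ⟨u, by rw [hw', ← hu]; rfl⟩
      rw [hPu y ((hiff y).1 hw')]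
      rfl
    · rintro rfl
      exact (hiff P).2 hP
  rcases hS ⟨ι bt, hbt⟩ ⟨x, hx⟩ with h | h
  · rw [hfiber] at h
    exact Set.singleton_ne_empty _ h
  · rw [hfiber] at h
    exact (Set.subsingleton_singleton.anti Set.inter_subset_left).not_nontrivial h

end NonSparse

end SparseDense

theorem proposition8 :
    -- part (i)
    (∀ (p : ℕ) [Fact p.Prime] (F : Type) [Field F] [NumberField F]
      (i : F →+* AlgebraicClosure ℚ) (j : AlgebraicClosure ℚ →+* ℂ_[p])
      (B' B : Scheme.{0}) [IrreducibleSpace B'] [IrreducibleSpace B]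
      (s' : B' ⟶ Spec (.of F)) (s : B ⟶ Spec (.of F)) (π : B' ⟶ B),
      IsVariety s' → IsVariety s → π ≫ s = s' → IsDominant π → IsGenericallyFinite π →
      0 < topologicalKrullDim B → 1 < genericDegree π →
      IsSparse s (nonSingletonFibers π) ∧
      Dense (Points.map j '' associatedPoints i s (nonSingletonFibers π))) ∧
    -- part (ii)
    (∃ S : Set (closedPoints 𝔸(Fin 1; Spec (.of ℚ))),
      S = rationalClosedPoints (𝔸(Fin 1; Spec (.of ℚ)) ↘ Spec (.of ℚ)) ∧
      ¬ IsSparse (𝔸(Fin 1; Spec (.of ℚ)) ↘ Spec (.of ℚ)) S ∧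
      ∀ (p : ℕ) [Fact p.Prime] (i : ℚ →+* AlgebraicClosure ℚ)
        (j : AlgebraicClosure ℚ →+* ℂ_[p]),
        IsNowhereDense (Points.map j ''
          associatedPoints i (𝔸(Fin 1; Spec (.of ℚ)) ↘ Spec (.of ℚ)) S)) := by
  refine ⟨fun p _ F _ _ i j B' B _ _ s' s π hs' hs hπ hdom hfin hdim hdeg =>
    ⟨isSparse_nonSingletonFibers π hs' hπ hdom hfin, ?_⟩, _, rfl, ?_, fun p _ i j => ?_⟩
  · let _ : Algebra F ℂ_[p] := (j.comp i).toAlgebra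
    have hp : p.Prime := Fact.out
    -- The small element of `F` is `p` itself, of norm `p⁻¹` in `ℂ_[p]`.
    refine dense_map_associatedPoints i j (dense_isIntegral_padicComplex p F) (ϖ := (p : F))
      (Nat.cast_ne_zero.2 hp.ne_zero) ?_ π hs' hs hπ hdim hdeg
    rw [map_natCast, map_natCast, ← map_natCast (algebraMap ℚ_[p] ℂ_[p]) p,
      norm_algebraMap', Padic.norm_p]
    exact inv_lt_one_of_one_lt₀ (by exact_mod_cast hp.one_lt)
  · obtain ⟨ι, _, hι⟩ := exists_isIso_affineLine ℚ
    have : IsIntegral 𝔸(Fin 1; Spec (.of ℚ)) := isIntegral_of_isOpenImmersion (inv ι)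
    exact not_isSparse_rationalClosedPoints ι hι
  · obtain ⟨ι, _, hι⟩ := exists_isIso_affineLine ℚ
    exact isNowhereDense_map_associatedPoints ι hι p i j
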